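/- \textbf{Setting.} Let $(E,\|\cdot\|)$ be a real separable Banach space, $(\Omega,\mathcal F,\{\mathcal F_t\}_{t\ge0},\mathbb P)$ a filtered probability space, and $\{X_t\}_{t\ge 0}$ an $E$-valued time-homogeneous Markov process with respect to $\{\mathcal F_t\}$; $X^x_{s,t}$ denotes its value at time $t\ge s$ when started from $x$ at time $s$, $X^x_t:=X^x_{0,t}$ and $P_tf(x):=\mathbb E[f(X^x_t)]$. Let $\tau_0=0$, $\tau_k>0$ $(k\ge1)$, $t_n:=\sum_{k=0}^n\tau_k$, with $\tau_k\to0$ and $t_n\to\infty$. Let $Y^{\tau}$ be an $E$-valued (possibly non-homogeneous) Markov chain with respect to $\{\mathcal F_{t_k}\}_{k\in\mathbb N}$; $Y^{x,\tau}_{t_m,t_n}$ denotes its value at time $t_n\ge t_m$ when started from $x$ at time $t_m$, and $Y^{x,\tau}_{t_n}:=Y^{x,\tau}_{t_0,t_n}$. \textbf{Assumptions.} There are positive constants $L_1,\dots,L_6$ such that the following bounds hold for all $x,y\in E$. (A1) There are $r\ge2$, $\tilde r\ge1$, $\gamma_1\in(0,1]$, $\beta\in[0,r-1]$, $l\in[0,r]$,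 $\tilde l\in(0,1]$ and a continuous $\rho:[0,\infty)\to[0,\infty)$ with $\int_0^\infty\rho(t)^{\gamma_1}dt<\infty$ and $\sum_{k\ge1}\rho(k)^{\gamma_1}<\infty$ such that for all $t\ge0$: $\mathbb E\|X^x_t\|^r\le L_1(1+\|x\|^{\tilde rr})$; $(\mathbb E\|X^x_t-X^y_t\|^2)^{1/2}\le L_2\|x-y\|(1+\|x\|^\beta+\|y\|^\beta)\rho(t)$; $(\mathbb E\|X^x_t-x\|^2)^{1/2}\le L_3(1+\|x\|^l)t^{\tilde l}$. (A2) There are $q\ge2$, $\tilde q\ge1$, $\kappa\in[0,q-1]$ and $\rho^\tau:[0,\infty)\to[0,\infty)$ such that for all $n\ge m\ge0$: $\mathbb E\|Y^{x,\tau}_{t_m,t_n}\|^q\le L_4(1+\|x\|^{\tilde qq})$; $(\mathbb E\|Y^{x,\tau}_{t_m,t_n}-Y^{y,\tau}_{t_m,t_n}\|^2)^{1/2}\le L_5\|x-y\|(1+\|x\|^\kappa+\|y\|^\kappa)\rho^\tau(t_n-t_m)$. (A3) There is $\alpha\ge0$ such that for all $n\ge m\ge1$: $(\mathbb E\|X^x_{t_m,t_n}-Y^{x,\tau}_{t_m,t_n}\|^2)^{1/2}\le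 L_6(1+\|x\|^{\tilde r\vee\tilde q})\tau_n^\alpha$. Let $\mu$ be the invariant probability measure of $X$, $\mu(f):=\int f\,d\mu$, and $\tilde d:=(1+\beta)\vee\tilde r\vee\tilde q$. For $p\ge1$ and $\gamma\in(0,1]$ let $\mathcal C_{p,\gamma}$ be the set of measurable $f:E\to\mathbb R$ with $$\sup_u\frac{|f(u)|}{1+\|u\|^{p/2}}+\sup_{u_1\ne u_2}\frac{|f(u_1)-f(u_2)|}{(1\wedge\|u_1-u_2\|^\gamma)(1+\|u_1\|^p+\|u_2\|^p)^{1/2}}<\infty.$$ For $k\in\mathbb N$ let $n_{(k)}$ be the index with $t_{n_{(k)}}\le k<t_{n_{(k)}+1}$, $\tilde t_k:=t_{n_{(k)}}$, and for $f\in\mathcal C_{p,\gamma}$, $x\in E$ let $$\mathscr M_k:=\sum_{i=0}^\infty\tau_i\big(\mathbb E[f(Y^{x,\tau}_{t_i})|\mathcal F_{t_k}]-\mu(f)\big)-\sum_{i=0}^\infty\tau_i\big(\mathbb E[f(Y^{x,\tau}_{t_i})|\mathcal F_0]-\mu(f)\big),$$ $\tilde{\mathscr M}_k:=\mathscr M_{n_{(k)}}$,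 $\tilde{\mathcal Z}_0:=0$, $\tilde{\mathcal Z}_k:=\tilde{\mathscr M}_k-\tilde{\mathscr M}_{k-1}$ for $k\ge1$. \textbf{Proposition.} Assume (A1)--(A3). Let $p\in[1,r\wedge q]$ and $\gamma\in[\gamma_1,1]$ satisfy $\frac p2(1+\tilde r)+(1+\beta)\gamma_1\le r$, $\;p\tilde q+2\tilde d\gamma\le q$, $\;\frac p2+\frac{p\tilde q}2+\gamma(\tilde d\vee\kappa)\le r\wedge q$, and $\frac p2+\big([(\frac p2+\gamma)(\tilde r\vee\tilde q)]\vee[(\frac p2+l\gamma)\tilde r]\big)\le r$. Suppose that (i) $\sum_{k\ge1}\tau_k^{1+\gamma\alpha}<\infty$; (ii) $\sup_{k}\sum_{i\ge k}\tau_i\,\rho(t_i-t_k)^\gamma<\infty$; (iii) $\sup_{k}\sum_{i\ge k}\tau_i\,\rho^\tau(t_i-t_k)^\gamma<\infty$; (iv) $\lim_{n\to\infty}\big(\sum_{k=1}^n\tau_k\big)^{-1}\sum_{k=1}^n\tau_{k-1}\Big(\sum_{i\ge k-1}\tau_i^{\gamma\alpha}\tau_{i+1}+\sum_{i\ge k}\tau_i^{1+\tilde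 l\gamma}\Big)=0$. Then for every $f\in\mathcal C_{p,\gamma}$ and $x\in E$ the integrals defining $$v:=\sqrt{2\mu\Big((f-\mu(f))\int_0^\infty(P_tf-\mu(f))\,dt\Big)}$$ converge and the radicand is nonnegative, the series defining $\mathscr M_k$ converge absolutely almost surely, $\tilde{\mathcal Z}_k\in L^2(\mathbb P)$, and $$\lim_{N\to\infty}\frac1{\tilde t_N}\sum_{k=1}^N\mathbb E\big[|\tilde{\mathcal Z}_k|^2\big]=v^2 .$$ -/

import Mathlib

open MeasureTheory ProbabilityTheory Filter Topology
open scoped NNReal ENNReal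

noncomputable section

/-! ### Markov families -/

section Markov

variable {Ω E : Type*} {mΩ : MeasurableSpace Ω}

/-- The transition operator `P_{s,t} g (x) = 𝔼[g(Z_{s,t}^x)]` of a family of processes, where
`Z s t x` is the value at time `t` of the process that starts from `x` at time `s`. -/
def transOp {T : Type*} (P : Measure Ω) (Z : T → T → E → Ω → E) (s t : T) (g : E → ℝ) (x : E) : ℝ :=
  ∫ ω, g (Z s t x ω) ∂P

/-- `Z` is a (possibly time-inhomogeneous) Markov family with respect to the filtration `ℱ`:
`Z s t x`, `s ≤ t`, starts from `x` at time `s`, is adapted, its transition operators map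
bounded Borel functions to bounded Borel functions, and the Markov property holds. -/
structure IsMarkovFamily {T : Type*} [Preorder T] [MeasurableSpace E]
    (P : Measure Ω) (ℱ : Filtration T mΩ) (Z : T → T → E → Ω → E) : Prop where
  start : ∀ s x, ∀ᵐ ω ∂P, Z s s x ω = x
  adapted : ∀ s t x, s ≤ t → Measurable[ℱ t] (Z s t x)
  measurable_transOp : ∀ s t, s ≤ t → ∀ g : E → ℝ, Measurable g → (∃ C, ∀ y, |g y| ≤ C) →
    Measurable (transOp P Z s t g)
  markov : ∀ s u t x, s ≤ u → u ≤ t → ∀ g : E → ℝ, Measurable g → (∃ C, ∀ y, |g y| ≤ C) →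
    P[fun ω => g (Z s t x ω) | ℱ u] =ᵐ[P] fun ω => transOp P Z u t g (Z s u x ω)

/-- Time-homogeneity: the law of `X_{s,t}^x` is that of `X_{0,t-s}^x`. -/
def IsTimeHomogeneous [MeasurableSpace E] (P : Measure Ω) (X : ℝ≥0 → ℝ≥0 → E → Ω → E) : Prop :=
  ∀ s t x, s ≤ t → P.map (X s t x) = P.map (X 0 (t - s) x)

/-- `μ` is invariant: if the initial value is distributed according to `μ`,
then so is the value at every time `t ≥ 0`. -/
def IsInvariantMeasure [MeasurableSpace E] (P : Measure Ω) (X : ℝ≥0 → ℝ≥0 → E → Ω → E)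
    (μ : Measure E) : Prop :=
  ∀ (t : ℝ≥0) (A : Set E), MeasurableSet A → ∫⁻ x, P {ω | X 0 t x ω ∈ A} ∂μ = μ A

/-- `2 μ((f - μ(f)) ∫_0^∞ (P_t f - μ(f)) dt)`. -/
def asymptoticVariance [MeasurableSpace E] (P : Measure Ω) (X : ℝ≥0 → ℝ≥0 → E → Ω → E)
    (μ : Measure E) (f : E → ℝ) : ℝ :=
  2 * ∫ u, (f u - ∫ y, f y ∂μ) *
    (∫ t in Set.Ioi (0 : ℝ), (transOp P X 0 t.toNNReal f u - ∫ y, f y ∂μ)) ∂μ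

/-- The limit constant `v = √(2 μ((f - μ(f)) ∫_0^∞ (P_t f - μ(f)) dt))`. -/
def limitConst [MeasurableSpace E] (P : Measure Ω) (X : ℝ≥0 → ℝ≥0 → E → Ω → E)
    (μ : Measure E) (f : E → ℝ) : ℝ :=
  √(asymptoticVariance P X μ f)

end Markov

/-! ### Test functions -/

section TestFunctions

variable {E : Type*} [NormedAddCommGroup E]

/-- The quasi-metric `d_{p,γ}(u₁,u₂) = (1 ∧ ‖u₁-u₂‖^γ) (1 + ‖u₁‖^p + ‖u₂‖^p)^{1/2}`. -/
def quasiDist (p γ : ℝ) (u₁ u₂ : E) : ℝ :=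
  min 1 (‖u₁ - u₂‖ ^ γ) * √(1 + ‖u₁‖ ^ p + ‖u₂‖ ^ p)

/-- The class `C_{p,γ}`: measurable `f` for which both suprema in
`‖f‖_{p,γ} = sup |f(u)|/(1+‖u‖^{p/2}) + sup |f(u₁)-f(u₂)|/d_{p,γ}(u₁,u₂)` are finite. -/
def IsTestFunction [MeasurableSpace E] (p γ : ℝ) (f : E → ℝ) : Prop :=
  Measurable f ∧ (∃ K : ℝ, ∀ u, |f u| ≤ K * (1 + ‖u‖ ^ (p / 2))) ∧
    ∃ K : ℝ, ∀ u₁ u₂, |f u₁ - f u₂| ≤ K * quasiDist p γ u₁ u₂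

end TestFunctions

/-! ### Time grids -/

/-- The grid points `t_n = ∑_{k=0}^n τ_k`. -/
def gridTime (τ : ℕ → ℝ≥0) (n : ℕ) : ℝ≥0 := ∑ k ∈ Finset.range (n + 1), τ k

theorem gridTime_mono (τ : ℕ → ℝ≥0) : Monotone (gridTime τ) := fun m n h =>
  Finset.sum_le_sum_of_subset (Finset.range_mono (by omega))

/-- `τ` is an admissible time-step sequence: `τ_0 = 0` (so `t_0 = 0`), `τ_k > 0` for `k ≥ 1`,
`τ_k → 0` (hence `sup τ_k < ∞`) and `t_n → ∞`. -/
structure IsStepSequence (τ : ℕ → ℝ≥0) : Prop where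
  zero : τ 0 = 0
  pos : ∀ k, 1 ≤ k → 0 < τ k
  tendsto_zero : Tendsto τ atTop (𝓝 0)
  tendsto_atTop : Tendsto (gridTime τ) atTop atTop

/-- `n_(k)`, the index with `t_{n_(k)} ≤ k < t_{n_(k)+1}`, i.e. the largest `n` with `t_n ≤ k`. -/
def quasiIndex (τ : ℕ → ℝ≥0) (k : ℕ) : ℕ := sSup {n : ℕ | gridTime τ n ≤ k}

/-- The quasi-uniform subsequence `t̃_k = t_{n_(k)}`. -/
def quasiTime (τ : ℕ → ℝ≥0) (k : ℕ) : ℝ≥0 := gridTime τ (quasiIndex τ k)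

theorem quasiIndex_spec {τ : ℕ → ℝ≥0} (hτ : IsStepSequence τ) (k : ℕ) :
    gridTime τ (quasiIndex τ k) ≤ k ∧ (k : ℝ≥0) < gridTime τ (quasiIndex τ k + 1) := by
  have hne : {n : ℕ | gridTime τ n ≤ k}.Nonempty := ⟨0, by simp [gridTime, hτ.zero]⟩
  have hbdd : BddAbove {n : ℕ | gridTime τ n ≤ k} := by
    obtain ⟨N, hN⟩ := (hτ.tendsto_atTop.eventually_gt_atTop (k : ℝ≥0)).exists
    refine ⟨N, fun n hn => ?_⟩
    by_contra h
    exact absurd (lt_of_lt_of_le hN ((gridTime_mono τ (le_of_not_ge h)).trans hn)) (lt_irrefl _)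
  refine ⟨Nat.sSup_mem hne hbdd, ?_⟩
  by_contra h
  have h2 : quasiIndex τ k + 1 ≤ quasiIndex τ k := le_csSup hbdd (not_lt.mp h)
  omega

/-- The filtration `{ℱ_{t_k}}_{k ∈ ℕ}` along the grid. -/
def gridFiltration {Ω : Type*} {mΩ : MeasurableSpace Ω} (ℱ : Filtration ℝ≥0 mΩ) (τ : ℕ → ℝ≥0) :
    Filtration ℕ mΩ where
  seq k := ℱ (gridTime τ k)
  mono' _ _ h := ℱ.mono (gridTime_mono τ h)
  le' _ := ℱ.le _

/-! ### Assumptions -/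

section Assumptions

variable {Ω E : Type*} {mΩ : MeasurableSpace Ω} [NormedAddCommGroup E]

/-- Moment bound, attractiveness and time regularity of the exact process, `X_t^x = X 0 t x`. -/
structure ExactAssumption (P : Measure Ω) (X : ℝ≥0 → ℝ≥0 → E → Ω → E)
    (r r' γ₁ β l l' : ℝ) (ρ : ℝ≥0 → ℝ≥0) : Prop where
  r_ge : 2 ≤ r
  r'_ge : 1 ≤ r'
  moment : ∃ L > 0, ∀ (x : E) (t : ℝ≥0),
    ∫⁻ ω, ‖X 0 t x ω‖ₑ ^ r ∂P ≤ ENNReal.ofReal (L * (1 + ‖x‖ ^ (r' * r)))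
  γ₁_pos : 0 < γ₁
  γ₁_le : γ₁ ≤ 1
  β_nonneg : 0 ≤ β
  β_le : β ≤ r - 1
  ρ_cont : Continuous ρ
  ρ_integrable : IntegrableOn (fun t : ℝ => (ρ t.toNNReal : ℝ) ^ γ₁) (Set.Ioi 0)
  ρ_summable : Summable fun k : ℕ => (ρ ((k + 1 : ℕ) : ℝ≥0) : ℝ) ^ γ₁
  attractive : ∃ L > 0, ∀ (x y : E) (t : ℝ≥0),
    eLpNorm (fun ω => X 0 t x ω - X 0 t y ω) 2 P
      ≤ ENNReal.ofReal (L * ‖x - y‖ * (1 + ‖x‖ ^ β + ‖y‖ ^ β) * ρ t)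
  l_nonneg : 0 ≤ l
  l_le : l ≤ r
  l'_pos : 0 < l'
  l'_le : l' ≤ 1
  regular : ∃ L > 0, ∀ (x : E) (t : ℝ≥0),
    eLpNorm (fun ω => X 0 t x ω - x) 2 P ≤ ENNReal.ofReal (L * (1 + ‖x‖ ^ l) * (t : ℝ) ^ l')

/-- Moment bound and attractiveness of the approximation, `Y_{t_m,t_n}^x = Y m n x`. -/
structure ApproxAssumption (P : Measure Ω) (Y : ℕ → ℕ → E → Ω → E) (τ : ℕ → ℝ≥0)
    (q q' κ : ℝ) (ρτ : ℝ≥0 → ℝ≥0) : Prop where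
  q_ge : 2 ≤ q
  q'_ge : 1 ≤ q'
  moment : ∃ L > 0, ∀ (x : E) (m k : ℕ), m ≤ k →
    ∫⁻ ω, ‖Y m k x ω‖ₑ ^ q ∂P ≤ ENNReal.ofReal (L * (1 + ‖x‖ ^ (q' * q)))
  κ_nonneg : 0 ≤ κ
  κ_le : κ ≤ q - 1
  attractive : ∃ L > 0, ∀ (x y : E) (m n : ℕ), m ≤ n →
    eLpNorm (fun ω => Y m n x ω - Y m n y ω) 2 P
      ≤ ENNReal.ofReal
          (L * ‖x - y‖ * (1 + ‖x‖ ^ κ + ‖y‖ ^ κ) * ρτ (gridTime τ n - gridTime τ m))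

/-- Strong convergence of the approximation with order `α`. -/
structure ConvergenceAssumption (P : Measure Ω) (X : ℝ≥0 → ℝ≥0 → E → Ω → E)
    (Y : ℕ → ℕ → E → Ω → E) (τ : ℕ → ℝ≥0) (r' q' α : ℝ) : Prop where
  α_nonneg : 0 ≤ α
  bound : ∃ L > 0, ∀ (x : E) (m n : ℕ), 1 ≤ m → m ≤ n →
    eLpNorm (fun ω => X (gridTime τ m) (gridTime τ n) x ω - Y m n x ω) 2 P
      ≤ ENNReal.ofReal (L * (1 + ‖x‖ ^ (max r' q')) * (τ n : ℝ) ^ α)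

end Assumptions

/-- The step conditions (i)-(iv). All series have nonnegative terms and are taken in `[0,∞]`,
except for (i); an index `i ≥ k` is written as `k + i`, and in (iv) the outer index `k ≥ 1`
as `k + 1`. -/
structure StepConditions (τ : ℕ → ℝ≥0) (ρ ρτ : ℝ≥0 → ℝ≥0) (γ α l' : ℝ) : Prop where
  cond_i : Summable fun k : ℕ => (τ (k + 1) : ℝ) ^ (1 + γ * α)
  cond_ii : (⨆ k : ℕ, ∑' i : ℕ,
    (τ (k + i) : ℝ≥0∞) * (ρ (gridTime τ (k + i) - gridTime τ k) : ℝ≥0∞) ^ γ) < ∞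
  cond_iii : (⨆ k : ℕ, ∑' i : ℕ,
    (τ (k + i) : ℝ≥0∞) * (ρτ (gridTime τ (k + i) - gridTime τ k) : ℝ≥0∞) ^ γ) < ∞
  cond_iv : Tendsto (fun n : ℕ => (∑ k ∈ Finset.range n, (τ k : ℝ≥0∞) *
      ((∑' i : ℕ, (τ (k + i) : ℝ≥0∞) ^ (γ * α) * (τ (k + i + 1) : ℝ≥0∞))
        + ∑' i : ℕ, (τ (k + 1 + i) : ℝ≥0∞) ^ (1 + l' * γ)))
      / (gridTime τ n : ℝ≥0∞)) atTop (𝓝 0)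

/-! ### The predominant martingale -/

section Martingale

variable {Ω E : Type*} {mΩ : MeasurableSpace Ω} [MeasurableSpace E]

/-- The terms `τ_i (𝔼[f(Y_{t_i}^x) | ℱ_{t_k}] - μ(f))`. -/
def martTerm (P : Measure Ω) (ℱ : Filtration ℝ≥0 mΩ) (τ : ℕ → ℝ≥0) (Y : ℕ → ℕ → E → Ω → E)
    (μ : Measure E) (f : E → ℝ) (x : E) (k i : ℕ) (ω : Ω) : ℝ :=
  (τ i : ℝ) * ((P[fun ω' => f (Y 0 i x ω') | gridFiltration ℱ τ k]) ω - ∫ y, f y ∂μ)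

/-- `M_k = ∑_i τ_i (𝔼[f(Y_{t_i}^x) | ℱ_{t_k}] - μ(f)) - ∑_i τ_i (𝔼[f(Y_{t_i}^x) | ℱ_0] - μ(f))`. -/
def mart (P : Measure Ω) (ℱ : Filtration ℝ≥0 mΩ) (τ : ℕ → ℝ≥0) (Y : ℕ → ℕ → E → Ω → E)
    (μ : Measure E) (f : E → ℝ) (x : E) (k : ℕ) (ω : Ω) : ℝ :=
  (∑' i, martTerm P ℱ τ Y μ f x k i ω) - ∑' i, martTerm P ℱ τ Y μ f x 0 i ω

/-- The predominant martingale `M̃_k = M_{n_(k)}`. -/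
def quasiMart (P : Measure Ω) (ℱ : Filtration ℝ≥0 mΩ) (τ : ℕ → ℝ≥0) (Y : ℕ → ℕ → E → Ω → E)
    (μ : Measure E) (f : E → ℝ) (x : E) (k : ℕ) (ω : Ω) : ℝ :=
  mart P ℱ τ Y μ f x (quasiIndex τ k) ω

/-- The martingale differences `Z̃_0 = 0`, `Z̃_k = M̃_k - M̃_{k-1}` for `k ≥ 1`. -/
def quasiDiff (P : Measure Ω) (ℱ : Filtration ℝ≥0 mΩ) (τ : ℕ → ℝ≥0) (Y : ℕ → ℕ → E → Ω → E)
    (μ : Measure E) (f : E → ℝ) (x : E) : ℕ → Ω → ℝ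
  | 0, _ => 0
  | k + 1, ω => quasiMart P ℱ τ Y μ f x (k + 1) ω - quasiMart P ℱ τ Y μ f x k ω

end Martingale

end

/-! Write `F_i = f(Y_{t_i}) - μ(f)` and `T_k = ∑_i τ_i E[F_i | ℱ_{t_k}]`. In `L²` the increments of
`T` are orthogonal to the past. Removing from `T_k` the terms already known at `t_k` leaves the
corrector `W_k = T_k - ∑_{i<k} τ_i F_i = ∑_{i≥k} τ_i E[F_i | ℱ_{t_k}]`, whose norm is bounded. `T`
and `W` have the same martingale increments, so these cancel when the squared norms are compared,
and `E|T_n - T_0|² = 2 ∑_{k<n} τ_k E[F_k W_k] - ∑_{k<n} τ_k² E[F_k²] + O(1)`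
(`norm_sq_sub_norm_sq_eq`, `exists_second_moment_martingale`). No conditional variance has to be
computed. Divided by `t_n`, the second sum vanishes because `τ_k → 0`.

By the Markov property `W_k = ψ_k(Y_{t_k})`, where `ψ_k` is a sum over the grid of transition
operators of `Y`. It is close to `φ(y) = ∫_0^∞ (P_t f(y) - μ(f)) dt`: replacing `Y` by `X` costs a
tail of `∑ τ_i^{1+γα}`, and replacing the Riemann sum by the integral costs `τ_k` and a tail of `∑
τ_i^{1+l'γ}` (`abs_tsum_sub_integral_le`). These costs vanish on average by (i) and (iv). Their
constants may grow faster in `y` than the moments allow, so they are used on bounded sets only;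
elsewhere a cruder bound of growth order below `q` suffices (`le_eta_add_of_wt_bounds`).

It remains to average `E[h(Y_{t_k})]` with `h = (f - μ(f)) φ`. The weighted empirical laws of `Y`
converge weakly to `μ` and have bounded `q`-th moments, while `h` is continuous of growth order
below `q`; hence the averages tend to `μ(h)` (`lipschitzTendsto_empiricalLaw`,
`LipschitzTendsto.tendsto_of_growth`). The limit `2 μ(h)` is the radicand `v²`, nonnegative as a
limit of nonnegative numbers. Orthogonality telescopes the sum of `E|Z̃_k|²`, so the subsequence
`n_(k)` costs nothing.

The decay underlying all of this combines attractiveness, invariance of `μ` and strong convergence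
(`decayBound_of_le`). It needs moments of `X` with the growth rate of those of `Y`, which
`ConvergenceAssumption.momentLE_exact` provides. -/

noncomputable section

/-! ### Polynomial weights and moments -/

section Weights

variable {Ω E : Type*} {mΩ : MeasurableSpace Ω} [NormedAddCommGroup E]

/-- The weight `1 + ‖y‖`. -/
def wt (y : E) : ℝ := 1 + ‖y‖

theorem one_le_wt (y : E) : 1 ≤ wt y := by simp [wt]

theorem wt_pos (y : E) : 0 < wt y := one_pos.trans_le (one_le_wt y)

theorem norm_le_wt (y : E) : ‖y‖ ≤ wt y := by simp [wt]

theorem continuous_wt : Continuous (wt : E → ℝ) := by unfold wt; fun_prop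

theorem continuous_wt_rpow (s : ℝ) : Continuous fun y : E => wt y ^ s :=
  continuous_wt.rpow_const fun y => Or.inl (wt_pos y).ne'

theorem measurable_wt_rpow [MeasurableSpace E] [BorelSpace E] (s : ℝ) :
    Measurable fun y : E => wt y ^ s :=
  (continuous_wt_rpow s).measurable

theorem wt_rpow_pos (y : E) (s : ℝ) : 0 < wt y ^ s := Real.rpow_pos_of_pos (wt_pos y) s

theorem wt_rpow_mono (y : E) {s t : ℝ} (h : s ≤ t) : wt y ^ s ≤ wt y ^ t :=
  Real.rpow_le_rpow_of_exponent_le (one_le_wt y) h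

theorem one_le_wt_rpow (y : E) {s : ℝ} (h : 0 ≤ s) : 1 ≤ wt y ^ s :=
  Real.one_le_rpow (one_le_wt y) h

theorem norm_rpow_le_wt_rpow (y : E) {s : ℝ} (h : 0 ≤ s) : ‖y‖ ^ s ≤ wt y ^ s :=
  Real.rpow_le_rpow (norm_nonneg y) (norm_le_wt y) h

theorem one_add_norm_rpow_le (y : E) {s : ℝ} (h : 0 ≤ s) : 1 + ‖y‖ ^ s ≤ 2 * wt y ^ s := by
  linarith [one_le_wt_rpow y h, norm_rpow_le_wt_rpow y h]

theorem wt_rpow_le (y : E) {s : ℝ} (h : 0 ≤ s) : wt y ^ s ≤ 2 ^ s * (1 + ‖y‖ ^ s) := by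
  rcases le_total ‖y‖ 1 with h1 | h1
  · calc wt y ^ s ≤ 2 ^ s := Real.rpow_le_rpow (wt_pos y).le (by unfold wt; linarith) h
      _ ≤ _ := le_mul_of_one_le_right (by positivity)
        (by linarith [Real.rpow_nonneg (norm_nonneg y) s])
  · calc wt y ^ s ≤ (2 * ‖y‖) ^ s :=
        Real.rpow_le_rpow (wt_pos y).le (by unfold wt; linarith) h
      _ = 2 ^ s * ‖y‖ ^ s := Real.mul_rpow (by norm_num) (norm_nonneg y)
      _ ≤ _ := by gcongr; linarith

/-- `U` has a moment of order `s` bounded by `C`, in terms of the weight `1 + ‖·‖`. -/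
def MomentLE (P : Measure Ω) (U : Ω → E) (s C : ℝ) : Prop :=
  Integrable (fun ω => wt (U ω) ^ s) P ∧ ∫ ω, wt (U ω) ^ s ∂P ≤ C

theorem MomentLE.mono {P : Measure Ω} {U : Ω → E} {s C C' : ℝ} (h : MomentLE P U s C)
    (hC : C ≤ C') : MomentLE P U s C' := ⟨h.1, h.2.trans hC⟩

theorem MomentLE.nonneg {P : Measure Ω} {U : Ω → E} {s C : ℝ} (h : MomentLE P U s C) : 0 ≤ C :=
  (integral_nonneg fun ω => (wt_rpow_pos (U ω) s).le).trans h.2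

theorem MomentLE.one_le {P : Measure Ω} [IsProbabilityMeasure P] {U : Ω → E} {s C : ℝ}
    (hs : 0 ≤ s) (h : MomentLE P U s C) : 1 ≤ C := by
  refine le_trans ?_ h.2
  calc (1 : ℝ) = ∫ _, (1 : ℝ) ∂P := by simp
    _ ≤ _ := integral_mono (integrable_const _) h.1 fun ω => one_le_wt_rpow _ hs

theorem momentLE_const {P : Measure Ω} [IsProbabilityMeasure P] (y : E) (s : ℝ) :
    MomentLE P (fun _ => y) s (wt y ^ s) := ⟨integrable_const _, by simp⟩

theorem integral_rpow_le {P : Measure Ω} [IsProbabilityMeasure P] {g : Ω → ℝ} (hg : 0 ≤ g)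
    (hi : Integrable g P) {θ : ℝ} (h0 : 0 ≤ θ) (h1 : θ ≤ 1) :
    Integrable (fun ω => g ω ^ θ) P ∧ ∫ ω, g ω ^ θ ∂P ≤ (∫ ω, g ω ∂P) ^ θ := by
  have hint : Integrable (fun ω => g ω ^ θ) P := by
    refine Integrable.mono' ((integrable_const (1 : ℝ)).add hi)
      (hi.aestronglyMeasurable.aemeasurable.pow_const θ).aestronglyMeasurable
      (Eventually.of_forall fun ω => ?_)
    rw [Real.norm_of_nonneg (Real.rpow_nonneg (hg ω) θ)]
    have : (0 : ℝ) ≤ g ω := hg ω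
    rcases le_total (g ω) 1 with h | h
    · exact (Real.rpow_le_one this h h0).trans (by simpa using this)
    · exact (Real.rpow_le_self_of_one_le h h1).trans (by simp)
  refine ⟨hint, ?_⟩
  exact (Real.concaveOn_rpow h0 h1).le_map_integral
    (continuousOn_id.rpow_const fun x _ => Or.inr h0) isClosed_Ici
    (Eventually.of_forall fun ω => hg ω) hi hint

theorem MomentLE.mono_exp {P : Measure Ω} [IsProbabilityMeasure P] {U : Ω → E} {s q C : ℝ}
    (h : MomentLE P U q C) (hs : 0 ≤ s) (hsq : s ≤ q) (hq : 0 < q) :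
    MomentLE P U s (C ^ (s / q)) := by
  have := integral_rpow_le (fun ω => (wt_rpow_pos (U ω) q).le) h.1
    (θ := s / q) (by positivity) (by rw [div_le_one hq]; exact hsq)
  have e : ∀ ω, (wt (U ω) ^ q) ^ (s / q) = wt (U ω) ^ s := fun ω => by
    rw [← Real.rpow_mul (wt_pos _).le, mul_div_cancel₀ _ hq.ne']
  simp only [e] at this
  exact ⟨this.1, this.2.trans (Real.rpow_le_rpow
    (integral_nonneg fun ω => (wt_rpow_pos (U ω) q).le) h.2 (by positivity))⟩

theorem sq_integral_le_of_eLpNorm_le {P : Measure Ω} {U : Ω → E} (hU : AEStronglyMeasurable U P)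
    {a : ℝ} (ha : 0 ≤ a) (h : eLpNorm U 2 P ≤ ENNReal.ofReal a) :
    Integrable (fun ω => ‖U ω‖ ^ 2) P ∧ ∫ ω, ‖U ω‖ ^ 2 ∂P ≤ a ^ 2 := by
  have hm : MemLp U 2 P := ⟨hU, h.trans_lt ENNReal.ofReal_lt_top⟩
  have hi : Integrable (fun ω => ‖U ω‖ ^ 2) P := hm.integrable_norm_pow (by norm_num)
  refine ⟨hi, ?_⟩
  have h2 := hm.eLpNorm_eq_integral_rpow_norm (by norm_num) (by norm_num)
  rw [h2, ENNReal.ofReal_le_ofReal_iff ha] at h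
  simp only [ENNReal.toReal_ofNat, Real.rpow_ofNat] at h
  have h3 : 0 ≤ ∫ ω, ‖U ω‖ ^ 2 ∂P := integral_nonneg fun ω => by positivity
  calc ∫ ω, ‖U ω‖ ^ 2 ∂P = ((∫ ω, ‖U ω‖ ^ 2 ∂P) ^ (2⁻¹ : ℝ)) ^ 2 := by
        rw [← Real.rpow_natCast, ← Real.rpow_mul h3]; norm_num
    _ ≤ a ^ 2 := by gcongr

variable [MeasurableSpace E] [BorelSpace E]

theorem MomentLE.of_lintegral {P : Measure Ω} [IsProbabilityMeasure P] {U : Ω → E}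
    (hU : AEMeasurable U P) {s L : ℝ} (hs : 0 ≤ s) (hL : 0 ≤ L)
    (h : ∫⁻ ω, ‖U ω‖ₑ ^ s ∂P ≤ ENNReal.ofReal L) : MomentLE P U s (2 ^ s * (1 + L)) := by
  have e : ∀ ω, ‖U ω‖ₑ ^ s = ENNReal.ofReal (‖U ω‖ ^ s) := fun ω => by
    rw [← ENNReal.ofReal_rpow_of_nonneg (norm_nonneg _) hs, ofReal_norm]
  simp only [e] at h
  have hm : AEMeasurable (fun ω => ‖U ω‖ ^ s) P := hU.norm.pow_const s
  have hn : 0 ≤ᵐ[P] fun ω => ‖U ω‖ ^ s := Eventually.of_forall fun ω => by positivity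
  have hi : Integrable (fun ω => ‖U ω‖ ^ s) P := by
    refine ⟨hm.aestronglyMeasurable, ?_⟩
    rw [hasFiniteIntegral_iff_ofReal hn]
    exact h.trans_lt ENNReal.ofReal_lt_top
  have hi2 : Integrable (fun ω => 2 ^ s * (1 + ‖U ω‖ ^ s)) P :=
    ((integrable_const _).add hi).const_mul _
  have hw : Integrable (fun ω => wt (U ω) ^ s) P :=
    hi2.mono' ((measurable_wt_rpow s).comp_aemeasurable hU).aestronglyMeasurable
      (Eventually.of_forall fun ω => by
        rw [Real.norm_of_nonneg (wt_rpow_pos _ _).le]; exact wt_rpow_le _ hs)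
  refine ⟨hw, (integral_mono hw hi2 fun ω => wt_rpow_le _ hs).trans ?_⟩
  rw [integral_const_mul, integral_add (integrable_const _) hi]
  have : ∫ ω, ‖U ω‖ ^ s ∂P ≤ L := by
    rw [integral_eq_lintegral_of_nonneg_ae hn hm.aestronglyMeasurable]
    exact ENNReal.toReal_le_of_le_ofReal hL h
  simp only [integral_const, probReal_univ, smul_eq_mul, one_mul]
  gcongr

end Weights

/-! ### Hölder functions of polynomial growth -/

section Holder

variable {Ω E : Type*} {mΩ : MeasurableSpace Ω} [NormedAddCommGroup E] [MeasurableSpace E]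

/-- `f` is measurable, grows like `(1 + ‖·‖)^{p/2}`, and is `γ`-Hölder with local constants
growing at the same rate. -/
structure HolderGrowth (p γ K : ℝ) (f : E → ℝ) : Prop where
  meas : Measurable f
  nonneg : 0 ≤ K
  growth : ∀ u, |f u| ≤ K * wt u ^ (p / 2)
  holder : ∀ u v, |f u - f v| ≤ K * (‖u - v‖ ^ γ * √(wt u ^ p + wt v ^ p))

/-- The truncation `1 ∧ ‖u₁ - u₂‖^γ` allows the Hölder exponent to be lowered. The main proof uses
`f` with both `γ` and `γ₁`. -/
theorem IsTestFunction.exists_holderGrowth {p γ γ' : ℝ} {f : E → ℝ} (hf : IsTestFunction p γ f)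
    (hp : 1 ≤ p) (hγ' : 0 < γ') (hγ : γ' ≤ γ) : ∃ K, HolderGrowth p γ' K f := by
  obtain ⟨hm, ⟨K₁, h₁⟩, K₂, h₂⟩ := hf
  refine ⟨2 * (|K₁| + |K₂|), hm, by positivity, fun u => ?_, fun u v => ?_⟩
  · have hw := one_add_norm_rpow_le u (s := p / 2) (by linarith)
    calc |f u| ≤ K₁ * (1 + ‖u‖ ^ (p / 2)) := h₁ u
      _ ≤ |K₁| * (2 * wt u ^ (p / 2)) := by
          apply mul_le_mul (le_abs_self _) hw (by positivity) (abs_nonneg _)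
      _ ≤ _ := by
          have : 0 ≤ |K₂| * wt u ^ (p / 2) := mul_nonneg (abs_nonneg _) (wt_rpow_pos _ _).le
          linarith
  · have hmin : min 1 (‖u - v‖ ^ γ) ≤ ‖u - v‖ ^ γ' := by
      rcases le_total ‖u - v‖ 1 with h | h
      · exact (min_le_right _ _).trans (by
          rcases (norm_nonneg (u - v)).eq_or_lt with h0 | h0
          · rw [← h0, Real.zero_rpow (by linarith), Real.zero_rpow hγ'.ne']
          · exact Real.rpow_le_rpow_of_exponent_ge h0 h hγ)
      · exact (min_le_left _ _).trans (Real.one_le_rpow h hγ'.le)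
    have hs : √(1 + ‖u‖ ^ p + ‖v‖ ^ p) ≤ 2 * √(wt u ^ p + wt v ^ p) := by
      rw [show (2 : ℝ) = √4 by rw [show (4 : ℝ) = 2 ^ 2 by norm_num]; simp, ← Real.sqrt_mul (by norm_num)]
      apply Real.sqrt_le_sqrt
      have a := one_le_wt_rpow u (s := p) (by linarith)
      have b := norm_rpow_le_wt_rpow u (s := p) (by linarith)
      have c := norm_rpow_le_wt_rpow v (s := p) (by linarith)
      have d := one_le_wt_rpow v (s := p) (by linarith)
      linarith
    calc |f u - f v| ≤ K₂ * quasiDist p γ u v := h₂ u v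
      _ ≤ |K₂| * (‖u - v‖ ^ γ' * (2 * √(wt u ^ p + wt v ^ p))) := by
          unfold quasiDist
          apply mul_le_mul (le_abs_self _) _ (by positivity) (abs_nonneg _)
          exact mul_le_mul hmin hs (Real.sqrt_nonneg _) (by positivity)
      _ ≤ _ := by
          have : 0 ≤ |K₁| * (‖u - v‖ ^ γ' * √(wt u ^ p + wt v ^ p)) := by positivity
          linarith

/-- This lets bounded Lipschitz functions, which determine weak convergence, enter the estimates
made for `f`. At distance at most one the Lipschitz bound suffices since `γ ≤ 1`; beyond, the bound
`2 * C` does. -/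
theorem HolderGrowth.of_lipschitz [BorelSpace E] {p γ C : ℝ} {L : ℝ≥0} {g : E → ℝ} (hp : 0 ≤ p)
    (hγ : 0 < γ) (hγ1 : γ ≤ 1) (hC : ∀ u, |g u| ≤ C) (hL : LipschitzWith L g) :
    HolderGrowth p γ (2 * C + L) g := by
  have hC0 : 0 ≤ C := (abs_nonneg _).trans (hC 0)
  refine ⟨hL.continuous.measurable, by positivity, fun u => ?_, fun u v => ?_⟩
  · have := one_le_wt_rpow u (s := p / 2) (by linarith)
    calc |g u| ≤ C := hC u
      _ ≤ 2 * C + L := by have := L.2; linarith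
      _ ≤ _ := le_mul_of_one_le_right (by positivity) this
  · have hs : 1 ≤ √(wt u ^ p + wt v ^ p) := by
      rw [Real.one_le_sqrt]
      linarith [one_le_wt_rpow u hp, one_le_wt_rpow v hp]
    have hmain : |g u - g v| ≤ (2 * C + L) * ‖u - v‖ ^ γ := by
      rcases le_total ‖u - v‖ 1 with h | h
      · have h1 : |g u - g v| ≤ L * ‖u - v‖ := by
          have := hL.dist_le_mul u v
          rwa [Real.dist_eq, dist_eq_norm] at this
        have h2 : ‖u - v‖ ≤ ‖u - v‖ ^ γ := Real.self_le_rpow_of_le_one (norm_nonneg _) h hγ1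
        calc |g u - g v| ≤ L * ‖u - v‖ := h1
          _ ≤ L * ‖u - v‖ ^ γ := by gcongr
          _ ≤ _ := by gcongr; linarith
      · have h1 := Real.one_le_rpow h hγ.le
        calc |g u - g v| ≤ |g u| + |g v| := abs_sub _ _
          _ ≤ 2 * C + L := by have := L.2; linarith [hC u, hC v]
          _ ≤ _ := le_mul_of_one_le_right (by positivity) h1
    calc |g u - g v| ≤ (2 * C + L) * ‖u - v‖ ^ γ := hmain
      _ ≤ (2 * C + L) * (‖u - v‖ ^ γ * √(wt u ^ p + wt v ^ p)) := by
          gcongr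
          exact le_mul_of_one_le_right (by positivity) hs

theorem HolderGrowth.continuous {p γ K : ℝ} {f : E → ℝ} (hf : HolderGrowth p γ K f)
    (hγ : 0 < γ) : Continuous f := by
  rw [continuous_iff_continuousAt]
  intro v
  rw [ContinuousAt, tendsto_iff_norm_sub_tendsto_zero]
  have hc : Continuous fun u => K * (‖u - v‖ ^ γ * √(wt u ^ p + wt v ^ p)) := by
    have h1 := continuous_wt_rpow (E := E) p
    have h2 : Continuous fun u => ‖u - v‖ ^ γ :=
      (continuous_id.sub continuous_const).norm.rpow_const fun _ => Or.inr hγ.le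
    fun_prop
  have h0 := hc.tendsto v
  simp only [sub_self, norm_zero, Real.zero_rpow hγ.ne', zero_mul, mul_zero] at h0
  exact squeeze_zero (fun _ => norm_nonneg _) (fun u => hf.holder u v) h0

theorem HolderGrowth.integrable {P : Measure Ω} {p γ K C : ℝ} {f : E → ℝ}
    (hf : HolderGrowth p γ K f) {U : Ω → E} (hU : AEMeasurable U P)
    (h : MomentLE P U (p / 2) C) : Integrable (fun ω => f (U ω)) P :=
  (h.1.const_mul K).mono' (hf.meas.comp_aemeasurable hU).aestronglyMeasurable
    (Eventually.of_forall fun ω => hf.growth (U ω))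

variable [BorelSpace E] [SecondCountableTopology E]

/-- Cauchy–Schwarz separates `‖U - V‖^γ` from the weight, and Jensen for the concave power `γ`
bounds `E‖U - V‖^{2γ}` by `a^{2γ}`. Every comparison of transition operators below reduces to this.
-/
theorem HolderGrowth.abs_integral_sub_le {P : Measure Ω} [IsProbabilityMeasure P]
    {p γ K a b b' : ℝ} {f : E → ℝ} (hf : HolderGrowth p γ K f) (hp : 0 < p) (hγ : 0 ≤ γ)
    (hγ1 : γ ≤ 1) {U V : Ω → E} (hU : AEMeasurable U P) (hV : AEMeasurable V P) (ha : 0 ≤ a)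
    (hUV : eLpNorm (fun ω => U ω - V ω) 2 P ≤ ENNReal.ofReal a)
    (hMU : MomentLE P U p b) (hMV : MomentLE P V p b') :
    |∫ ω, f (U ω) ∂P - ∫ ω, f (V ω) ∂P| ≤ K * (a ^ γ * √(b + b')) := by
  have hfU := hf.integrable hU (hMU.mono_exp (by linarith) (by linarith) hp)
  have hfV := hf.integrable hV (hMV.mono_exp (by linarith) (by linarith) hp)
  have hsub : AEMeasurable (fun ω => U ω - V ω) P := hU.sub hV
  obtain ⟨hi, hile⟩ := sq_integral_le_of_eLpNorm_le hsub.aestronglyMeasurable ha hUV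
  obtain ⟨hj, hjle⟩ := integral_rpow_le (fun ω => sq_nonneg ‖U ω - V ω‖) hi hγ hγ1
  set F : Ω → ℝ := fun ω => ‖U ω - V ω‖ ^ γ with hF
  set G : Ω → ℝ := fun ω => √(wt (U ω) ^ p + wt (V ω) ^ p) with hG
  have hFm : AEStronglyMeasurable F P := (hsub.norm.pow_const γ).aestronglyMeasurable
  have hGm : AEStronglyMeasurable G P :=
    (((measurable_wt_rpow p).comp_aemeasurable hU).add
      ((measurable_wt_rpow p).comp_aemeasurable hV)).sqrt.aestronglyMeasurable
  have hF2 : ∀ ω, F ω ^ 2 = (‖U ω - V ω‖ ^ 2) ^ γ := fun ω => by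
    simp only [hF]
    rw [← Real.rpow_natCast, ← Real.rpow_natCast, ← Real.rpow_mul (norm_nonneg _),
      ← Real.rpow_mul (norm_nonneg _), mul_comm]
  have hG2 : ∀ ω, G ω ^ 2 = wt (U ω) ^ p + wt (V ω) ^ p := fun ω =>
    Real.sq_sqrt (add_nonneg (wt_rpow_pos _ _).le (wt_rpow_pos _ _).le)
  have hFL : MemLp F 2 P := (memLp_two_iff_integrable_sq hFm).2 (by simpa only [hF2] using hj)
  have hGL : MemLp G 2 P := (memLp_two_iff_integrable_sq hGm).2
    (by simp only [hG2]; exact hMU.1.add hMV.1)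
  have hFG : Integrable (fun ω => F ω * G ω) P := hFL.integrable_mul hGL
  have hcs : ∫ ω, F ω * G ω ∂P ≤ (∫ ω, F ω ^ 2 ∂P) ^ (1 / 2 : ℝ) * (∫ ω, G ω ^ 2 ∂P) ^ (1 / 2 : ℝ) := by
    have := integral_mul_le_Lp_mul_Lq_of_nonneg (μ := P) Real.HolderConjugate.two_two
      (f := F) (g := G) (Eventually.of_forall fun ω => by positivity)
      (Eventually.of_forall fun ω => by positivity) (by simpa using hFL) (by simpa using hGL)
    simpa only [Real.rpow_ofNat] using this
  have h1 : (∫ ω, F ω ^ 2 ∂P) ^ (1 / 2 : ℝ) ≤ a ^ γ := by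
    have e : a ^ γ = ((a ^ 2) ^ γ) ^ (1 / 2 : ℝ) := by
      rw [← Real.rpow_natCast, ← Real.rpow_mul ha, ← Real.rpow_mul ha]; congr 1; push_cast; ring
    rw [e]
    refine Real.rpow_le_rpow (integral_nonneg fun ω => by positivity) ?_ (by norm_num)
    simp only [hF2]
    exact hjle.trans (Real.rpow_le_rpow (integral_nonneg fun ω => by positivity) hile hγ)
  have h2 : (∫ ω, G ω ^ 2 ∂P) ^ (1 / 2 : ℝ) ≤ √(b + b') := by
    rw [Real.sqrt_eq_rpow]
    refine Real.rpow_le_rpow (integral_nonneg fun ω => by positivity) ?_ (by norm_num)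
    simp only [hG2]
    rw [integral_add hMU.1 hMV.1]
    exact add_le_add hMU.2 hMV.2
  rw [← integral_sub hfU hfV]
  calc |∫ ω, (f (U ω) - f (V ω)) ∂P| ≤ ∫ ω, |f (U ω) - f (V ω)| ∂P := abs_integral_le_integral_abs
    _ ≤ ∫ ω, K * (F ω * G ω) ∂P :=
        integral_mono (hfU.sub hfV).abs (hFG.const_mul K) fun ω => hf.holder _ _
    _ = K * ∫ ω, F ω * G ω ∂P := integral_const_mul _ _
    _ ≤ K * (a ^ γ * √(b + b')) := by
        refine mul_le_mul_of_nonneg_left (hcs.trans ?_) hf.nonneg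
        exact mul_le_mul h1 h2 (Real.rpow_nonneg (integral_nonneg fun ω => by positivity) _)
          (Real.rpow_nonneg ha _)

end Holder

/-! ### Transition kernels of a Markov family -/

theorem integral_measure_bind {α β : Type*} {mα : MeasurableSpace α} {mβ : MeasurableSpace β}
    {μ : Measure α} [SFinite μ] {κ : Kernel α β} [IsSFiniteKernel κ] {f : β → ℝ}
    (hi : Integrable f (μ.bind κ)) :
    ∫ y, f y ∂(μ.bind κ) = ∫ x, ∫ y, f y ∂κ x ∂μ := by
  rw [Measure.comp_eq_comp_const_apply] at hi ⊢
  rw [Kernel.integral_comp hi, Kernel.const_apply]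

section MarkovKernel

variable {Ω E T : Type*} {mΩ : MeasurableSpace Ω} [MeasurableSpace E] [Preorder T]
  {P : Measure Ω} {ℱ : Filtration T mΩ} {Z : T → T → E → Ω → E}

theorem IsMarkovFamily.measurable (hZ : IsMarkovFamily P ℱ Z) {s t : T} (h : s ≤ t) (y : E) :
    Measurable (Z s t y) := (hZ.adapted s t y h).mono (ℱ.le t) le_rfl

variable [IsProbabilityMeasure P]

/-- The transition kernel from time `s` to time `t`. -/
def IsMarkovFamily.kernel (hZ : IsMarkovFamily P ℱ Z) {s t : T} (h : s ≤ t) : Kernel E E where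
  toFun y := P.map (Z s t y)
  measurable' := by
    refine Measure.measurable_of_measurable_coe _ fun B hB => ?_
    have hm := hZ.measurable_transOp s t h (B.indicator 1) (measurable_one.indicator hB)
      ⟨1, fun y => by by_cases hy : y ∈ B <;> simp [hy]⟩
    have e : (fun y => P.map (Z s t y) B)
        = fun y => ENNReal.ofReal (transOp P Z s t (B.indicator 1) y) := by
      funext y
      have hB' := hZ.measurable h y hB
      rw [Measure.map_apply (hZ.measurable h y) hB, transOp,
        show (fun ω => B.indicator (1 : E → ℝ) (Z s t y ω))
          = (Z s t y ⁻¹' B).indicator 1 from rfl, integral_indicator_one hB', measureReal_def,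
        ENNReal.ofReal_toReal (measure_ne_top _ _)]
    rw [e]
    exact hm.ennreal_ofReal

theorem IsMarkovFamily.kernel_apply (hZ : IsMarkovFamily P ℱ Z) {s t : T} (h : s ≤ t) (y : E) :
    hZ.kernel h y = P.map (Z s t y) := rfl

instance (hZ : IsMarkovFamily P ℱ Z) {s t : T} (h : s ≤ t) : IsMarkovKernel (hZ.kernel h) :=
  ⟨fun y => Measure.isProbabilityMeasure_map (hZ.measurable h y).aemeasurable⟩

theorem IsMarkovFamily.integral_kernel (hZ : IsMarkovFamily P ℱ Z) {s t : T} (h : s ≤ t) (y : E)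
    {f : E → ℝ} (hf : Measurable f) : ∫ z, f z ∂hZ.kernel h y = transOp P Z s t f y := by
  rw [hZ.kernel_apply, integral_map (hZ.measurable h y).aemeasurable hf.aestronglyMeasurable,
    transOp]

theorem IsMarkovFamily.measurable_transOp' (hZ : IsMarkovFamily P ℱ Z) {s t : T} (h : s ≤ t)
    {f : E → ℝ} (hf : Measurable f) : Measurable (transOp P Z s t f) := by
  have := (hf.stronglyMeasurable.integral_kernel (κ := hZ.kernel h)).measurable
  simpa only [hZ.integral_kernel h _ hf] using this

/-- The Markov property is assumed for bounded functions only. Tested on indicators it becomes an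
identity of measures on each event of `ℱ u`, and in this form it extends to unbounded integrable
functions such as `f`. -/
theorem IsMarkovFamily.map_restrict_eq_bind (hZ : IsMarkovFamily P ℱ Z) {s u t : T} (hsu : s ≤ u)
    (hut : u ≤ t) (x : E) {A : Set Ω} (hA : MeasurableSet[ℱ u] A) :
    (P.restrict A).map (Z s t x)
      = ((P.restrict A).map (Z s u x)).bind (hZ.kernel hut) := by
  have hA' := ℱ.le u A hA
  have hst := hsu.trans hut
  ext B hB
  have hbd : ∃ C, ∀ y, |B.indicator (1 : E → ℝ) y| ≤ C :=
    ⟨1, fun y => by by_cases hy : y ∈ B <;> simp [hy]⟩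
  have hgm : Measurable (B.indicator (1 : E → ℝ)) := measurable_one.indicator hB
  have hM := hZ.markov s u t x hsu hut (B.indicator 1) hgm hbd
  have e1 : ∀ y, transOp P Z u t (B.indicator 1) y = (hZ.kernel hut y).real B := fun y => by
    rw [← hZ.integral_kernel hut y hgm, integral_indicator_one hB]
  have hint : Integrable (fun ω => B.indicator (1 : E → ℝ) (Z s t x ω)) P :=
    Integrable.of_bound (hgm.comp (hZ.measurable hst x)).aestronglyMeasurable 1
      (Eventually.of_forall fun ω => by
        rw [Real.norm_eq_abs]; by_cases hy : Z s t x ω ∈ B <;> simp [hy])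
  have hset := setIntegral_condExp (ℱ.le u) hint hA
  have hpre := hZ.measurable hst x hB
  rw [setIntegral_congr_ae hA' (hM.mono fun ω h _ => h)] at hset
  simp only [e1] at hset
  have hl : ∫ ω in A, B.indicator (1 : E → ℝ) (Z s t x ω) ∂P
      = (P.restrict A).real (Z s t x ⁻¹' B) := by
    rw [← integral_indicator_one hpre]; rfl
  have hkm : Measurable fun y => hZ.kernel hut y B := (hZ.kernel hut).measurable_coe hB
  rw [hl] at hset
  rw [Measure.map_apply (hZ.measurable hst x) hB,
    Measure.bind_apply hB (hZ.kernel hut).measurable.aemeasurable,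
    lintegral_map hkm (hZ.measurable hsu x), ← ENNReal.ofReal_toReal
      (measure_ne_top (P.restrict A) (Z s t x ⁻¹' B)), ← measureReal_def, ← hset,
    ofReal_integral_eq_lintegral_ofReal]
  · refine lintegral_congr fun ω => ?_
    rw [measureReal_def, ENNReal.ofReal_toReal (measure_ne_top _ _)]
  · refine Integrable.of_bound (hkm.comp (hZ.measurable hsu x)).ennreal_toReal.aestronglyMeasurable
      1 (Eventually.of_forall fun ω => ?_)
    rw [Real.norm_of_nonneg measureReal_nonneg]
    exact measureReal_le_one
  · exact Eventually.of_forall fun ω => measureReal_nonneg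

theorem IsMarkovFamily.setIntegral_transOp (hZ : IsMarkovFamily P ℱ Z) {s u t : T} (hsu : s ≤ u)
    (hut : u ≤ t) (x : E) {f : E → ℝ} (hf : Measurable f)
    (hi : Integrable (fun ω => f (Z s t x ω)) P) {A : Set Ω} (hA : MeasurableSet[ℱ u] A) :
    IntegrableOn (fun ω => transOp P Z u t f (Z s u x ω)) A P ∧
      ∫ ω in A, transOp P Z u t f (Z s u x ω) ∂P = ∫ ω in A, f (Z s t x ω) ∂P := by
  have hst := hsu.trans hut
  have hmap := hZ.map_restrict_eq_bind hsu hut x hA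
  have hi' : Integrable f ((P.restrict A).map (Z s t x)) :=
    (integrable_map_measure hf.aestronglyMeasurable (hZ.measurable hst x).aemeasurable).2
      hi.integrableOn
  have hm := (hZ.measurable_transOp' hut hf).aestronglyMeasurable
    (μ := (P.restrict A).map (Z s u x))
  rw [hmap] at hi'
  have h1 := integral_measure_bind hi'
  simp only [hZ.integral_kernel hut _ hf] at h1
  have h3 : Integrable (transOp P Z u t f) ((P.restrict A).map (Z s u x)) := by
    refine (Measure.integrable_integral_norm_of_integrable_comp hi').mono' hm
      (Eventually.of_forall fun y => ?_)
    rw [← hZ.integral_kernel hut _ hf]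
    exact norm_integral_le_integral_norm _
  refine ⟨(integrable_map_measure hm (hZ.measurable hsu x).aemeasurable).1 h3, ?_⟩
  rw [← integral_map (hZ.measurable hsu x).aemeasurable hm, ← h1, ← hmap,
    integral_map (hZ.measurable hst x).aemeasurable hf.aestronglyMeasurable]

theorem IsMarkovFamily.integrable_transOp (hZ : IsMarkovFamily P ℱ Z) {s u t : T} (hsu : s ≤ u)
    (hut : u ≤ t) (x : E) {f : E → ℝ} (hf : Measurable f)
    (hi : Integrable (fun ω => f (Z s t x ω)) P) :
    Integrable (fun ω => transOp P Z u t f (Z s u x ω)) P := by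
  simpa using (hZ.setIntegral_transOp hsu hut x hf hi MeasurableSet.univ).1

theorem IsMarkovFamily.integral_transOp (hZ : IsMarkovFamily P ℱ Z) {s u t : T} (hsu : s ≤ u)
    (hut : u ≤ t) (x : E) {f : E → ℝ} (hf : Measurable f)
    (hi : Integrable (fun ω => f (Z s t x ω)) P) :
    ∫ ω, transOp P Z u t f (Z s u x ω) ∂P = ∫ ω, f (Z s t x ω) ∂P := by
  simpa using (hZ.setIntegral_transOp hsu hut x hf hi MeasurableSet.univ).2

theorem IsMarkovFamily.condExp_eq (hZ : IsMarkovFamily P ℱ Z) {s u t : T} (hsu : s ≤ u)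
    (hut : u ≤ t) (x : E) {f : E → ℝ} (hf : Measurable f)
    (hi : Integrable (fun ω => f (Z s t x ω)) P) :
    P[fun ω => f (Z s t x ω) | ℱ u] =ᵐ[P] fun ω => transOp P Z u t f (Z s u x ω) := by
  refine (ae_eq_condExp_of_forall_setIntegral_eq (ℱ.le u) hi (fun A hA _ => ?_)
    (fun A hA _ => ?_) ?_).symm
  · exact (hZ.setIntegral_transOp hsu hut x hf hi hA).1
  · exact (hZ.setIntegral_transOp hsu hut x hf hi hA).2
  · exact ((hZ.measurable_transOp' hut hf).comp
      (hZ.adapted s u x hsu)).stronglyMeasurable.aestronglyMeasurable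

theorem IsMarkovFamily.condExp_sub_const_eq (hZ : IsMarkovFamily P ℱ Z) {s u t : T} (hsu : s ≤ u)
    (hut : u ≤ t) (x : E) {f : E → ℝ} (hf : Measurable f) (c : ℝ)
    (hi : Integrable (fun ω => f (Z s t x ω)) P) :
    P[fun ω => f (Z s t x ω) - c | ℱ u] =ᵐ[P] fun ω => transOp P Z u t f (Z s u x ω) - c := by
  filter_upwards [condExp_sub hi (integrable_const c) (ℱ u), hZ.condExp_eq hsu hut x hf hi]
    with ω h1 h2
  have h3 := h1
  rw [Pi.sub_apply, h2, condExp_const (ℱ.le u)] at h3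
  exact h3

end MarkovKernel

/-! ### Homogeneity and invariance -/

section Invariance

variable {Ω E : Type*} {mΩ : MeasurableSpace Ω} [MeasurableSpace E]
  {P : Measure Ω} [IsProbabilityMeasure P] {ℱ : Filtration ℝ≥0 mΩ} {X : ℝ≥0 → ℝ≥0 → E → Ω → E}

theorem IsTimeHomogeneous.transOp_eq (hX : IsMarkovFamily P ℱ X) (hXhom : IsTimeHomogeneous P X)
    {s t : ℝ≥0} (h : s ≤ t) {f : E → ℝ} (hf : Measurable f) :
    transOp P X s t f = transOp P X 0 (t - s) f := by
  funext y
  rw [← hX.integral_kernel h y hf, ← hX.integral_kernel (zero_le) y hf, hX.kernel_apply,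
    hX.kernel_apply, hXhom s t y h]

/-- The semigroup property of the transition operators of a time-homogeneous Markov family. -/
theorem IsTimeHomogeneous.transOp_add (hX : IsMarkovFamily P ℱ X)
    (hXhom : IsTimeHomogeneous P X) (t h : ℝ≥0) {f : E → ℝ} (hf : Measurable f) (y : E)
    (hi : Integrable (fun ω => f (X 0 (t + h) y ω)) P) :
    Integrable (fun ω => transOp P X 0 h f (X 0 t y ω)) P ∧
      ∫ ω, transOp P X 0 h f (X 0 t y ω) ∂P = transOp P X 0 (t + h) f y := by
  have e : transOp P X t (t + h) f = transOp P X 0 h f := by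
    rw [hXhom.transOp_eq hX (le_self_add) hf, add_tsub_cancel_left]
  rw [← e]
  exact ⟨hX.integrable_transOp zero_le le_self_add y hf hi,
    hX.integral_transOp zero_le le_self_add y hf hi⟩

theorem IsInvariantMeasure.bind_eq (hX : IsMarkovFamily P ℱ X) {μ : Measure E}
    (hμ : IsInvariantMeasure P X μ) (t : ℝ≥0) :
    μ.bind (hX.kernel (zero_le (a := t))) = μ := by
  ext B hB
  rw [Measure.bind_apply hB (Kernel.measurable _).aemeasurable]
  rw [← hμ t B hB]
  refine lintegral_congr fun y => ?_
  rw [hX.kernel_apply, Measure.map_apply (hX.measurable zero_le y) hB]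
  rfl

theorem IsInvariantMeasure.integral_transOp (hX : IsMarkovFamily P ℱ X) {μ : Measure E}
    [SFinite μ] (hμ : IsInvariantMeasure P X μ) (t : ℝ≥0) {f : E → ℝ} (hf : Measurable f)
    (hi : Integrable f μ) :
    Integrable (transOp P X 0 t f) μ ∧ ∫ y, transOp P X 0 t f y ∂μ = ∫ y, f y ∂μ := by
  have hmap := hμ.bind_eq hX t
  have hi' := hi
  rw [← hmap] at hi'
  have h1 := integral_measure_bind hi'
  rw [hmap] at h1
  simp only [hX.integral_kernel zero_le _ hf] at h1
  refine ⟨?_, h1.symm⟩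
  refine (Measure.integrable_integral_norm_of_integrable_comp hi').mono'
    (hX.measurable_transOp' zero_le hf).aestronglyMeasurable (Eventually.of_forall fun y => ?_)
  rw [← hX.integral_kernel zero_le _ hf]
  exact norm_integral_le_integral_norm _

end Invariance

/-! ### Weak convergence and moments -/

section Weak

variable {E : Type*} [NormedAddCommGroup E]

theorem exists_forall_wt_rpow_le {s q : ℝ} (hsq : s < q) (C : ℝ) {η : ℝ} (hη : 0 < η) :
    ∃ R : ℝ, 0 < R ∧ ∀ u : E, R < wt u → C * wt u ^ s ≤ η * wt u ^ q := by
  have ht : Tendsto (fun R : ℝ => |C| * R ^ (-(q - s))) atTop (𝓝 (|C| * 0)) :=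
    (tendsto_rpow_neg_atTop (by linarith)).const_mul _
  rw [mul_zero] at ht
  obtain ⟨R, hR, hR0⟩ := ((ht.eventually_lt_const hη).and (eventually_gt_atTop 0)).exists
  refine ⟨R, hR0, fun u hu => ?_⟩
  have h1 : wt u ^ s = wt u ^ (-(q - s)) * wt u ^ q := by
    rw [← Real.rpow_add (wt_pos u)]; congr 1; ring
  have h2 : wt u ^ (-(q - s)) ≤ R ^ (-(q - s)) :=
    Real.rpow_le_rpow_of_nonpos hR0 hu.le (by linarith)
  calc C * wt u ^ s ≤ |C| * wt u ^ s :=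
        mul_le_mul_of_nonneg_right (le_abs_self C) (wt_rpow_pos u s).le
    _ = |C| * wt u ^ (-(q - s)) * wt u ^ q := by rw [h1, mul_assoc]
    _ ≤ |C| * R ^ (-(q - s)) * wt u ^ q :=
        mul_le_mul_of_nonneg_right (mul_le_mul_of_nonneg_left h2 (abs_nonneg C))
          (wt_rpow_pos u q).le
    _ ≤ η * wt u ^ q := mul_le_mul_of_nonneg_right hR.le (wt_rpow_pos u q).le

variable [MeasurableSpace E]

/-- Convergence of the integrals of all bounded Lipschitz functions. -/
def LipschitzTendsto (ν : ℕ → Measure E) (μ : Measure E) : Prop :=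
  ∀ (g : E → ℝ) (C : ℝ) (L : ℝ≥0), (∀ u, |g u| ≤ C) → LipschitzWith L g →
    Tendsto (fun n => ∫ u, g u ∂ν n) atTop (𝓝 (∫ u, g u ∂μ))

variable [BorelSpace E]

theorem momentLE_map_iff {Ω : Type*} {mΩ : MeasurableSpace Ω} {P : Measure Ω} {U : Ω → E}
    (hU : AEMeasurable U P) {s C : ℝ} : MomentLE (P.map U) id s C ↔ MomentLE P U s C := by
  have hm : AEStronglyMeasurable (fun u : E => wt u ^ s) (P.map U) :=
    (measurable_wt_rpow s).aestronglyMeasurable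
  simp only [MomentLE, id]
  rw [integrable_map_measure hm hU, integral_map hU hm]
  rfl

variable {ν : ℕ → Measure E} {μ : Measure E} [∀ n, IsProbabilityMeasure (ν n)]
  [IsProbabilityMeasure μ]

theorem LipschitzTendsto.tendsto_of_bounded (h : LipschitzTendsto ν μ) {g : E → ℝ}
    (hg : Continuous g) {C : ℝ} (hC : ∀ u, |g u| ≤ C) :
    Tendsto (fun n => ∫ u, g u ∂ν n) atTop (𝓝 (∫ u, g u ∂μ)) := by
  let νp : ℕ → ProbabilityMeasure E := fun n => ⟨ν n, inferInstance⟩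
  let μp : ProbabilityMeasure E := ⟨μ, inferInstance⟩
  have hw : Tendsto νp atTop (𝓝 μp) := by
    rw [tendsto_iff_forall_lipschitz_integral_tendsto]
    rintro f ⟨C, hC⟩ ⟨L, hL⟩
    refine h f (|f 0| + C) L (fun u => ?_) hL
    have := hC u 0
    rw [Real.dist_eq] at this
    have h2 := abs_add_le (f u - f 0) (f 0)
    rw [sub_add_cancel] at h2
    linarith
  rw [ProbabilityMeasure.tendsto_iff_forall_integral_tendsto] at hw
  exact hw (BoundedContinuousFunction.ofNormedAddCommGroup g hg C hC)

/-- The truncations `min (wt u ^ s) M` are bounded and continuous, so their integrals pass to the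
limit; monotone convergence then removes `M`. -/
theorem LipschitzTendsto.momentLE (h : LipschitzTendsto ν μ) {s C : ℝ}
    (hm : ∀ n, MomentLE (ν n) id s C) : MomentLE μ id s C := by
  have hC : 0 ≤ C := (hm 0).nonneg
  have hcw := continuous_wt_rpow (E := E) s
  have hmin : ∀ M : ℕ, Continuous fun u : E => min (wt u ^ s) (M : ℝ) := fun M =>
    hcw.min continuous_const
  have hnn : ∀ (M : ℕ) (u : E), 0 ≤ min (wt u ^ s) (M : ℝ) := fun M u =>
    le_min (wt_rpow_pos u s).le (Nat.cast_nonneg M)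
  have hbd : ∀ (M : ℕ) (u : E), |min (wt u ^ s) (M : ℝ)| ≤ M := fun M u => by
    rw [abs_of_nonneg (hnn M u)]; exact min_le_right _ _
  have hle : ∀ M : ℕ, ∫ u, min (wt u ^ s) (M : ℝ) ∂μ ≤ C := fun M => by
    refine le_of_tendsto' (h.tendsto_of_bounded (hmin M) (hbd M)) fun n => ?_
    refine le_trans (integral_mono_of_nonneg (Eventually.of_forall (hnn M)) (hm n).1
      (Eventually.of_forall fun u => min_le_left _ _)) (hm n).2
  have hl : ∫⁻ u, ENNReal.ofReal (wt u ^ s) ∂μ ≤ ENNReal.ofReal C := by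
    have ht : Tendsto (fun M : ℕ => ∫⁻ u, ENNReal.ofReal (min (wt u ^ s) (M : ℝ)) ∂μ) atTop
        (𝓝 (∫⁻ u, ENNReal.ofReal (wt u ^ s) ∂μ)) := by
      refine lintegral_tendsto_of_tendsto_of_monotone
        (fun M => (hmin M).measurable.ennreal_ofReal.aemeasurable)
        (Eventually.of_forall fun u M N hMN => ?_) (Eventually.of_forall fun u => ?_)
      · exact ENNReal.ofReal_le_ofReal (min_le_min le_rfl (by exact_mod_cast hMN))
      · refine tendsto_const_nhds.congr' ?_
        filter_upwards [eventually_ge_atTop ⌈wt u ^ s⌉₊] with M hM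
        rw [min_eq_left (Nat.ceil_le.1 hM)]
    refine le_of_tendsto' ht fun M => ?_
    rw [← ofReal_integral_eq_lintegral_ofReal (Integrable.of_bound
      (hmin M).measurable.aestronglyMeasurable M (Eventually.of_forall (hbd M)))
      (Eventually.of_forall (hnn M))]
    exact ENNReal.ofReal_le_ofReal (hle M)
  have h0 : 0 ≤ᵐ[μ] fun u : E => wt u ^ s := Eventually.of_forall fun u => (wt_rpow_pos u s).le
  refine ⟨⟨hcw.measurable.aestronglyMeasurable, ?_⟩, ?_⟩
  · simp only [id]
    rw [hasFiniteIntegral_iff_ofReal h0]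
    exact hl.trans_lt ENNReal.ofReal_lt_top
  · simp only [id]
    rw [integral_eq_lintegral_of_nonneg_ae h0 hcw.measurable.aestronglyMeasurable]
    exact ENNReal.toReal_le_of_le_ofReal hC hl

/-- A uniform moment of order `q > s` makes functions of growth `s` uniformly integrable: a cutoff
`χ` turns `g` into a bounded continuous function, and what is cut off has integral at most `η * B`
under all the measures involved. -/
theorem LipschitzTendsto.tendsto_of_growth (h : LipschitzTendsto ν μ) {s q B C : ℝ} (hs : 0 ≤ s)
    (hsq : s < q) (hB : ∀ n, MomentLE (ν n) id q B) {g : E → ℝ} (hg : Continuous g)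
    (hC : ∀ u, |g u| ≤ C * wt u ^ s) :
    Tendsto (fun n => ∫ u, g u ∂ν n) atTop (𝓝 (∫ u, g u ∂μ)) := by
  have hBμ : MomentLE μ id q B := h.momentLE hB
  have hB0 : 0 ≤ B := hBμ.nonneg
  have hC0 : 0 ≤ C := by
    have := (abs_nonneg _).trans (hC 0)
    exact nonneg_of_mul_nonneg_left this (wt_rpow_pos 0 s)
  rw [Metric.tendsto_atTop]
  intro ε hε
  -- The cutoff is paid for twice, under `ν n` and under `μ`, at most `ε / 4` each; `ε / 2` is left
  -- for the bounded part.
  set η := ε / (4 * (B + 1)) with hη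
  have hη0 : 0 < η := by positivity
  obtain ⟨R, hR0, hR⟩ := exists_forall_wt_rpow_le (E := E) hsq C hη0
  set χ : E → ℝ := fun u => max 0 (min 1 (R + 1 - wt u)) with hχ
  have hχ0 : ∀ u, 0 ≤ χ u := fun u => le_max_left _ _
  have hχ1 : ∀ u, χ u ≤ 1 := fun u => max_le zero_le_one (min_le_left _ _)
  have hχc : Continuous χ := by have := continuous_wt (E := E); fun_prop
  have hbd : ∀ u, |g u * χ u| ≤ C * (R + 1) ^ s := fun u => by
    rw [abs_mul, abs_of_nonneg (hχ0 u)]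
    rcases le_total (wt u) (R + 1) with hu | hu
    · calc |g u| * χ u ≤ |g u| := mul_le_of_le_one_right (abs_nonneg _) (hχ1 u)
        _ ≤ C * wt u ^ s := hC u
        _ ≤ _ := by gcongr; exact (wt_pos u).le
    · have : χ u = 0 := max_eq_left ((min_le_right _ _).trans (by linarith))
      rw [this, mul_zero]; positivity
  have hdiff : ∀ u, |g u - g u * χ u| ≤ η * wt u ^ q := fun u => by
    rcases le_or_gt (wt u) R with hu | hu
    · have : χ u = 1 := by simp only [hχ]; rw [min_eq_left (by linarith)]; simp
      rw [this, mul_one, sub_self, abs_zero]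
      have := wt_rpow_pos u q
      positivity
    · rw [show g u - g u * χ u = g u * (1 - χ u) by ring, abs_mul,
        abs_of_nonneg (sub_nonneg.2 (hχ1 u))]
      exact (mul_le_of_le_one_right (abs_nonneg _) (by linarith [hχ0 u])).trans
        ((hC u).trans (hR u hu))
  have key : ∀ ν' : Measure E, [IsProbabilityMeasure ν'] → MomentLE ν' id q B →
      |∫ u, g u ∂ν' - ∫ u, g u * χ u ∂ν'| ≤ η * B := fun ν' _ hν' => by
    have hi1 : Integrable (fun u => g u * χ u) ν' := Integrable.of_bound
      (hg.mul hχc).measurable.aestronglyMeasurable _ (Eventually.of_forall hbd)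
    have hi2 : Integrable (fun u => g u - g u * χ u) ν' := (hν'.1.const_mul η).mono'
      (hg.sub (hg.mul hχc)).measurable.aestronglyMeasurable (Eventually.of_forall hdiff)
    have hi : Integrable g ν' := (hi2.add hi1).congr (Eventually.of_forall fun u => by simp)
    rw [← integral_sub hi hi1]
    calc |∫ u, (g u - g u * χ u) ∂ν'| ≤ ∫ u, |g u - g u * χ u| ∂ν' :=
          abs_integral_le_integral_abs
      _ ≤ ∫ u, η * wt u ^ q ∂ν' := integral_mono hi2.abs (hν'.1.const_mul η) hdiff
      _ = η * ∫ u, wt u ^ q ∂ν' := integral_const_mul _ _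
      _ ≤ η * B := mul_le_mul_of_nonneg_left hν'.2 hη0.le
  obtain ⟨N, hN⟩ := Metric.tendsto_atTop.1 (h.tendsto_of_bounded (hg.mul hχc) hbd) (ε / 2)
    (by positivity)
  refine ⟨N, fun n hn => ?_⟩
  have h1 := hN n hn
  have h2 := key (ν n) (hB n)
  have h3 := key μ hBμ
  have h4 : η * B ≤ ε / 4 := by
    rw [hη, div_mul_eq_mul_div, div_le_div_iff₀ (by positivity) (by norm_num)]
    nlinarith
  simp only [Pi.mul_apply] at h1
  rw [Real.dist_eq] at h1 ⊢
  rw [abs_lt] at h1 ⊢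
  rw [abs_le] at h2 h3
  constructor <;> linarith [h1.1, h1.2, h2.1, h2.2, h3.1, h3.2]

end Weak

/-! ### Estimates for the exact process -/

section Moments

/-- Weights are at least one, so their sum is dominated by twice their product. A product merges
with other powers of the same base, which a sum does not. -/
theorem sqrt_add_moment_le {E : Type*} [NormedAddCommGroup E] {C : ℝ} (hC : 0 ≤ C) (y z : E) {s : ℝ} (hs : 0 ≤ s) :
    √(C * wt y ^ s + C * wt z ^ s) ≤ √(2 * C) * (wt y * wt z) ^ (s / 2) := by
  have hW : 0 ≤ wt y * wt z := (mul_pos (wt_pos y) (wt_pos z)).le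
  have e : (wt y * wt z) ^ (s / 2) = √((wt y * wt z) ^ s) := by
    rw [Real.sqrt_eq_rpow, ← Real.rpow_mul hW]; congr 1; ring
  rw [e, ← Real.sqrt_mul (by positivity)]
  apply Real.sqrt_le_sqrt
  rw [Real.mul_rpow (wt_pos y).le (wt_pos z).le]
  have a := one_le_wt_rpow y hs
  have b := one_le_wt_rpow z hs
  have a' : wt y ^ s ≤ wt y ^ s * wt z ^ s := le_mul_of_one_le_right (by linarith) b
  have b' : wt z ^ s ≤ wt y ^ s * wt z ^ s := le_mul_of_one_le_left (by linarith) a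
  have := mul_le_mul_of_nonneg_left (add_le_add a' b') hC
  linarith

variable {Ω E : Type*} {mΩ : MeasurableSpace Ω} [NormedAddCommGroup E]
  {P : Measure Ω} [IsProbabilityMeasure P]

/-- Because `1 ≤ C`, the same constant serves every lower order: `C ^ (s / q) ≤ C`. -/
theorem MomentLE.lower {U : Ω → E} {y : E} {a s q C : ℝ} (hC : 1 ≤ C)
    (h : MomentLE P U q (C * wt y ^ (a * q))) (hs : 0 ≤ s) (hsq : s ≤ q) (hq : 0 < q) :
    MomentLE P U s (C * wt y ^ (a * s)) := by
  refine (h.mono_exp hs hsq hq).mono ?_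
  rw [Real.mul_rpow (by linarith) (wt_rpow_pos _ _).le, ← Real.rpow_mul (wt_pos y).le,
    show a * q * (s / q) = a * s by field_simp]
  gcongr
  · exact (wt_rpow_pos _ _).le
  · calc C ^ (s / q) ≤ C ^ (1 : ℝ) :=
        Real.rpow_le_rpow_of_exponent_le hC (by rw [div_le_one hq]; exact hsq)
      _ = C := Real.rpow_one C

variable [MeasurableSpace E] [BorelSpace E]

theorem MomentLE.of_growth {U : Ω → E} (hU : AEMeasurable U P) {y : E} {a s L : ℝ} (hs : 0 ≤ s)
    (ha : 0 ≤ a) (hL : 0 ≤ L)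
    (h : ∫⁻ ω, ‖U ω‖ₑ ^ s ∂P ≤ ENNReal.ofReal (L * (1 + ‖y‖ ^ (a * s)))) :
    MomentLE P U s (2 ^ s * (1 + 2 * L) * wt y ^ (a * s)) := by
  have has : 0 ≤ a * s := by positivity
  refine (MomentLE.of_lintegral hU hs (by positivity) h).mono ?_
  rw [mul_assoc]
  gcongr
  have h1 := one_le_wt_rpow y has
  have h2 := mul_le_mul_of_nonneg_left (one_add_norm_rpow_le y has) hL
  linarith

theorem one_le_two_rpow_mul {s L : ℝ} (hs : 0 ≤ s) (hL : 0 ≤ L) :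
    1 ≤ (2 : ℝ) ^ s * (1 + 2 * L) :=
  one_le_mul_of_one_le_of_one_le (Real.one_le_rpow (by norm_num) hs) (by linarith)

end Moments

/-! ### Attractiveness, invariance and time regularity of the exact semigroup -/

section Exact

variable {Ω E : Type*} {mΩ : MeasurableSpace Ω} [NormedAddCommGroup E]
  [MeasurableSpace E] [BorelSpace E]
  {P : Measure Ω} [IsProbabilityMeasure P] {ℱ : Filtration ℝ≥0 mΩ} {X : ℝ≥0 → ℝ≥0 → E → Ω → E}
  {r r' γ₁ β l l' : ℝ} {ρ : ℝ≥0 → ℝ≥0}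

theorem ExactAssumption.exists_momentLE (h1 : ExactAssumption P X r r' γ₁ β l l' ρ)
    (hX : IsMarkovFamily P ℱ X) :
    ∃ C, 1 ≤ C ∧ ∀ t y, MomentLE P (X 0 t y) r (C * wt y ^ (r' * r)) := by
  obtain ⟨L, hL, h⟩ := h1.moment
  have hr : 0 ≤ r := by linarith [h1.r_ge]
  exact ⟨_, one_le_two_rpow_mul hr hL.le, fun t y => MomentLE.of_growth
    (hX.measurable zero_le y).aemeasurable hr (by linarith [h1.r'_ge]) hL.le (h y t)⟩

theorem ApproxAssumption.exists_momentLE {𝒢 : Filtration ℕ mΩ} {Y : ℕ → ℕ → E → Ω → E}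
    {τ : ℕ → ℝ≥0} {q q' κ : ℝ} {ρτ : ℝ≥0 → ℝ≥0} (h2 : ApproxAssumption P Y τ q q' κ ρτ)
    (hY : IsMarkovFamily P 𝒢 Y) :
    ∃ C, 1 ≤ C ∧ ∀ m n y, m ≤ n → MomentLE P (Y m n y) q (C * wt y ^ (q' * q)) := by
  obtain ⟨L, hL, h⟩ := h2.moment
  have hq : 0 ≤ q := by linarith [h2.q_ge]
  exact ⟨_, one_le_two_rpow_mul hq hL.le, fun m n y hmn => MomentLE.of_growth
    (hY.measurable hmn y).aemeasurable hq (by linarith [h2.q'_ge]) hL.le (h y m n hmn)⟩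

variable [SecondCountableTopology E]

/-- In the exponent, `β * γ` comes from the local Lipschitz constant and `a * p / 2` from the square
root of the `p`-th moments. The rate `a` is left free: it is `r'` when the moments of `μ` are
derived, and `q'` in the main proof. -/
theorem ExactAssumption.exists_transOp_sub_le (h1 : ExactAssumption P X r r' γ₁ β l l' ρ)
    (hX : IsMarkovFamily P ℱ X) {p γ K a C : ℝ} {f : E → ℝ} (hf : HolderGrowth p γ K f)
    (hp : 0 < p) (hγ : 0 < γ) (hγ1 : γ ≤ 1) (ha : 0 ≤ a)
    (hM : ∀ t y, MomentLE P (X 0 t y) p (C * wt y ^ (a * p))) :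
    ∃ C', 0 ≤ C' ∧ ∀ t y z, |transOp P X 0 t f y - transOp P X 0 t f z|
      ≤ C' * ‖y - z‖ ^ γ * (wt y * wt z) ^ (β * γ + a * p / 2) * (ρ t : ℝ) ^ γ := by
  obtain ⟨L, hL, hatt⟩ := h1.attractive
  have hC : 0 ≤ C := nonneg_of_mul_nonneg_left (hM 0 0).nonneg (wt_rpow_pos _ _)
  have hβ := h1.β_nonneg
  have hK := hf.nonneg
  refine ⟨K * ((3 * L) ^ γ * √(2 * C)), by positivity, fun t y z => ?_⟩
  set W := wt y * wt z with hWdef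
  have hW1 : 1 ≤ W := one_le_mul_of_one_le_of_one_le (one_le_wt y) (one_le_wt z)
  have hW : 0 < W := by linarith
  have hsum : 1 + ‖y‖ ^ β + ‖z‖ ^ β ≤ 3 * W ^ β := by
    have e : W ^ β = wt y ^ β * wt z ^ β := Real.mul_rpow (wt_pos y).le (wt_pos z).le
    have a := one_le_wt_rpow y hβ
    have b := one_le_wt_rpow z hβ
    have a' : wt y ^ β ≤ wt y ^ β * wt z ^ β := le_mul_of_one_le_right (by linarith) b
    have b' : wt z ^ β ≤ wt y ^ β * wt z ^ β := le_mul_of_one_le_left (by linarith) a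
    have c := norm_rpow_le_wt_rpow y hβ
    have d := norm_rpow_le_wt_rpow z hβ
    rw [e]; linarith
  have hb : L * ‖y - z‖ * (1 + ‖y‖ ^ β + ‖z‖ ^ β) * ρ t ≤ (3 * L) * ‖y - z‖ * W ^ β * ρ t := by
    have := mul_le_mul_of_nonneg_left hsum
      (show 0 ≤ L * ‖y - z‖ * ρ t by positivity)
    linarith
  have h := hf.abs_integral_sub_le hp hγ.le hγ1 (hX.measurable (zero_le (a := t)) y).aemeasurable
    (hX.measurable (zero_le (a := t)) z).aemeasurable
    (a := (3 * L) * ‖y - z‖ * W ^ β * ρ t) (by positivity)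
    ((hatt y z t).trans (ENNReal.ofReal_le_ofReal hb)) (hM t y) (hM t z)
  refine h.trans ?_
  have hs := sqrt_add_moment_le hC y z (s := a * p) (by positivity)
  have e1 : ((3 * L) * ‖y - z‖ * W ^ β * ρ t) ^ γ
      = (3 * L) ^ γ * ‖y - z‖ ^ γ * W ^ (β * γ) * (ρ t : ℝ) ^ γ := by
    rw [Real.mul_rpow (by positivity) (by positivity), Real.mul_rpow (by positivity)
      (by positivity), Real.mul_rpow (by positivity) (by positivity), ← Real.rpow_mul hW.le]
  rw [e1, Real.rpow_add hW]
  calc _ ≤ K * ((3 * L) ^ γ * ‖y - z‖ ^ γ * W ^ (β * γ) * (ρ t : ℝ) ^ γ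
        * (√(2 * C) * W ^ (a * p / 2))) := by gcongr
    _ = _ := by ring

/-- Convergence of the transition semigroup towards an invariant measure with enough moments. -/
theorem exists_transOp_sub_integral_le (hX : IsMarkovFamily P ℱ X) {μ : Measure E}
    [IsProbabilityMeasure μ] (hμ : IsInvariantMeasure P X μ) {p γ K C e R : ℝ} {f : E → ℝ}
    (hf : HolderGrowth p γ K f) (hγ : 0 < γ) (hC : 0 ≤ C)
    (hpe : p / 2 ≤ γ + e) (hμm : MomentLE μ id (γ + e) R)
    (h : ∀ t y z, |transOp P X 0 t f y - transOp P X 0 t f z|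
      ≤ C * ‖y - z‖ ^ γ * (wt y * wt z) ^ e * (ρ t : ℝ) ^ γ) :
    Integrable f μ ∧ ∀ t y, |transOp P X 0 t f y - ∫ z, f z ∂μ|
      ≤ C * R * wt y ^ (γ + e) * (ρ t : ℝ) ^ γ := by
  have hfi : Integrable f μ := (hμm.1.const_mul K).mono' hf.meas.aestronglyMeasurable
    (Eventually.of_forall fun u => (hf.growth u).trans
      (mul_le_mul_of_nonneg_left (wt_rpow_mono u hpe) hf.nonneg))
  refine ⟨hfi, fun t y => ?_⟩
  obtain ⟨hi, hie⟩ := hμ.integral_transOp hX t hf.meas hfi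
  have hb : ∀ z, |transOp P X 0 t f y - transOp P X 0 t f z|
      ≤ C * wt y ^ (γ + e) * (ρ t : ℝ) ^ γ * wt z ^ (γ + e) := fun z => by
    refine (h t y z).trans ?_
    have h0 := wt_pos y
    have h0' := wt_pos z
    have hn : ‖y - z‖ ^ γ ≤ (wt y * wt z) ^ γ := by
      refine Real.rpow_le_rpow (norm_nonneg _) ((norm_sub_le y z).trans ?_) hγ.le
      simp only [wt]
      nlinarith [norm_nonneg y, norm_nonneg z]
    calc C * ‖y - z‖ ^ γ * (wt y * wt z) ^ e * (ρ t : ℝ) ^ γ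
        ≤ C * (wt y * wt z) ^ γ * (wt y * wt z) ^ e * (ρ t : ℝ) ^ γ := by gcongr
      _ = _ := by
          rw [Real.mul_rpow h0.le h0'.le, Real.mul_rpow h0.le h0'.le, Real.rpow_add h0,
            Real.rpow_add h0']
          ring
  -- By invariance `μ(f)` is the `μ`-average of `P_t f`, so only differences between two starting
  -- points remain.
  rw [← hie]
  have e2 : transOp P X 0 t f y - ∫ z, transOp P X 0 t f z ∂μ
      = ∫ z, (transOp P X 0 t f y - transOp P X 0 t f z) ∂μ := by
    rw [integral_sub (integrable_const _) hi]; simp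
  rw [e2]
  calc |∫ z, (transOp P X 0 t f y - transOp P X 0 t f z) ∂μ|
      ≤ ∫ z, |transOp P X 0 t f y - transOp P X 0 t f z| ∂μ := abs_integral_le_integral_abs
    _ ≤ ∫ z, C * wt y ^ (γ + e) * (ρ t : ℝ) ^ γ * wt z ^ (γ + e) ∂μ :=
        integral_mono ((integrable_const _).sub hi).abs (hμm.1.const_mul _) hb
    _ = C * wt y ^ (γ + e) * (ρ t : ℝ) ^ γ * ∫ z, wt z ^ (γ + e) ∂μ := integral_const_mul _ _
    _ ≤ C * wt y ^ (γ + e) * (ρ t : ℝ) ^ γ * R := by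
        have := (wt_rpow_pos y (γ + e)).le
        gcongr
        exact hμm.2
    _ = _ := by ring

/-- The invariant measure inherits the moments of the process. -/
theorem ExactAssumption.exists_momentLE_invariant (h1 : ExactAssumption P X r r' γ₁ β l l' ρ)
    (hX : IsMarkovFamily P ℱ X) {μ : Measure E} [IsProbabilityMeasure μ]
    (hμ : IsInvariantMeasure P X μ) : ∃ C, MomentLE μ id r C := by
  obtain ⟨C, hC, hM⟩ := h1.exists_momentLE hX
  have hr := h1.r_ge
  have hr' := h1.r'_ge
  refine ⟨C * wt (0 : E) ^ (r' * r), ?_⟩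
  have hprob : ∀ k : ℕ, IsProbabilityMeasure (P.map (X 0 ((k + 1 : ℕ) : ℝ≥0) 0)) := fun k =>
    Measure.isProbabilityMeasure_map (hX.measurable zero_le 0).aemeasurable
  refine LipschitzTendsto.momentLE (ν := fun k : ℕ => P.map (X 0 ((k + 1 : ℕ) : ℝ≥0) 0)) ?_
    fun k => (momentLE_map_iff (hX.measurable zero_le 0).aemeasurable).2 (hM _ 0)
  intro g B L hB hL
  have hgm := hL.continuous.measurable
  have hg := HolderGrowth.of_lipschitz (p := 2) (by norm_num) h1.γ₁_pos h1.γ₁_le hB hL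
  have hgi : Integrable g μ := Integrable.of_bound hgm.aestronglyMeasurable B
    (Eventually.of_forall hB)
  obtain ⟨C', hC', hc⟩ := h1.exists_transOp_sub_le hX hg two_pos h1.γ₁_pos h1.γ₁_le
    (a := r') (by linarith)
    (fun t y => (hM t y).lower hC (by norm_num) h1.r_ge (by linarith))
  have hρ : Tendsto (fun k : ℕ => (ρ ((k + 1 : ℕ) : ℝ≥0) : ℝ) ^ γ₁) atTop (𝓝 0) :=
    h1.ρ_summable.tendsto_atTop_zero
  have hbd : ∀ t y, |transOp P X 0 t g y| ≤ B := fun t y => by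
    unfold transOp
    have := norm_integral_le_of_norm_le_const (μ := P) (f := fun ω => g (X 0 t y ω))
      (C := B) (Eventually.of_forall fun ω => hB _)
    simpa using this
  have e : ∀ k : ℕ, ∫ u, g u ∂P.map (X 0 ((k + 1 : ℕ) : ℝ≥0) 0)
      = transOp P X 0 ((k + 1 : ℕ) : ℝ≥0) g 0 := fun k => by
    rw [← hX.integral_kernel zero_le 0 hgm, hX.kernel_apply]
  simp only [e]
  -- Attractiveness makes the starting point irrelevant as `k → ∞`, while invariance keeps the
  -- average over `z ~ μ` fixed. Hence the laws of `X` started at `0` converge weakly to `μ`.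
  have hlim : Tendsto (fun k : ℕ => ∫ z, (transOp P X 0 ((k + 1 : ℕ) : ℝ≥0) g 0
      - transOp P X 0 ((k + 1 : ℕ) : ℝ≥0) g z) ∂μ) atTop (𝓝 (∫ _, (0 : ℝ) ∂μ)) := by
    refine tendsto_integral_of_dominated_convergence (fun _ => 2 * B) (fun k => ?_)
      (integrable_const _) (fun k => Eventually.of_forall fun z => ?_)
      (Eventually.of_forall fun z => ?_)
    · exact (measurable_const.sub (hX.measurable_transOp' zero_le hgm)).aestronglyMeasurable
    · rw [Real.norm_eq_abs]
      refine (abs_sub _ _).trans ?_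
      linarith [hbd ((k + 1 : ℕ) : ℝ≥0) 0, hbd ((k + 1 : ℕ) : ℝ≥0) z]
    · refine squeeze_zero_norm (fun k => hc ((k + 1 : ℕ) : ℝ≥0) 0 z) ?_
      simpa using hρ.const_mul (C' * ‖0 - z‖ ^ γ₁ * (wt 0 * wt z) ^ (β * γ₁ + r' * 2 / 2))
  rw [integral_zero] at hlim
  refine tendsto_sub_nhds_zero_iff.1 (hlim.congr fun k => ?_)
  obtain ⟨hi, hie⟩ := hμ.integral_transOp hX ((k + 1 : ℕ) : ℝ≥0) hgm hgi
  rw [integral_sub (integrable_const _) hi, hie]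
  simp

/-- Time regularity of the transition semigroup. -/
theorem ExactAssumption.exists_transOp_add_sub_le (h1 : ExactAssumption P X r r' γ₁ β l l' ρ)
    (hX : IsMarkovFamily P ℱ X) (hXhom : IsTimeHomogeneous P X) {p γ K : ℝ} {f : E → ℝ}
    (hf : HolderGrowth p γ K f) (hp : 0 < p) (hγ : 0 < γ) (hγ1 : γ ≤ 1)
    (hpler : p ≤ r) (hexp : l * γ + r' * p / 2 ≤ r) :
    ∃ C, 0 ≤ C ∧ ∀ t h y, |transOp P X 0 (t + h) f y - transOp P X 0 t f y|
      ≤ C * wt y ^ (r' * r) * (h : ℝ) ^ (l' * γ) := by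
  obtain ⟨C, hC, hM⟩ := h1.exists_momentLE hX
  obtain ⟨L, hL, hreg⟩ := h1.regular
  have hr := h1.r_ge
  have hr' := h1.r'_ge
  have hl := h1.l_nonneg
  have hK := hf.nonneg
  have hpr : p ≤ r' * p := le_mul_of_one_le_left hp.le hr'
  have hlγ : 0 ≤ l * γ := by positivity
  have hpr2 : p / 2 ≤ r := by linarith
  have hint : ∀ t y, Integrable (fun ω => f (X 0 t y ω)) P := fun t y =>
    hf.integrable (hX.measurable zero_le y).aemeasurable
      ((hM t y).lower hC (by linarith) hpr2 (by linarith))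
  set D := K * ((2 * L) ^ γ * √(2 * C)) with hD
  have hD0 : 0 ≤ D := by positivity
  -- The increment over `[0, h]` is estimated first; the semigroup property then averages it over
  -- the law of `X` at time `t`. Growth of order `r` is the most that the moments of `X` can absorb.
  have hg : ∀ (h : ℝ≥0) u, |transOp P X 0 h f u - f u| ≤ D * (h : ℝ) ^ (l' * γ) * wt u ^ r := by
    intro h u
    have hb : L * (1 + ‖u‖ ^ l) * (h : ℝ) ^ l' ≤ (2 * L) * wt u ^ l * (h : ℝ) ^ l' := by
      have := mul_le_mul_of_nonneg_left (one_add_norm_rpow_le u hl)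
        (show 0 ≤ L * (h : ℝ) ^ l' by positivity)
      linarith
    have hwl := (wt_rpow_pos u l).le
    have hmom := (hM h u).lower hC hp.le hpler (by linarith)
    have hmc : MomentLE P (fun _ => u) p (C * wt u ^ (r' * p)) :=
      (momentLE_const u p).mono ((wt_rpow_mono u hpr).trans
        (le_mul_of_one_le_left (wt_rpow_pos _ _).le hC))
    have hh := hf.abs_integral_sub_le hp hγ.le hγ1 (hX.measurable (zero_le (a := h)) u).aemeasurable
      aemeasurable_const (a := (2 * L) * wt u ^ l * (h : ℝ) ^ l') (by positivity)
      ((hreg u h).trans (ENNReal.ofReal_le_ofReal hb)) hmom hmc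
    have e0 : ∫ _, f u ∂P = f u := by simp
    rw [e0] at hh
    refine hh.trans ?_
    have e1 : ((2 * L) * wt u ^ l * (h : ℝ) ^ l') ^ γ
        = (2 * L) ^ γ * wt u ^ (l * γ) * (h : ℝ) ^ (l' * γ) := by
      rw [Real.mul_rpow (by positivity) (by positivity), Real.mul_rpow (by positivity)
        (by positivity), ← Real.rpow_mul (wt_pos u).le, ← Real.rpow_mul h.coe_nonneg]
    have e2 : √(C * wt u ^ (r' * p) + C * wt u ^ (r' * p)) = √(2 * C) * wt u ^ (r' * p / 2) := by
      rw [show C * wt u ^ (r' * p) + C * wt u ^ (r' * p) = 2 * C * wt u ^ (r' * p) by ring,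
        Real.sqrt_mul (by positivity), Real.sqrt_eq_rpow (wt u ^ (r' * p)),
        ← Real.rpow_mul (wt_pos u).le]
      congr 2; ring
    rw [e1, e2]
    calc K * ((2 * L) ^ γ * wt u ^ (l * γ) * (h : ℝ) ^ (l' * γ)
          * (√(2 * C) * wt u ^ (r' * p / 2)))
        = D * (h : ℝ) ^ (l' * γ) * wt u ^ (l * γ + r' * p / 2) := by
          rw [Real.rpow_add (wt_pos u), hD]; ring
      _ ≤ _ := by gcongr; exact one_le_wt u
  refine ⟨D * C, by positivity, fun t h y => ?_⟩
  obtain ⟨hi, hie⟩ := hXhom.transOp_add hX t h hf.meas y (hint _ _)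
  rw [← hie]
  change |_ - ∫ ω, f (X 0 t y ω) ∂P| ≤ _
  rw [← integral_sub hi (hint t y)]
  calc _ ≤ ∫ ω, |transOp P X 0 h f (X 0 t y ω) - f (X 0 t y ω)| ∂P :=
        abs_integral_le_integral_abs
    _ ≤ ∫ ω, D * (h : ℝ) ^ (l' * γ) * wt (X 0 t y ω) ^ r ∂P :=
        integral_mono (hi.sub (hint t y)).abs ((hM t y).1.const_mul _) fun ω => hg h _
    _ = D * (h : ℝ) ^ (l' * γ) * ∫ ω, wt (X 0 t y ω) ^ r ∂P := integral_const_mul _ _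
    _ ≤ D * (h : ℝ) ^ (l' * γ) * (C * wt y ^ (r' * r)) := by
        gcongr
        exact (hM t y).2
    _ = _ := by ring

end Exact

/-! ### Grid times -/

section Grid

variable {τ : ℕ → ℝ≥0}

theorem gridTime_succ (τ : ℕ → ℝ≥0) (n : ℕ) : gridTime τ (n + 1) = gridTime τ n + τ (n + 1) :=
  Finset.sum_range_succ _ _

theorem IsStepSequence.exists_gridTime_le_lt (hτ : IsStepSequence τ) (m : ℕ) (t : ℝ≥0) :
    ∃ n, m ≤ n ∧ gridTime τ n ≤ gridTime τ m + t ∧ gridTime τ m + t < gridTime τ (n + 1) := by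
  have hex : ∃ N, gridTime τ m + t < gridTime τ N :=
    (hτ.tendsto_atTop.eventually_gt_atTop _).exists
  classical
  have hspec := Nat.find_spec hex
  have hpos : m < Nat.find hex := by
    by_contra h
    exact absurd (hspec.trans_le (gridTime_mono τ (not_lt.1 h))) (by simp)
  refine ⟨Nat.find hex - 1, by omega, not_lt.1 (Nat.find_min hex (by omega)), ?_⟩
  rwa [Nat.sub_add_cancel (by omega)]

/-- For `α = 0`, condition (i) would make `∑ τ_k` finite, against `t_n → ∞`. Positivity is what
gives `τ_n^{γα} → 0`. -/
theorem IsStepSequence.α_pos (hτ : IsStepSequence τ) {γ α : ℝ} (hα : 0 ≤ α)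
    (hi : Summable fun k : ℕ => (τ (k + 1) : ℝ) ^ (1 + γ * α)) : 0 < α := by
  refine hα.lt_of_ne' fun h0 => ?_
  simp only [h0, mul_zero, add_zero, Real.rpow_one] at hi
  have hs : Summable τ := by
    rw [← NNReal.summable_coe]
    exact (summable_nat_add_iff 1).1 hi
  obtain ⟨N, hN⟩ := (hτ.tendsto_atTop.eventually_gt_atTop (∑' k, τ k)).exists
  exact absurd hN (not_lt.2 (hs.sum_le_tsum _ fun _ _ => zero_le))

end Grid

/-! ### Transfer of bounds between the exact process and its approximation -/

section Approximation

theorem continuous_transOp_of_regular {Ω E : Type*} {mΩ : MeasurableSpace Ω} {P : Measure Ω}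
    {X : ℝ≥0 → ℝ≥0 → E → Ω → E} {f : E → ℝ} {y : E} {C s : ℝ} (hs : 0 < s)
    (h : ∀ t h : ℝ≥0, |transOp P X 0 (t + h) f y - transOp P X 0 t f y| ≤ C * (h : ℝ) ^ s) :
    Continuous fun t : ℝ≥0 => transOp P X 0 t f y := by
  have hd : ∀ t u : ℝ≥0, |transOp P X 0 t f y - transOp P X 0 u f y| ≤ C * (dist t u) ^ s := by
    intro t u
    rcases le_total u t with hle | hle
    · have := h u (t - u)
      rwa [add_tsub_cancel_of_le hle, NNReal.coe_sub hle, ← abs_of_nonneg (sub_nonneg.2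
        (NNReal.coe_le_coe.2 hle)), ← NNReal.dist_eq] at this
    · have := h t (u - t)
      rwa [add_tsub_cancel_of_le hle, NNReal.coe_sub hle, ← abs_of_nonneg (sub_nonneg.2
        (NNReal.coe_le_coe.2 hle)), ← NNReal.dist_eq, abs_sub_comm, dist_comm] at this
  rw [continuous_iff_continuousAt]
  intro u
  rw [ContinuousAt, tendsto_iff_norm_sub_tendsto_zero]
  refine squeeze_zero (fun _ => norm_nonneg _) (fun t => hd t u) ?_
  have hc : Continuous fun t : ℝ≥0 => C * (dist t u) ^ s :=
    ((continuous_id.dist continuous_const).rpow_const fun _ => Or.inr hs.le).const_mul C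
  simpa [Real.zero_rpow hs.ne'] using hc.tendsto u

variable {Ω E : Type*} {mΩ : MeasurableSpace Ω} [NormedAddCommGroup E]
  [MeasurableSpace E] [BorelSpace E] [SecondCountableTopology E]
  {P : Measure Ω} [IsProbabilityMeasure P] {ℱ : Filtration ℝ≥0 mΩ} {X : ℝ≥0 → ℝ≥0 → E → Ω → E}
  {r r' γ₁ β l l' : ℝ} {ρ : ℝ≥0 → ℝ≥0}

variable {Y : ℕ → ℕ → E → Ω → E} {τ : ℕ → ℝ≥0} {q q' κ α : ℝ} {ρτ : ℝ≥0 → ℝ≥0}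

/-- The transition operators of the exact process and of its approximation are close. -/
theorem ConvergenceAssumption.exists_transOp_sub_le
    (h3 : ConvergenceAssumption P X Y τ r' q' α) (hX : IsMarkovFamily P ℱ X)
    (hXhom : IsTimeHomogeneous P X) (hY : IsMarkovFamily P (gridFiltration ℱ τ) Y)
    {p γ K a C : ℝ} {f : E → ℝ} (hf : HolderGrowth p γ K f) (hp : 0 < p) (hγ : 0 < γ)
    (hγ1 : γ ≤ 1) (hr' : 1 ≤ r') (hC : 0 ≤ C)
    (hM : ∀ t y, MomentLE P (X 0 t y) p (C * wt y ^ (a * p)))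
    (hMY : ∀ m n y, m ≤ n → MomentLE P (Y m n y) p (C * wt y ^ (a * p))) :
    ∃ C', 0 ≤ C' ∧ ∀ m n y, 1 ≤ m → m ≤ n →
      |transOp P Y m n f y - transOp P X 0 (gridTime τ n - gridTime τ m) f y|
        ≤ C' * wt y ^ (max r' q' * γ + a * p / 2) * (τ n : ℝ) ^ (γ * α) := by
  obtain ⟨L, hL, hc⟩ := h3.bound
  have hK := hf.nonneg
  set d := max r' q' with hd
  have hd0 : 0 ≤ d := by linarith [le_max_left r' q']
  refine ⟨K * ((2 * L) ^ γ * √(2 * C)), by positivity, fun m n y hm hmn => ?_⟩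
  have hg := gridTime_mono τ hmn
  have hwd := (wt_rpow_pos y d).le
  have hb : L * (1 + ‖y‖ ^ d) * (τ n : ℝ) ^ α ≤ (2 * L) * wt y ^ d * (τ n : ℝ) ^ α := by
    have := mul_le_mul_of_nonneg_left (one_add_norm_rpow_le y hd0)
      (show 0 ≤ L * (τ n : ℝ) ^ α by positivity)
    linarith
  have hMX : MomentLE P (X (gridTime τ m) (gridTime τ n) y) p (C * wt y ^ (a * p)) := by
    rw [← momentLE_map_iff (hX.measurable hg y).aemeasurable, hXhom _ _ y hg,
      momentLE_map_iff (hX.measurable zero_le y).aemeasurable]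
    exact hM _ y
  have h := hf.abs_integral_sub_le hp hγ.le hγ1 (hX.measurable hg y).aemeasurable
    (hY.measurable hmn y).aemeasurable (a := (2 * L) * wt y ^ d * (τ n : ℝ) ^ α) (by positivity)
    ((hc y m n hm hmn).trans (ENNReal.ofReal_le_ofReal hb)) hMX (hMY m n y hmn)
  have e0 : ∫ ω, f (X (gridTime τ m) (gridTime τ n) y ω) ∂P
      = transOp P X 0 (gridTime τ n - gridTime τ m) f y := by
    rw [← hXhom.transOp_eq hX hg hf.meas]; rfl
  rw [e0, abs_sub_comm] at h
  refine h.trans (le_of_eq ?_)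
  have e1 : ((2 * L) * wt y ^ d * (τ n : ℝ) ^ α) ^ γ
      = (2 * L) ^ γ * wt y ^ (d * γ) * (τ n : ℝ) ^ (γ * α) := by
    rw [Real.mul_rpow (by positivity) (by positivity), Real.mul_rpow (by positivity)
      (by positivity), ← Real.rpow_mul (wt_pos y).le, ← Real.rpow_mul (NNReal.coe_nonneg _),
      mul_comm α γ]
  have e2 : √(C * wt y ^ (a * p) + C * wt y ^ (a * p)) = √(2 * C) * wt y ^ (a * p / 2) := by
    rw [show C * wt y ^ (a * p) + C * wt y ^ (a * p) = 2 * C * wt y ^ (a * p) by ring,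
      Real.sqrt_mul (by positivity), Real.sqrt_eq_rpow (wt y ^ (a * p)),
      ← Real.rpow_mul (wt_pos y).le]
    congr 2; ring
  rw [e1, e2, Real.rpow_add (wt_pos y)]
  ring

/-- The exact process inherits the moment bounds of its approximations. -/
theorem ConvergenceAssumption.momentLE_exact
    (h3 : ConvergenceAssumption P X Y τ r' q' α) (hα : 0 < α) (hτ : IsStepSequence τ)
    (h1 : ExactAssumption P X r r' γ₁ β l l' ρ) (h2 : ApproxAssumption P Y τ q q' κ ρτ)
    (hX : IsMarkovFamily P ℱ X) (hXhom : IsTimeHomogeneous P X)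
    (hY : IsMarkovFamily P (gridFiltration ℱ τ) Y) {p γ : ℝ} (hp : 0 < p) (hpr : p ≤ r)
    (hpq : p ≤ q) (hγ : 0 < γ) (hγ1 : γ ≤ 1) (hexp : l * γ + r' * p / 2 ≤ r)
    {C : ℝ} (hM : ∀ m n y, m ≤ n → MomentLE P (Y m n y) q (C * wt y ^ (q' * q))) (t : ℝ≥0)
    (y : E) : MomentLE P (X 0 t y) q (C * wt y ^ (q' * q)) := by
  obtain ⟨C₁, hC₁, hM₁⟩ := h1.exists_momentLE hX
  obtain ⟨C₂, hC₂, hM₂⟩ := h2.exists_momentLE hY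
  have hr := h1.r_ge
  have hq := h2.q_ge
  -- `Y` is started at `t_{m+1}` and observed at the last grid time not exceeding `t_{m+1} + t`. As
  -- `m → ∞` the steps vanish, so the elapsed time tends to `t` and the strong error to `0`: these
  -- laws converge weakly to that of `X 0 t y` and pass their moments on.
  choose n hn1 hn2 hn3 using fun m => hτ.exists_gridTime_le_lt (m + 1) t
  have hXm := (hX.measurable (zero_le (a := t)) y).aemeasurable (μ := P)
  have hYm := fun m => (hY.measurable (hn1 m) y).aemeasurable (μ := P)
  have := fun m => Measure.isProbabilityMeasure_map (hYm m)
  have := Measure.isProbabilityMeasure_map hXm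
  rw [← momentLE_map_iff hXm]
  refine LipschitzTendsto.momentLE (ν := fun m => P.map (Y (m + 1) (n m) y)) ?_
    fun m => (momentLE_map_iff (hYm m)).2 (hM _ _ y (hn1 m))
  intro g B L hB hL
  have hgm := hL.continuous.measurable
  have hg := HolderGrowth.of_lipschitz hp.le hγ hγ1 hB hL
  have e1 : ∀ m, ∫ u, g u ∂P.map (Y (m + 1) (n m) y) = transOp P Y (m + 1) (n m) g y := fun m => by
    rw [← hY.integral_kernel (hn1 m) y hgm, hY.kernel_apply]
  have e2 : ∫ u, g u ∂P.map (X 0 t y) = transOp P X 0 t g y := by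
    rw [← hX.integral_kernel zero_le y hgm, hX.kernel_apply]
  simp only [e1, e2]
  obtain ⟨D, hD, hreg⟩ := h1.exists_transOp_add_sub_le hX hXhom hg hp hγ hγ1 hpr hexp
  -- The starting point `y` is fixed here, so a crude common growth rate is enough.
  set a := max r' q' with ha
  set C' := max C₁ C₂ with hC'
  have hmax1 : ∀ t y, MomentLE P (X 0 t y) p (C' * wt y ^ (a * p)) := fun t y =>
    ((hM₁ t y).lower hC₁ hp.le hpr (by linarith)).mono (mul_le_mul (le_max_left _ _)
      (wt_rpow_mono y (mul_le_mul_of_nonneg_right (le_max_left _ _) hp.le))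
      (wt_rpow_pos _ _).le (by linarith [le_max_left C₁ C₂]))
  have hmax2 : ∀ m n y, m ≤ n → MomentLE P (Y m n y) p (C' * wt y ^ (a * p)) := fun m n y hmn =>
    ((hM₂ m n y hmn).lower hC₂ hp.le hpq (by linarith)).mono (mul_le_mul (le_max_right _ _)
      (wt_rpow_mono y (mul_le_mul_of_nonneg_right (le_max_right _ _) hp.le))
      (wt_rpow_pos _ _).le (by linarith [le_max_left C₁ C₂]))
  obtain ⟨D', hD', hconv⟩ := h3.exists_transOp_sub_le hX hXhom hY hg hp hγ hγ1 h1.r'_ge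
    (by linarith [le_max_left C₁ C₂]) hmax1 hmax2
  have hnlim : Tendsto n atTop atTop := tendsto_atTop_mono (fun m => (Nat.le_succ m).trans (hn1 m))
    tendsto_id
  have hτn : Tendsto (fun m => (τ (n m) : ℝ) ^ (γ * α)) atTop (𝓝 0) := by
    have h0 : Tendsto (fun m => (τ (n m) : ℝ)) atTop (𝓝 0) := by
      exact_mod_cast (NNReal.tendsto_coe.2 hτ.tendsto_zero).comp hnlim
    have := h0.rpow_const (p := γ * α) (Or.inr (by positivity))
    rwa [Real.zero_rpow (by positivity)] at this
  have hτn' : Tendsto (fun m => τ (n m + 1)) atTop (𝓝 0) :=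
    hτ.tendsto_zero.comp ((tendsto_add_atTop_nat 1).comp hnlim)
  have hs : Tendsto (fun m => gridTime τ (n m) - gridTime τ (m + 1)) atTop (𝓝 t) := by
    have hlow : Tendsto (fun m => t - τ (n m + 1)) atTop (𝓝 (t - 0)) :=
      tendsto_const_nhds.sub hτn'
    rw [tsub_zero] at hlow
    refine tendsto_of_tendsto_of_tendsto_of_le_of_le hlow tendsto_const_nhds (fun m => ?_)
      fun m => ?_
    · have := (hn3 m).le
      rw [gridTime_succ τ (n m)] at this
      rw [tsub_le_iff_right, tsub_add_eq_add_tsub (gridTime_mono τ (hn1 m))]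
      exact le_tsub_of_add_le_left this
    · exact tsub_le_iff_left.2 (hn2 m)
  have hl' := h1.l'_pos
  have hcont := (continuous_transOp_of_regular (P := P) (X := X) (f := g) (y := y)
    (C := D * wt y ^ (r' * r)) (s := l' * γ) (by positivity) fun t h => hreg t h y).tendsto t
  have hlim1 := hcont.comp hs
  have hlim2 : Tendsto (fun m => transOp P Y (m + 1) (n m) g y
      - transOp P X 0 (gridTime τ (n m) - gridTime τ (m + 1)) g y) atTop (𝓝 0) := by
    refine squeeze_zero_norm (fun m => hconv (m + 1) (n m) y (by omega) (hn1 m)) ?_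
    simpa using hτn.const_mul (D' * wt y ^ (max r' q' * γ + a * p / 2))
  simpa [Function.comp_def] using hlim2.add hlim1

end Approximation

/-! ### Consequences of the step conditions -/

section Steps

theorem tendsto_weighted_cesaro {τ : ℕ → ℝ≥0} (hτ : Tendsto (gridTime τ) atTop atTop) {a : ℕ → ℝ}
    (ha : Tendsto a atTop (𝓝 0)) :
    Tendsto (fun n => (∑ k ∈ Finset.range n, (τ k : ℝ) * a k) / gridTime τ n) atTop (𝓝 0) := by
  have hsum : Tendsto (fun n => ∑ k ∈ Finset.range n, (τ k : ℝ)) atTop atTop := by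
    rw [← tendsto_add_atTop_iff_nat 1]
    have := NNReal.tendsto_coe_atTop.2 hτ
    simpa [gridTime] using this
  have ho : (fun k => (τ k : ℝ) * a k) =o[atTop] fun k => (τ k : ℝ) := by
    simpa using (Asymptotics.isBigO_refl (fun k => (τ k : ℝ)) atTop).mul_isLittleO
      ((Asymptotics.isLittleO_one_iff ℝ).2 ha)
  have h1 := ho.sum_range (fun k => (τ k).coe_nonneg) hsum
  have h2 : (fun n => ∑ k ∈ Finset.range n, (τ k : ℝ)) =O[atTop] fun n => (gridTime τ n : ℝ) := by
    refine Asymptotics.IsBigO.of_bound 1 (Eventually.of_forall fun n => ?_)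
    rw [one_mul, Real.norm_of_nonneg (Finset.sum_nonneg fun k _ => (τ k).coe_nonneg),
      Real.norm_of_nonneg (NNReal.coe_nonneg _)]
    simp only [gridTime, NNReal.coe_sum]
    exact Finset.sum_le_sum_of_subset_of_nonneg (Finset.range_mono (Nat.le_succ n))
      fun k _ _ => (τ k).coe_nonneg
  exact (h1.trans_isBigO h2).tendsto_div_nhds_zero

theorem summable_and_tsum_le_of_ennreal {g : ℕ → ℝ≥0} {B : ℝ≥0∞} (hB : B ≠ ∞)
    (h : ∑' i, (g i : ℝ≥0∞) ≤ B) :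
    Summable (fun i => (g i : ℝ)) ∧ ∑' i, (g i : ℝ) ≤ B.toReal := by
  have hs : Summable g := ENNReal.tsum_coe_ne_top_iff_summable.1 (h.trans_lt hB.lt_top).ne
  refine ⟨NNReal.summable_coe.2 hs, ?_⟩
  rw [← NNReal.coe_tsum, ← ENNReal.coe_toReal, ENNReal.coe_tsum hs]
  exact ENNReal.toReal_mono hB h

variable {τ : ℕ → ℝ≥0} {ρ ρτ : ℝ≥0 → ℝ≥0} {γ α l' : ℝ}

theorem StepConditions.summable_rpow_order (h : StepConditions τ ρ ρτ γ α l') :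
    Summable fun k : ℕ => (τ k : ℝ) ^ (1 + γ * α) :=
  (summable_nat_add_iff 1).1 h.cond_i

theorem StepConditions.exists_tsum_le (h : StepConditions τ ρ ρτ γ α l') (hγ : 0 ≤ γ) :
    ∃ B, ∀ k, Summable (fun i => (τ (k + i) : ℝ)
        * (ρ (gridTime τ (k + i) - gridTime τ k) : ℝ) ^ γ) ∧
      ∑' i, (τ (k + i) : ℝ) * (ρ (gridTime τ (k + i) - gridTime τ k) : ℝ) ^ γ ≤ B := by
  have := fun k => summable_and_tsum_le_of_ennreal
    (g := fun i => τ (k + i) * ρ (gridTime τ (k + i) - gridTime τ k) ^ γ) h.cond_ii.ne (by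
      refine le_trans (le_of_eq ?_) (le_iSup _ k)
      refine tsum_congr fun i => ?_
      rw [ENNReal.coe_mul, ENNReal.coe_rpow_of_nonneg _ hγ])
  simp only [NNReal.coe_mul, NNReal.coe_rpow] at this
  exact ⟨_, this⟩

/-- A convergent quotient in (iv) is eventually finite, which forces the series inside it to be
finite. -/
theorem StepConditions.summable_rpow_regular (hτ : IsStepSequence τ)
    (h : StepConditions τ ρ ρτ γ α l') (hs : 0 ≤ 1 + l' * γ) :
    Summable fun k : ℕ => (τ k : ℝ) ^ (1 + l' * γ) := by
  have key : ∑' i : ℕ, (τ (1 + 1 + i) : ℝ≥0∞) ^ (1 + l' * γ) ≠ ∞ := by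
    intro htop
    have hev := h.cond_iv.eventually_lt_const (show (0 : ℝ≥0∞) < 1 by norm_num)
    obtain ⟨n, hn, hn2⟩ := (hev.and (eventually_ge_atTop 2)).exists
    refine absurd hn (not_lt.2 ?_)
    -- The index `1` is chosen because `τ 0 = 0` would annihilate an infinite series in `[0, ∞]`.
    have hterm := Finset.single_le_sum (f := fun k => (τ k : ℝ≥0∞) *
      ((∑' i : ℕ, (τ (k + i) : ℝ≥0∞) ^ (γ * α) * (τ (k + i + 1) : ℝ≥0∞))
        + ∑' i : ℕ, (τ (k + 1 + i) : ℝ≥0∞) ^ (1 + l' * γ))) (s := Finset.range n)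
      (fun _ _ => zero_le) (Finset.mem_range.2 (show 1 < n by omega))
    have hτ1 : (τ 1 : ℝ≥0∞) ≠ 0 := by exact_mod_cast (hτ.pos 1 le_rfl).ne'
    simp only [htop, add_top, ENNReal.mul_top hτ1, top_le_iff] at hterm
    rw [hterm, ENNReal.top_div_coe]
    exact le_top
  have := (summable_and_tsum_le_of_ennreal (g := fun i => τ (1 + 1 + i) ^ (1 + l' * γ)) key
    (le_of_eq (tsum_congr fun i => ENNReal.coe_rpow_of_nonneg _ hs))).1
  rw [← summable_nat_add_iff 2]
  refine this.congr fun i => ?_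
  rw [NNReal.coe_rpow, show 1 + 1 + i = i + 2 by omega]

theorem StepConditions.tendsto_regular (hτ : IsStepSequence τ)
    (h : StepConditions τ ρ ρτ γ α l') (hs : 0 ≤ 1 + l' * γ) :
    Tendsto (fun n => (∑ k ∈ Finset.range n, (τ k : ℝ) * ∑' i, (τ (k + 1 + i) : ℝ) ^ (1 + l' * γ))
      / gridTime τ n) atTop (𝓝 0) := by
  have hsum : ∀ k, Summable fun i => τ (k + 1 + i) ^ (1 + l' * γ) := fun k => by
    rw [← NNReal.summable_coe]
    have := (summable_nat_add_iff (k + 1)).2 (h.summable_rpow_regular hτ hs)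
    refine this.congr fun i => ?_
    rw [NNReal.coe_rpow, show k + 1 + i = i + (k + 1) by omega]
  set G : ℕ → ℝ≥0 := fun n => (∑ k ∈ Finset.range n, τ k * ∑' i, τ (k + 1 + i) ^ (1 + l' * γ))
    / gridTime τ n with hG
  have hGlim : Tendsto G atTop (𝓝 0) := by
    rw [← ENNReal.tendsto_coe, ENNReal.coe_zero]
    refine tendsto_of_tendsto_of_tendsto_of_le_of_le' tendsto_const_nhds h.cond_iv
      (Eventually.of_forall fun n => zero_le) ?_
    filter_upwards [hτ.tendsto_atTop.eventually_gt_atTop 0] with n hn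
    rw [hG, ENNReal.coe_div hn.ne', ENNReal.ofNNReal_finsetSum]
    refine ENNReal.div_le_div_right (Finset.sum_le_sum fun k _ => ?_) _
    rw [ENNReal.coe_mul, ENNReal.coe_tsum (hsum k)]
    refine mul_le_mul_right (le_trans (le_of_eq (tsum_congr fun i => ?_)) le_add_self) _
    exact ENNReal.coe_rpow_of_nonneg _ hs
  have := NNReal.tendsto_coe.2 hGlim
  simpa [hG, NNReal.coe_tsum] using this

/-- The error made when the corrector of the approximation is replaced by that of the exact
process at step `k`. -/
def correctorError (τ : ℕ → ℝ≥0) (a b : ℝ) (k : ℕ) : ℝ :=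
  (∑' i, (τ (k + i) : ℝ) ^ a) + τ k + ∑' i, (τ (k + 1 + i) : ℝ) ^ b

theorem correctorError_nonneg (τ : ℕ → ℝ≥0) (a b : ℝ) (k : ℕ) : 0 ≤ correctorError τ a b k := by
  have h1 : 0 ≤ ∑' i, (τ (k + i) : ℝ) ^ a := tsum_nonneg fun i => by positivity
  have h2 : 0 ≤ ∑' i, (τ (k + 1 + i) : ℝ) ^ b := tsum_nonneg fun i => by positivity
  unfold correctorError
  positivity

/-- The tails of the series in (i) and the steps `τ_k` tend to zero, hence so do their weighted
averages; the remaining tail is averaged out by (iv). -/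
theorem StepConditions.tendsto_correctorError (hτ : IsStepSequence τ)
    (h : StepConditions τ ρ ρτ γ α l') (hs : 0 ≤ 1 + l' * γ) :
    Tendsto (fun n => (∑ k ∈ Finset.range n,
      (τ k : ℝ) * correctorError τ (1 + γ * α) (1 + l' * γ) k) / gridTime τ n) atTop (𝓝 0) := by
  have h0 : Tendsto (fun k => (∑' i, (τ (k + i) : ℝ) ^ (1 + γ * α)) + τ k) atTop (𝓝 (0 + 0)) := by
    refine Tendsto.add ?_ (NNReal.tendsto_coe.2 hτ.tendsto_zero)
    have := tendsto_sum_nat_add fun k => (τ k : ℝ) ^ (1 + γ * α)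
    simpa only [add_comm] using this
  rw [add_zero] at h0
  have := (tendsto_weighted_cesaro hτ.tendsto_atTop h0).add (h.tendsto_regular hτ hs)
  rw [add_zero] at this
  refine this.congr fun n => ?_
  rw [← add_div, ← Finset.sum_add_distrib]
  simp only [correctorError, mul_add]

end Steps

/-! ### The corrector -/

section Corrector

variable {τ : ℕ → ℝ≥0}

/-- Right-endpoint rule: an interval of length `h` costs `D * h ^ (1 + s)`. The node `i = 0` lies at
time zero and has no interval, whence the extra term `τ k * |u 0|`. -/
theorem abs_riemannSum_sub_integral_le {u : ℝ≥0 → ℝ} (hu : Continuous u) {D s : ℝ} (hs : 0 ≤ s)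
    (hD : 0 ≤ D) (hreg : ∀ t h : ℝ≥0, |u (t + h) - u t| ≤ D * (h : ℝ) ^ s) (k N : ℕ) :
    |∑ i ∈ Finset.range (N + 1), (τ (k + i) : ℝ) * u (gridTime τ (k + i) - gridTime τ k)
        - ∫ t in (0 : ℝ)..((gridTime τ (k + N) - gridTime τ k : ℝ≥0) : ℝ), u t.toNNReal|
      ≤ τ k * |u 0| + D * ∑ i ∈ Finset.range N, (τ (k + 1 + i) : ℝ) ^ (1 + s) := by
  have hc : Continuous fun t : ℝ => u t.toNNReal := hu.comp continuous_real_toNNReal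
  induction N with
  | zero => simp [abs_mul]
  | succ N ih =>
    set a : ℝ≥0 := gridTime τ (k + N) - gridTime τ k with ha
    set b : ℝ≥0 := gridTime τ (k + (N + 1)) - gridTime τ k with hb
    set h : ℝ≥0 := τ (k + (N + 1)) with hh
    have hab : b = a + h := by
      rw [hb, ha, ← add_assoc, gridTime_succ, hh, ← add_assoc,
        tsub_add_eq_add_tsub (gridTime_mono τ (Nat.le_add_right k N))]
    have hba : (b : ℝ) - a = h := by rw [hab, NNReal.coe_add]; ring
    have hle : (a : ℝ) ≤ b := by have := h.coe_nonneg; linarith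
    rw [Finset.sum_range_succ _ (N + 1),
      Finset.sum_range_succ (fun i => (τ (k + 1 + i) : ℝ) ^ (1 + s)) N,
      ← intervalIntegral.integral_add_adjacent_intervals (hc.intervalIntegrable 0 (a : ℝ))
        (hc.intervalIntegrable (a : ℝ) (b : ℝ))]
    have hstep : |(h : ℝ) * u b - ∫ t in (a : ℝ)..b, u t.toNNReal| ≤ D * (h : ℝ) ^ (1 + s) := by
      have e : (h : ℝ) * u b - ∫ t in (a : ℝ)..b, u t.toNNReal
          = ∫ t in (a : ℝ)..b, (u b - u t.toNNReal) := by
        rw [intervalIntegral.integral_sub intervalIntegrable_const (hc.intervalIntegrable _ _),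
          intervalIntegral.integral_const, hba, smul_eq_mul]
      rw [e]
      have hb2 : ∀ t ∈ Set.uIoc (a : ℝ) b, ‖u b - u t.toNNReal‖ ≤ D * (h : ℝ) ^ s := fun t ht => by
        rw [Set.uIoc_of_le hle] at ht
        have ht0 : 0 ≤ t := a.coe_nonneg.trans ht.1.le
        have htb : t.toNNReal ≤ b := Real.toNNReal_le_iff_le_coe.2 ht.2
        have := hreg t.toNNReal (b - t.toNNReal)
        rw [add_tsub_cancel_of_le htb] at this
        rw [Real.norm_eq_abs]
        refine this.trans ?_
        gcongr
        rw [← NNReal.coe_le_coe, NNReal.coe_sub htb, Real.coe_toNNReal t ht0]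
        linarith [ht.1]
      have := intervalIntegral.norm_integral_le_of_norm_le_const hb2
      rw [hba, abs_of_nonneg h.coe_nonneg, Real.norm_eq_abs] at this
      refine this.trans (le_of_eq ?_)
      rcases h.coe_nonneg.eq_or_lt with h0 | h0
      · rw [← h0, Real.zero_rpow (by positivity : (1 + s) ≠ 0)]; ring
      · rw [Real.rpow_add h0, Real.rpow_one]; ring
    have hidx : τ (k + 1 + N) = h := by rw [hh]; congr 1; omega
    rw [hidx]
    have htri : ∀ x y z w : ℝ, |x + y - (z + w)| ≤ |x - z| + |y - w| := fun x y z w => by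
      rw [show x + y - (z + w) = (x - z) + (y - w) by ring]; exact abs_add_le _ _
    refine (htri _ _ _ _).trans ((add_le_add ih hstep).trans (le_of_eq ?_))
    ring

/-- Two errors add up: replacing `v` by `u` at the nodes, at cost `D' * τ ^ (1 + e)` per step, and
the Riemann error. Both are uniform in the horizon, which is then sent to infinity. -/
theorem abs_tsum_sub_integral_le (hτ : IsStepSequence τ) {u : ℝ≥0 → ℝ} (hu : Continuous u)
    {D D' s e : ℝ} (hs : 0 ≤ s) (he : 0 ≤ e) (hD : 0 ≤ D) (hD' : 0 ≤ D')
    (hreg : ∀ t h : ℝ≥0, |u (t + h) - u t| ≤ D * (h : ℝ) ^ s)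
    (hint : IntegrableOn (fun t : ℝ => u t.toNNReal) (Set.Ioi 0)) {v : ℕ → ℝ} {k : ℕ}
    (hv : ∀ i, |v i - u (gridTime τ (k + i) - gridTime τ k)| ≤ D' * (τ (k + i) : ℝ) ^ e)
    (hsv : Summable fun i => (τ (k + i) : ℝ) * v i)
    (hse : Summable fun i => (τ i : ℝ) ^ (1 + e)) (hss : Summable fun i => (τ i : ℝ) ^ (1 + s)) :
    |(∑' i, (τ (k + i) : ℝ) * v i) - ∫ t in Set.Ioi (0 : ℝ), u t.toNNReal|
      ≤ (D' + |u 0| + D) * correctorError τ (1 + e) (1 + s) k := by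
  have hsum1 : Summable fun i => (τ (k + i) : ℝ) ^ (1 + e) := by
    have := (summable_nat_add_iff k).2 hse
    simpa only [add_comm] using this
  have hsum2 : Summable fun i => (τ (k + 1 + i) : ℝ) ^ (1 + s) := by
    have := (summable_nat_add_iff (k + 1)).2 hss
    refine this.congr fun i => ?_
    rw [show k + 1 + i = i + (k + 1) by omega]
  have hlim1 : Tendsto (fun N => ∑ i ∈ Finset.range (N + 1), (τ (k + i) : ℝ) * v i) atTop
      (𝓝 (∑' i, (τ (k + i) : ℝ) * v i)) :=
    (tendsto_add_atTop_iff_nat 1).2 hsv.hasSum.tendsto_sum_nat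
  have hT : Tendsto (fun N => ((gridTime τ (k + N) - gridTime τ k : ℝ≥0) : ℝ)) atTop atTop := by
    have h1 : Tendsto (fun N => (gridTime τ (k + N) : ℝ)) atTop atTop := by
      refine (NNReal.tendsto_coe_atTop.2 hτ.tendsto_atTop).comp ?_
      simpa only [add_comm] using tendsto_add_atTop_nat k
    refine (tendsto_atTop_add_const_right _ (-(gridTime τ k : ℝ)) h1).congr fun N => ?_
    rw [NNReal.coe_sub (gridTime_mono τ (Nat.le_add_right k N)), sub_eq_add_neg]
  have hlim2 := intervalIntegral_tendsto_integral_Ioi 0 hint hT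
  refine le_of_tendsto ((hlim1.sub hlim2).abs) (Eventually.of_forall fun N => ?_)
  have hR := abs_riemannSum_sub_integral_le (τ := τ) hu hs hD hreg k N
  have hV : |∑ i ∈ Finset.range (N + 1), (τ (k + i) : ℝ) * v i
      - ∑ i ∈ Finset.range (N + 1), (τ (k + i) : ℝ) * u (gridTime τ (k + i) - gridTime τ k)|
      ≤ D' * ∑ i ∈ Finset.range (N + 1), (τ (k + i) : ℝ) ^ (1 + e) := by
    rw [← Finset.sum_sub_distrib, Finset.mul_sum]
    refine (Finset.abs_sum_le_sum_abs _ _).trans (Finset.sum_le_sum fun i _ => ?_)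
    rw [← mul_sub, abs_mul, abs_of_nonneg (NNReal.coe_nonneg _)]
    refine (mul_le_mul_of_nonneg_left (hv i) (NNReal.coe_nonneg _)).trans (le_of_eq ?_)
    rcases (τ (k + i)).coe_nonneg.eq_or_lt with h0 | h0
    · rw [← h0, Real.zero_rpow (by positivity : (1 + e) ≠ 0)]; ring
    · rw [Real.rpow_add h0, Real.rpow_one]; ring
  have b1 : ∑ i ∈ Finset.range (N + 1), (τ (k + i) : ℝ) ^ (1 + e)
      ≤ ∑' i, (τ (k + i) : ℝ) ^ (1 + e) := hsum1.sum_le_tsum _ fun i _ => by positivity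
  have b2 : ∑ i ∈ Finset.range N, (τ (k + 1 + i) : ℝ) ^ (1 + s)
      ≤ ∑' i, (τ (k + 1 + i) : ℝ) ^ (1 + s) := hsum2.sum_le_tsum _ fun i _ => by positivity
  have hk := (τ k).coe_nonneg
  have c1 : 0 ≤ ∑' i, (τ (k + i) : ℝ) ^ (1 + e) := tsum_nonneg fun i => by positivity
  have c2 : 0 ≤ ∑' i, (τ (k + 1 + i) : ℝ) ^ (1 + s) := tsum_nonneg fun i => by positivity
  have hu0 := abs_nonneg (u 0)
  have key := (abs_sub_le _ _ _).trans (add_le_add hV hR)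
  refine key.trans ?_
  unfold correctorError
  have d1 := mul_le_mul_of_nonneg_left b1 hD'
  have d2 := mul_le_mul_of_nonneg_left b2 hD
  set s1 := ∑' i, (τ (k + i) : ℝ) ^ (1 + e)
  set s2 := ∑' i, (τ (k + 1 + i) : ℝ) ^ (1 + s)
  nlinarith [mul_nonneg hD' hk, mul_nonneg hD' c2, mul_nonneg hu0 c1, mul_nonneg hu0 c2,
    mul_nonneg hD c1, mul_nonneg hD hk]

end Corrector

/-! ### Martingale approximation of weighted sums -/

section Hilbert

open scoped InnerProductSpace

variable {H : Type*} [NormedAddCommGroup H] [InnerProductSpace ℝ H]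

/-- With `W n = T n - ∑ τ i • F i` and `D = T (n + 1) - T n`, both `T (n + 1) = D + T n` and `W (n +
1) = D + (W n - τ n • F n)` are orthogonal decompositions. Subtracting the two Pythagorean
identities cancels `‖D‖ ^ 2` and leaves the pairings of `F` with `W`. -/
theorem norm_sq_sub_norm_sq_eq {T F : ℕ → H} {τ : ℕ → ℝ}
    (hT : ∀ k, ⟪T (k + 1) - T k, T k⟫_ℝ = 0)
    (hF : ∀ l k, l ≤ k → ⟪T (k + 1) - T k, F l⟫_ℝ = 0) (n : ℕ) :
    ‖T n‖ ^ 2 - ‖T 0‖ ^ 2 = ‖T n - ∑ i ∈ Finset.range n, τ i • F i‖ ^ 2 - ‖T 0‖ ^ 2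
      + 2 * ∑ k ∈ Finset.range n, τ k * ⟪F k, T k - ∑ i ∈ Finset.range k, τ i • F i⟫_ℝ
      - ∑ k ∈ Finset.range n, τ k ^ 2 * ‖F k‖ ^ 2 := by
  induction n with
  | zero => simp
  | succ n ih =>
    set W : ℕ → H := fun k => T k - ∑ i ∈ Finset.range k, τ i • F i with hW
    set D := T (n + 1) - T n with hD
    have e1 : ‖T (n + 1)‖ ^ 2 = ‖D‖ ^ 2 + ‖T n‖ ^ 2 := by
      have : T (n + 1) = D + T n := by rw [hD]; abel
      rw [this, norm_add_sq_real, hT n]; ring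
    have hDW : ⟪D, W n - τ n • F n⟫_ℝ = 0 := by
      simp only [hW]
      rw [inner_sub_right, inner_sub_right, hT n, inner_sum, inner_smul_right, hF n n le_rfl,
        Finset.sum_eq_zero fun i hi => by
          rw [inner_smul_right, hF i n (Finset.mem_range.1 hi).le, mul_zero]]
      simp
    have e2 : ‖W (n + 1)‖ ^ 2 = ‖D‖ ^ 2 + ‖W n - τ n • F n‖ ^ 2 := by
      have : W (n + 1) = D + (W n - τ n • F n) := by
        simp only [hW, hD, Finset.sum_range_succ]; abel
      rw [this, norm_add_sq_real, hDW]; ring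
    have e3 : ‖W n - τ n • F n‖ ^ 2
        = ‖W n‖ ^ 2 - 2 * (τ n * ⟪F n, W n⟫_ℝ) + τ n ^ 2 * ‖F n‖ ^ 2 := by
      rw [norm_sub_sq_real, inner_smul_right, real_inner_comm, norm_smul, mul_pow,
        Real.norm_eq_abs, sq_abs]
    change _ = ‖W (n + 1)‖ ^ 2 - _ + 2 * (∑ k ∈ Finset.range (n + 1), τ k * ⟪F k, W k⟫_ℝ) - _
    change _ = ‖W n‖ ^ 2 - _ + 2 * (∑ k ∈ Finset.range n, τ k * ⟪F k, W k⟫_ℝ) - _ at ih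
    rw [e1, e2, e3, Finset.sum_range_succ (fun k => τ k * ⟪F k, W k⟫_ℝ),
      Finset.sum_range_succ (fun k => τ k ^ 2 * ‖F k‖ ^ 2)]
    linarith

end Hilbert

/-! ### Conditional series in `L²` and their second moments -/

section Series

variable {Ω : Type*} {mΩ : MeasurableSpace Ω} {P : Measure Ω}

/-- An absolutely convergent series in `L²` converges absolutely almost everywhere, to the
same sum. -/
theorem Lp.ae_summable_and_tsum [IsProbabilityMeasure P] {f : ℕ → Ω → ℝ} (hf : ∀ i, MemLp (f i) 2 P)
    (hs : Summable fun i => ‖(hf i).toLp (f i)‖) :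
    (∀ᵐ ω ∂P, Summable fun i => f i ω) ∧
      (∑' i, (hf i).toLp (f i) : Lp ℝ 2 P) =ᵐ[P] fun ω => ∑' i, f i ω := by
  have h1 : ∀ᵐ ω ∂P, Summable fun i => f i ω := by
    have hm : ∀ i, AEMeasurable (fun ω => ‖f i ω‖ₑ) P := fun i => (hf i).1.enorm
    have hle : ∀ i, ∫⁻ ω, ‖f i ω‖ₑ ∂P ≤ ENNReal.ofReal ‖(hf i).toLp (f i)‖ := fun i => by
      rw [Lp.norm_toLp, ENNReal.ofReal_toReal (hf i).2.ne, ← eLpNorm_one_eq_lintegral_enorm]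
      exact eLpNorm_le_eLpNorm_of_exponent_le (by norm_num) (hf i).1
    have hfin : ∫⁻ ω, ∑' i, ‖f i ω‖ₑ ∂P ≠ ∞ := by
      rw [lintegral_tsum hm]
      refine ((ENNReal.tsum_le_tsum hle).trans_lt ?_).ne
      rw [← ENNReal.ofReal_tsum_of_nonneg (fun i => norm_nonneg _) hs]
      exact ENNReal.ofReal_lt_top
    filter_upwards [ae_lt_top' (AEMeasurable.tsum hm) hfin] with ω hω
    have : Summable fun i => ‖f i ω‖₊ := ENNReal.tsum_coe_ne_top_iff_summable.1 hω.ne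
    exact Summable.of_norm (NNReal.summable_coe.2 this)
  refine ⟨h1, ?_⟩
  -- Convergence in `L²` gives almost sure convergence along a subsequence, which identifies the two
  -- sums.
  have hsum : Summable fun i => (hf i).toLp (f i) := Summable.of_norm hs
  obtain ⟨ns, hns, hlim⟩ :=
    (tendstoInMeasure_of_tendsto_Lp hsum.hasSum.tendsto_sum_nat).exists_seq_tendsto_ae
  have hpart : ∀ n, ((∑ i ∈ Finset.range n, (hf i).toLp (f i) : Lp ℝ 2 P) : Ω → ℝ)
      =ᵐ[P] fun ω => ∑ i ∈ Finset.range n, f i ω := fun n => by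
    induction n with
    | zero =>
      simp only [Finset.range_zero, Finset.sum_empty]
      exact Lp.coeFn_zero ℝ 2 P
    | succ n ih =>
      rw [Finset.sum_range_succ]
      filter_upwards [Lp.coeFn_add (∑ i ∈ Finset.range n, (hf i).toLp (f i)) ((hf n).toLp (f n)),
        ih, (hf n).coeFn_toLp] with ω h1 h2 h3
      rw [h1, Pi.add_apply, h2, h3, Finset.sum_range_succ]
  filter_upwards [h1, hlim, ae_all_iff.2 hpart] with ω hω hlimω hpω
  have h2 := hω.hasSum.tendsto_sum_nat.comp hns.tendsto_atTop
  refine tendsto_nhds_unique hlimω (h2.congr fun n => (hpω (ns n)).symm)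

open scoped InnerProductSpace

theorem inner_toLp_eq {f g : Ω → ℝ} (hf : MemLp f 2 P) (hg : MemLp g 2 P) :
    ⟪hf.toLp f, hg.toLp g⟫_ℝ = ∫ ω, f ω * g ω ∂P := by
  rw [L2.inner_def]
  refine integral_congr_ae ?_
  filter_upwards [hf.coeFn_toLp, hg.coeFn_toLp] with ω h1 h2
  rw [h1, h2, real_inner_eq_re_inner, RCLike.inner_apply]
  simp [mul_comm]

theorem norm_toLp_sq {f : Ω → ℝ} (hf : MemLp f 2 P) : ‖hf.toLp f‖ ^ 2 = ∫ ω, f ω ^ 2 ∂P := by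
  rw [← real_inner_self_eq_norm_sq, inner_toLp_eq]
  simp only [sq]

variable [IsProbabilityMeasure P]

variable {𝒢 : Filtration ℕ mΩ} {F : ℕ → Ω → ℝ}

/-- The conditional expectation of `F i` given `𝒢 k`, as an element of `L²`. -/
def condLp (𝒢 : Filtration ℕ mΩ) (hF : ∀ i, MemLp (F i) 2 P) (k i : ℕ) : Lp ℝ 2 P :=
  ((hF i).condExp (m := 𝒢 k) one_le_two).toLp _

variable (hF : ∀ i, MemLp (F i) 2 P)

theorem inner_condLp {k i : ℕ} {g : Ω → ℝ} (hg : MemLp g 2 P)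
    (hgm : AEStronglyMeasurable[𝒢 k] g P) :
    ⟪condLp 𝒢 hF k i, hg.toLp g⟫_ℝ = ⟪(hF i).toLp (F i), hg.toLp g⟫_ℝ := by
  rw [condLp, inner_toLp_eq, inner_toLp_eq]
  have hi : Integrable (F i * g) P := (hF i).integrable_mul hg
  have h := condExp_mul_of_aestronglyMeasurable_right hgm hi ((hF i).integrable one_le_two)
  have e := integral_condExp (μ := P) (f := F i * g) (𝒢.le k)
  rw [integral_congr_ae h] at e
  exact e

/-- Conditioning on less contracts the norm. This reaches `k = 0` from `k = 1`, since decay is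
available only from `t_1` on. -/
theorem norm_condLp_le {j k : ℕ} (hjk : j ≤ k) (i : ℕ) :
    ‖condLp 𝒢 hF j i‖ ≤ ‖condLp 𝒢 hF k i‖ := by
  have hk := (hF i).condExp (m := 𝒢 k) one_le_two
  rw [condLp, condLp, Lp.norm_toLp, Lp.norm_toLp]
  refine ENNReal.toReal_mono hk.2.ne ?_
  rw [← eLpNorm_congr_ae (condExp_condExp_of_le (𝒢.mono hjk) (𝒢.le k))]
  exact eLpNorm_condExp_le_eLpNorm _ one_le_two

theorem condLp_of_le (hFm : ∀ i, StronglyMeasurable[𝒢 i] (F i)) {k i : ℕ} (h : i ≤ k) :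
    condLp 𝒢 hF k i = (hF i).toLp (F i) := by
  rw [condLp]
  congr 1
  exact condExp_of_stronglyMeasurable (𝒢.le k) ((hFm i).mono (𝒢.mono h))
    ((hF i).integrable one_le_two)

variable {τ : ℕ → ℝ≥0}

/-- The second moments of the martingale `k ↦ ∑ i, τ i * 𝔼[F i | 𝒢 k]` and of its increments. -/
theorem exists_second_moment_martingale (hFm : ∀ i, StronglyMeasurable[𝒢 i] (F i)) {B : ℝ} (hs : ∀ k, 1 ≤ k → Summable fun i => (τ (k + i) : ℝ) * ‖condLp 𝒢 hF k (k + i)‖)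
    (hB : ∀ k, 1 ≤ k → ∑' i, (τ (k + i) : ℝ) * ‖condLp 𝒢 hF k (k + i)‖ ≤ B) :
    (∀ k, ∀ᵐ ω ∂P, Summable fun i => (τ i : ℝ) * P[F i | 𝒢 k] ω) ∧
    (∀ k, MemLp (fun ω => ∑' i, (τ i : ℝ) * P[F i | 𝒢 k] ω) 2 P) ∧
    ∃ V : ℕ → ℝ, V 0 = 0 ∧
      (∀ j k, j ≤ k → ∫ ω, ((∑' i, (τ i : ℝ) * P[F i | 𝒢 k] ω)
        - ∑' i, (τ i : ℝ) * P[F i | 𝒢 j] ω) ^ 2 ∂P = V k - V j) ∧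
      ∃ B', ∀ n, |V n - 2 * ∑ k ∈ Finset.range n, (τ k : ℝ)
          * ∫ ω, F k ω * (∑' i, (τ (k + i) : ℝ) * P[F (k + i) | 𝒢 k] ω) ∂P
        + ∑ k ∈ Finset.range n, (τ k : ℝ) ^ 2 * ∫ ω, F k ω ^ 2 ∂P| ≤ B' := by
  have hG : ∀ k i, MemLp (P[F i | 𝒢 k]) 2 P := fun k i => (hF i).condExp one_le_two
  have hτG : ∀ k i, MemLp (fun ω => (τ i : ℝ) * P[F i | 𝒢 k] ω) 2 P := fun k i =>
    (hG k i).const_mul _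
  have htoLp : ∀ k i, (hτG k i).toLp _ = (τ i : ℝ) • condLp 𝒢 hF k i := fun k i => rfl
  have hnorm : ∀ k i, ‖(hτG k i).toLp _‖ = (τ i : ℝ) * ‖condLp 𝒢 hF k i‖ := fun k i => by
    rw [htoLp, norm_smul, Real.norm_of_nonneg (τ i).coe_nonneg]
  have hsum : ∀ k, Summable fun i => (τ i : ℝ) * ‖condLp 𝒢 hF k i‖ := by
    have h1 : ∀ k, 1 ≤ k → Summable fun i => (τ i : ℝ) * ‖condLp 𝒢 hF k i‖ := fun k hk => by
      rw [← summable_nat_add_iff k]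
      simpa only [add_comm] using hs k hk
    intro k
    rcases Nat.eq_zero_or_pos k with rfl | hk
    · exact Summable.of_nonneg_of_le (fun i => by positivity)
        (fun i => mul_le_mul_of_nonneg_left (norm_condLp_le hF zero_le_one i)
          (τ i).coe_nonneg) (h1 1 le_rfl)
    · exact h1 k hk
  have hsumV : ∀ k, Summable fun i => (τ i : ℝ) • condLp 𝒢 hF k i := fun k =>
    Summable.of_norm (by simpa only [← htoLp, hnorm] using hsum k)
  have hser := fun k => Lp.ae_summable_and_tsum (hτG k) (by simpa only [hnorm] using hsum k)
  set T : ℕ → Lp ℝ 2 P := fun k => ∑' i, (τ i : ℝ) • condLp 𝒢 hF k i with hT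
  have hTae : ∀ k, T k =ᵐ[P] fun ω => ∑' i, (τ i : ℝ) * P[F i | 𝒢 k] ω := fun k => (hser k).2
  have hTmem : ∀ k, MemLp (fun ω => ∑' i, (τ i : ℝ) * P[F i | 𝒢 k] ω) 2 P := fun k =>
    (memLp_congr_ae (hTae k)).1 (Lp.memLp (T k))
  -- The right-hand side does not depend on `k`: this is the martingale property in weak form.
  have hTinner : ∀ k g (hg : MemLp g 2 P), AEStronglyMeasurable[𝒢 k] g P →
      ⟪T k, hg.toLp g⟫_ℝ = ∑' i, (τ i : ℝ) * ⟪(hF i).toLp (F i), hg.toLp g⟫_ℝ := by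
    intro k g hg hgm
    have := ((hsumV k).hasSum.mapL (innerSL ℝ (hg.toLp g))).tsum_eq
    rw [real_inner_comm, ← innerSL_apply_apply ℝ, ← this]
    refine tsum_congr fun i => ?_
    rw [innerSL_apply_apply, inner_smul_right, real_inner_comm, inner_condLp hF hg hgm]
  have horth : ∀ j k g (hg : MemLp g 2 P), j ≤ k → AEStronglyMeasurable[𝒢 j] g P →
      ⟪T k - T j, hg.toLp g⟫_ℝ = 0 := by
    intro j k g hg hjk hgm
    rw [inner_sub_left, hTinner k g hg (hgm.mono (𝒢.mono hjk)), hTinner j g hg hgm, sub_self]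
  -- `T j` is a limit in `L²`, so orthogonality to it is checked term by term along its series.
  have horthT : ∀ j k, j ≤ k → ⟪T k - T j, T j⟫_ℝ = 0 := by
    intro j k hjk
    have := ((hsumV j).hasSum.mapL (innerSL ℝ (T k - T j))).tsum_eq
    rw [← innerSL_apply_apply ℝ, ← this]
    refine (tsum_congr fun i => ?_).trans tsum_zero
    rw [innerSL_apply_apply, inner_smul_right, condLp,
      horth j k _ (hG j i) hjk stronglyMeasurable_condExp.aestronglyMeasurable, mul_zero]
  have hpyth : ∀ j k, j ≤ k → ‖T k - T j‖ ^ 2 = ‖T k‖ ^ 2 - ‖T j‖ ^ 2 := by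
    intro j k hjk
    have e : ‖T k‖ ^ 2 = ‖(T k - T j) + T j‖ ^ 2 := by rw [sub_add_cancel]
    rw [e, norm_add_sq_real, horthT j k hjk]; ring
  -- Terms of index below `k` are already measurable at time `k`; only the corrector survives.
  have htail : ∀ k, T k - ∑ i ∈ Finset.range k, (τ i : ℝ) • (hF i).toLp (F i)
      = ∑' i, (τ (k + i) : ℝ) • condLp 𝒢 hF k (k + i) := by
    intro k
    have e := (hsumV k).sum_add_tsum_nat_add k
    have e2 : ∑ i ∈ Finset.range k, (τ i : ℝ) • condLp 𝒢 hF k i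
        = ∑ i ∈ Finset.range k, (τ i : ℝ) • (hF i).toLp (F i) :=
      Finset.sum_congr rfl fun i hi => by
        rw [condLp_of_le hF hFm (Finset.mem_range.1 hi).le]
    rw [e2] at e
    simp only [hT]
    rw [← e, add_sub_cancel_left]
    simp only [add_comm k]
  have hWnorm : ∀ k, 1 ≤ k → ‖∑' i, (τ (k + i) : ℝ) • condLp 𝒢 hF k (k + i)‖ ≤ B := by
    intro k hk
    refine (norm_tsum_le_tsum_norm ?_).trans ?_
    · simpa only [← htoLp, hnorm] using hs k hk
    · simpa only [← htoLp, hnorm] using hB k hk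
  refine ⟨fun k => (hser k).1, hTmem, fun n => ‖T n‖ ^ 2 - ‖T 0‖ ^ 2, sub_self _, ?_,
    B ^ 2 + ‖T 0‖ ^ 2 + ‖T 0‖ ^ 2, fun n => ?_⟩
  · intro j k hjk
    rw [sub_sub_sub_cancel_right, ← hpyth j k hjk, ← real_inner_self_eq_norm_sq, L2.inner_def]
    refine integral_congr_ae ?_
    filter_upwards [hTae k, hTae j, Lp.coeFn_sub (T k) (T j)] with ω h1 h2 h3
    rw [h3, Pi.sub_apply, h1, h2, real_inner_self_eq_norm_sq, Real.norm_eq_abs, sq_abs]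
  · have hmain := norm_sq_sub_norm_sq_eq (T := T) (F := fun i => (hF i).toLp (F i))
      (τ := fun i => (τ i : ℝ)) (fun k => horthT k (k + 1) (Nat.le_succ k))
      (fun l k hlk => horth k (k + 1) _ (hF l) (Nat.le_succ k)
        ((hFm l).mono (𝒢.mono hlk)).aestronglyMeasurable) n
    simp only [htail] at hmain
    have e1 : ∀ k, ⟪(hF k).toLp (F k), ∑' i, (τ (k + i) : ℝ) • condLp 𝒢 hF k (k + i)⟫_ℝ
        = ∫ ω, F k ω * (∑' i, (τ (k + i) : ℝ) * P[F (k + i) | 𝒢 k] ω) ∂P := by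
      intro k
      have hs' : Summable fun i => ‖(hτG k (k + i)).toLp _‖ := by
        simp only [hnorm]
        have := (summable_nat_add_iff k).2 (hsum k)
        simpa only [add_comm] using this
      have hae := (Lp.ae_summable_and_tsum (fun i => hτG k (k + i)) hs').2
      rw [L2.inner_def]
      refine integral_congr_ae ?_
      filter_upwards [hae, (hF k).coeFn_toLp] with ω h1 h2
      simp only [htoLp] at h1
      rw [h1, h2, real_inner_eq_re_inner, RCLike.inner_apply]
      simp [mul_comm]
    simp only [e1, norm_toLp_sq] at hmain
    -- The bound `B` starts at `n = 1`; for `n = 0` the corrector is `T 0` itself.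
    have hW : ‖∑' i, (τ (n + i) : ℝ) • condLp 𝒢 hF n (n + i)‖ ^ 2 ≤ B ^ 2 + ‖T 0‖ ^ 2 := by
      rcases Nat.eq_zero_or_pos n with rfl | hn
      · have : ∑' i, (τ (0 + i) : ℝ) • condLp 𝒢 hF 0 (0 + i) = T 0 := by simp [hT]
        rw [this]
        nlinarith
      · have := hWnorm n hn
        have h0 := norm_nonneg (∑' i, (τ (n + i) : ℝ) • condLp 𝒢 hF n (n + i))
        nlinarith [sq_nonneg ‖T 0‖]
    beta_reduce
    rw [hmain, abs_le]
    have h0 := sq_nonneg ‖∑' i, (τ (n + i) : ℝ) • condLp 𝒢 hF n (n + i)‖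
    have h1 := sq_nonneg ‖T 0‖
    constructor
    · nlinarith [sq_nonneg B]
    · nlinarith [sq_nonneg B]

end Series

/-! ### Decay of the approximation towards the invariant measure -/

section Decay

/-- Where the weight exceeds `R`, the gap `s < q` makes the first bound at most `η * wt y ^ q`.
Where it does not, `wt y ^ B` is at most `R ^ B`. Hence `B` may exceed every available moment. -/
theorem le_eta_add_of_wt_bounds {E : Type*} [NormedAddCommGroup E] {C C₁ s q B : ℝ}
    (hC₁ : 0 ≤ C₁) (hsq : s < q) (hB : 0 ≤ B) {η : ℝ} (hη : 0 < η) :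
    ∃ C' : ℝ, 0 ≤ C' ∧ ∀ (y : E) (x ε : ℝ), 0 ≤ ε → x ≤ C * wt y ^ s → x ≤ C₁ * wt y ^ B * ε →
      x ≤ η * wt y ^ q + C' * ε := by
  obtain ⟨R, hR0, hR⟩ := exists_forall_wt_rpow_le (E := E) hsq C hη
  refine ⟨C₁ * R ^ B, by positivity, fun y x ε hε h1 h2 => ?_⟩
  have hw := wt_rpow_pos y q
  rcases le_or_gt (wt y) R with h | h
  · have : wt y ^ B ≤ R ^ B := Real.rpow_le_rpow (wt_pos y).le h hB
    have h3 : C₁ * wt y ^ B * ε ≤ C₁ * R ^ B * ε := by gcongr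
    have : 0 ≤ η * wt y ^ q := by positivity
    linarith
  · have : 0 ≤ C₁ * R ^ B * ε := by positivity
    linarith [hR y h]

variable {Ω E : Type*} {mΩ : MeasurableSpace Ω} [NormedAddCommGroup E] [MeasurableSpace E]

/-- `|𝔼[f(Y_{t_m,t_n}^y)] - μ(f)|` decays like `ρ(t_n - t_m)^γ + τ_n^{γα}`, with constants growing
like `(1 + ‖y‖)^A`. -/
def DecayBound (P : Measure Ω) (Y : ℕ → ℕ → E → Ω → E) (τ : ℕ → ℝ≥0) (ρ : ℝ≥0 → ℝ≥0)
    (μ : Measure E) (γ α A C : ℝ) (f : E → ℝ) : Prop :=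
  ∀ m n y, 1 ≤ m → m ≤ n → |transOp P Y m n f y - ∫ z, f z ∂μ|
    ≤ C * wt y ^ A * ((ρ (gridTime τ n - gridTime τ m) : ℝ) ^ γ + (τ n : ℝ) ^ (γ * α))

variable {P : Measure Ω} {X : ℝ≥0 → ℝ≥0 → E → Ω → E} {Y : ℕ → ℕ → E → Ω → E} {τ : ℕ → ℝ≥0}
  {ρ ρτ : ℝ≥0 → ℝ≥0} {μ : Measure E} {γ α A l' : ℝ}

theorem decayBound_of_le {C C' A₁ A₂ : ℝ} {f : E → ℝ} (hC : 0 ≤ C) (hC' : 0 ≤ C') (h₁ : A₁ ≤ A)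
    (h₂ : A₂ ≤ A)
    (hX : ∀ t y, |transOp P X 0 t f y - ∫ z, f z ∂μ| ≤ C * wt y ^ A₁ * (ρ t : ℝ) ^ γ)
    (hY : ∀ m n y, 1 ≤ m → m ≤ n →
      |transOp P Y m n f y - transOp P X 0 (gridTime τ n - gridTime τ m) f y|
        ≤ C' * wt y ^ A₂ * (τ n : ℝ) ^ (γ * α)) :
    DecayBound P Y τ ρ μ γ α A (C + C') f := by
  intro m n y hm hmn
  have h1 := hX (gridTime τ n - gridTime τ m) y
  have h2 := hY m n y hm hmn
  have h3 := abs_sub_le (transOp P Y m n f y)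
    (transOp P X 0 (gridTime τ n - gridTime τ m) f y) (∫ z, f z ∂μ)
  have w1 := wt_rpow_mono y h₁
  have w2 := wt_rpow_mono y h₂
  have w0 := (wt_rpow_pos y A).le
  set a := (ρ (gridTime τ n - gridTime τ m) : ℝ) ^ γ
  have ha : 0 ≤ a := by positivity
  set b := (τ n : ℝ) ^ (γ * α)
  have hb : 0 ≤ b := by positivity
  have h4 : C * wt y ^ A₁ * a ≤ C * wt y ^ A * a := by gcongr
  have h5 : C' * wt y ^ A₂ * b ≤ C' * wt y ^ A * b := by gcongr
  have h6 : 0 ≤ C * wt y ^ A * b := by positivity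
  have h7 : 0 ≤ C' * wt y ^ A * a := by positivity
  nlinarith

/-- This sums a `DecayBound` against the steps, uniformly in the starting index: (ii) controls the
part with `ρ`, (i) the part with `τ ^ (1 + γα)`. -/
theorem StepConditions.exists_sum_decay_le (h : StepConditions τ ρ ρτ γ α l') (hγα : 0 ≤ γ * α)
    (hγ : 0 ≤ γ) :
    ∃ B, ∀ k, Summable (fun i => (τ (k + i) : ℝ)
        * ((ρ (gridTime τ (k + i) - gridTime τ k) : ℝ) ^ γ + (τ (k + i) : ℝ) ^ (γ * α))) ∧
      ∑' i, (τ (k + i) : ℝ) * ((ρ (gridTime τ (k + i) - gridTime τ k) : ℝ) ^ γ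
        + (τ (k + i) : ℝ) ^ (γ * α)) ≤ B := by
  obtain ⟨B, hB⟩ := h.exists_tsum_le hγ
  have hs := h.summable_rpow_order
  refine ⟨B + ∑' i, (τ i : ℝ) ^ (1 + γ * α), fun k => ?_⟩
  have e : ∀ i, (τ (k + i) : ℝ) * ((ρ (gridTime τ (k + i) - gridTime τ k) : ℝ) ^ γ
      + (τ (k + i) : ℝ) ^ (γ * α)) = (τ (k + i) : ℝ)
        * (ρ (gridTime τ (k + i) - gridTime τ k) : ℝ) ^ γ + (τ (k + i) : ℝ) ^ (1 + γ * α) := by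
    intro i
    rcases (τ (k + i)).coe_nonneg.eq_or_lt with h0 | h0
    · rw [← h0, Real.zero_rpow (by positivity : 1 + γ * α ≠ 0)]; ring
    · rw [Real.rpow_add h0, Real.rpow_one]; ring
  simp only [e]
  have hs' : Summable fun i => (τ (k + i) : ℝ) ^ (1 + γ * α) := by
    simpa only [add_comm] using (summable_nat_add_iff k).2 hs
  refine ⟨(hB k).1.add hs', ?_⟩
  rw [(hB k).1.tsum_add hs']
  refine add_le_add (hB k).2 ?_
  have h1 := hs.sum_add_tsum_nat_add k
  have h2 : 0 ≤ ∑ i ∈ Finset.range k, (τ i : ℝ) ^ (1 + γ * α) :=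
    Finset.sum_nonneg fun i _ => by positivity
  simp only [add_comm _ k] at h1
  linarith

variable [IsProbabilityMeasure P] {𝒢 : Filtration ℕ mΩ}

/-- The weighted empirical laws `(1/t_n) ∑_{k ≤ n} τ_k law(Y_{t_k})`, for `n ≥ 1`. -/
def empiricalLaw (P : Measure Ω) (Y : ℕ → ℕ → E → Ω → E) (τ : ℕ → ℝ≥0) (x : E) (n : ℕ) :
    Measure E :=
  (gridTime τ (n + 1))⁻¹ • ∑ k ∈ Finset.range (n + 2), τ k • P.map (Y 0 k x)

theorem IsStepSequence.gridTime_succ_pos (hτ : IsStepSequence τ) (n : ℕ) :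
    0 < gridTime τ (n + 1) := by
  rw [gridTime_succ]
  exact add_pos_of_nonneg_of_pos zero_le (hτ.pos _ (by omega))

theorem isProbabilityMeasure_empiricalLaw (hτ : IsStepSequence τ) (hY : IsMarkovFamily P 𝒢 Y)
    (x : E) (n : ℕ) : IsProbabilityMeasure (empiricalLaw P Y τ x n) := by
  have := fun k => Measure.isProbabilityMeasure_map (μ := P)
    (hY.measurable (Nat.zero_le k) x).aemeasurable
  constructor
  simp only [empiricalLaw, Measure.smul_apply, Measure.finsetSum_apply, measure_univ,
    ENNReal.smul_def, smul_eq_mul, mul_one]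
  rw [← ENNReal.ofNNReal_finsetSum, ← ENNReal.coe_mul]
  change (((gridTime τ (n + 1))⁻¹ * gridTime τ (n + 1) : ℝ≥0) : ℝ≥0∞) = 1
  rw [inv_mul_cancel₀ (hτ.gridTime_succ_pos n).ne', ENNReal.coe_one]

theorem integral_empiricalLaw (hY : IsMarkovFamily P 𝒢 Y) (x : E) (n : ℕ) {g : E → ℝ}
    (hg : Measurable g) (hi : ∀ k, Integrable (fun ω => g (Y 0 k x ω)) P) :
    Integrable g (empiricalLaw P Y τ x n) ∧ ∫ u, g u ∂empiricalLaw P Y τ x n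
      = (∑ k ∈ Finset.range (n + 2), (τ k : ℝ) * ∫ ω, g (Y 0 k x ω) ∂P) / gridTime τ (n + 1) := by
  have hm := fun k => (hY.measurable (Nat.zero_le k) x).aemeasurable (μ := P)
  have hi' : ∀ k, Integrable g (τ k • P.map (Y 0 k x)) := fun k => by
    have : Integrable g (P.map (Y 0 k x)) :=
      (integrable_map_measure hg.aestronglyMeasurable (hm k)).2 (hi k)
    exact this.smul_measure_nnreal
  refine ⟨(integrable_finsetSum_measure.2 fun k _ => hi' k).smul_measure_nnreal, ?_⟩
  rw [empiricalLaw, integral_smul_nnreal_measure, integral_finsetSum_measure fun k _ => hi' k,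
    div_eq_inv_mul, NNReal.smul_def, smul_eq_mul, NNReal.coe_inv]
  congr 1
  refine Finset.sum_congr rfl fun k _ => ?_
  rw [integral_smul_nnreal_measure, integral_map (hm k) hg.aestronglyMeasurable, NNReal.smul_def,
    smul_eq_mul]

/-- `L²` bounds for the conditional expectations of `f(Y_{t_i})`. -/
theorem norm_condLp_le_of_decayBound (hY : IsMarkovFamily P 𝒢 Y) {x : E} {f : E → ℝ} {C M : ℝ}
    (hC : 0 ≤ C) (hf : Measurable f) (hM : ∀ k, MomentLE P (Y 0 k x) (2 * A) M)
    (hd : DecayBound P Y τ ρ μ γ α A C f)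
    (hfi : ∀ i, Integrable (fun ω => f (Y 0 i x ω)) P)
    (hF : ∀ i, MemLp (fun ω => f (Y 0 i x ω) - ∫ z, f z ∂μ) 2 P) {k i : ℕ} (hk : 1 ≤ k) :
    ‖condLp 𝒢 hF k (k + i)‖ ≤ C * √M * ((ρ (gridTime τ (k + i) - gridTime τ k) : ℝ) ^ γ
      + (τ (k + i) : ℝ) ^ (γ * α)) := by
  set b := (ρ (gridTime τ (k + i) - gridTime τ k) : ℝ) ^ γ + (τ (k + i) : ℝ) ^ (γ * α) with hb
  have hb0 : 0 ≤ b := by positivity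
  have hki := Nat.le_add_right k i
  have hce := hY.condExp_sub_const_eq (Nat.zero_le k) hki x hf (∫ z, f z ∂μ) (hfi (k + i))
  refine abs_le_of_sq_le_sq' ?_ (by positivity) |>.2
  rw [condLp, norm_toLp_sq]
  have hsq : ∀ᵐ ω ∂P, P[fun ω => f (Y 0 (k + i) x ω) - ∫ z, f z ∂μ | 𝒢 k] ω ^ 2
      ≤ (C * b) ^ 2 * wt (Y 0 k x ω) ^ (2 * A) := by
    filter_upwards [hce] with ω h
    rw [h, ← sq_abs]
    calc _ ≤ (C * wt (Y 0 k x ω) ^ A * b) ^ 2 := by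
          gcongr
          exact hd k (k + i) _ hk hki
      _ = _ := by
          rw [mul_comm 2 A, Real.rpow_mul (wt_pos _).le]
          norm_cast
          ring
  calc _ ≤ ∫ ω, (C * b) ^ 2 * wt (Y 0 k x ω) ^ (2 * A) ∂P :=
        integral_mono_ae ((hF (k + i)).condExp one_le_two).integrable_sq ((hM k).1.const_mul _) hsq
    _ = (C * b) ^ 2 * ∫ ω, wt (Y 0 k x ω) ^ (2 * A) ∂P := integral_const_mul _ _
    _ ≤ (C * b) ^ 2 * M := mul_le_mul_of_nonneg_left (hM k).2 (by positivity)
    _ = (C * √M * b) ^ 2 := by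
        rw [mul_pow, mul_pow, mul_pow, Real.sq_sqrt (hM k).nonneg]; ring

variable [BorelSpace E]

theorem momentLE_empiricalLaw (hτ : IsStepSequence τ) (hY : IsMarkovFamily P 𝒢 Y) {x : E}
    {q M : ℝ} (hM : ∀ k, MomentLE P (Y 0 k x) q M) (n : ℕ) :
    MomentLE (empiricalLaw P Y τ x n) id q M := by
  have h := integral_empiricalLaw (τ := τ) hY x n (measurable_wt_rpow q) fun k => (hM k).1
  refine ⟨h.1, h.2.trans_le ?_⟩
  have hpos : (0 : ℝ) < gridTime τ (n + 1) := hτ.gridTime_succ_pos n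
  rw [div_le_iff₀ hpos]
  calc _ ≤ ∑ k ∈ Finset.range (n + 2), (τ k : ℝ) * M :=
        Finset.sum_le_sum fun k _ => mul_le_mul_of_nonneg_left (hM k).2 (τ k).coe_nonneg
    _ = M * gridTime τ (n + 1) := by
        rw [← Finset.sum_mul, mul_comm, gridTime, NNReal.coe_sum]

/-- The decay is summable against the steps, so the weighted sum of deviations stays bounded while
`t_n → ∞`. The chain is first conditioned at `t_1`, where `DecayBound` begins; index `0` carries
weight `τ 0 = 0`. -/
theorem lipschitzTendsto_empiricalLaw (hτ : IsStepSequence τ) (hY : IsMarkovFamily P 𝒢 Y) {x : E}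
    (hstep : StepConditions τ ρ ρτ γ α l') (hγα : 0 ≤ γ * α) (hγ : 0 ≤ γ) {M : ℝ}
    (hM : MomentLE P (Y 0 1 x) A M)
    (hdec : ∀ (g : E → ℝ) (C : ℝ) (L : ℝ≥0), (∀ u, |g u| ≤ C) → LipschitzWith L g →
      ∃ C', 0 ≤ C' ∧ DecayBound P Y τ ρ μ γ α A C' g) :
    LipschitzTendsto (empiricalLaw P Y τ x) μ := by
  intro g C L hC hL
  have hgm := hL.continuous.measurable
  obtain ⟨C', hC', hd⟩ := hdec g C L hC hL
  obtain ⟨B, hB⟩ := hstep.exists_sum_decay_le hγα hγ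
  have hgi : ∀ k, Integrable (fun ω => g (Y 0 k x ω)) P := fun k =>
    Integrable.of_bound (hgm.comp (hY.measurable (Nat.zero_le k) x)).aestronglyMeasurable C
      (Eventually.of_forall fun ω => hC _)
  set m := ∫ u, g u ∂μ with hm
  have hbound : ∀ i, |∫ ω, g (Y 0 (1 + i) x ω) ∂P - m| ≤ C' * M
      * ((ρ (gridTime τ (1 + i) - gridTime τ 1) : ℝ) ^ γ + (τ (1 + i) : ℝ) ^ (γ * α)) := by
    intro i
    have h0 : 0 ≤ (ρ (gridTime τ (1 + i) - gridTime τ 1) : ℝ) ^ γ + (τ (1 + i) : ℝ) ^ (γ * α) := by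
      positivity
    have hti := hY.integrable_transOp (Nat.zero_le 1) (Nat.le_add_right 1 i) x hgm (hgi _)
    rw [← hY.integral_transOp (Nat.zero_le 1) (Nat.le_add_right 1 i) x hgm (hgi _)]
    have e : ∫ ω, transOp P Y 1 (1 + i) g (Y 0 1 x ω) ∂P - m
        = ∫ ω, (transOp P Y 1 (1 + i) g (Y 0 1 x ω) - m) ∂P := by
      rw [integral_sub hti (integrable_const _)]; simp
    rw [e]
    set b := (ρ (gridTime τ (1 + i) - gridTime τ 1) : ℝ) ^ γ + (τ (1 + i) : ℝ) ^ (γ * α) with hb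
    calc _ ≤ ∫ ω, |transOp P Y 1 (1 + i) g (Y 0 1 x ω) - m| ∂P := abs_integral_le_integral_abs
      _ ≤ ∫ ω, C' * b * wt (Y 0 1 x ω) ^ A ∂P := by
          refine integral_mono (hti.sub (integrable_const _)).abs (hM.1.const_mul _) fun ω => ?_
          refine (hd 1 (1 + i) _ le_rfl (Nat.le_add_right 1 i)).trans (le_of_eq ?_)
          ring
      _ = C' * b * ∫ ω, wt (Y 0 1 x ω) ^ A ∂P := integral_const_mul _ _
      _ ≤ C' * b * M := mul_le_mul_of_nonneg_left hM.2 (by positivity)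
      _ = _ := by ring
  have hsum : ∀ n, |∑ k ∈ Finset.range (n + 2), (τ k : ℝ) * (∫ ω, g (Y 0 k x ω) ∂P - m)|
      ≤ C' * M * B := by
    intro n
    rw [Finset.sum_range_succ', hτ.zero, NNReal.coe_zero, zero_mul, add_zero]
    calc _ ≤ ∑ i ∈ Finset.range (n + 1), |(τ (i + 1) : ℝ) * (∫ ω, g (Y 0 (i + 1) x ω) ∂P - m)| :=
          Finset.abs_sum_le_sum_abs _ _
      _ ≤ ∑ i ∈ Finset.range (n + 1), C' * M * ((τ (1 + i) : ℝ)
          * ((ρ (gridTime τ (1 + i) - gridTime τ 1) : ℝ) ^ γ + (τ (1 + i) : ℝ) ^ (γ * α))) := by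
          refine Finset.sum_le_sum fun i _ => ?_
          rw [add_comm i 1, abs_mul, abs_of_nonneg (NNReal.coe_nonneg _)]
          refine (mul_le_mul_of_nonneg_left (hbound i) (NNReal.coe_nonneg _)).trans (le_of_eq ?_)
          ring
      _ ≤ C' * M * B := by
          rw [← Finset.mul_sum]
          refine mul_le_mul_of_nonneg_left (le_trans ?_ (hB 1).2) (mul_nonneg hC' hM.nonneg)
          exact (hB 1).1.sum_le_tsum _ fun i _ => by positivity
  have hT : Tendsto (fun n => (gridTime τ (n + 1) : ℝ)) atTop atTop :=
    (NNReal.tendsto_coe_atTop.2 hτ.tendsto_atTop).comp (tendsto_add_atTop_nat 1)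
  have hlim : Tendsto (fun n => (∑ k ∈ Finset.range (n + 2), (τ k : ℝ)
      * (∫ ω, g (Y 0 k x ω) ∂P - m)) / gridTime τ (n + 1)) atTop (𝓝 0) := by
    refine squeeze_zero_norm (fun n => ?_) (tendsto_const_nhds (x := C' * M * B) |>.div_atTop hT)
    rw [norm_div, Real.norm_eq_abs, Real.norm_of_nonneg (NNReal.coe_nonneg _)]
    exact div_le_div_of_nonneg_right (hsum n) (NNReal.coe_nonneg _)
  rw [← tendsto_sub_nhds_zero_iff]
  refine hlim.congr fun n => ?_
  have hpos : (0 : ℝ) < gridTime τ (n + 1) := hτ.gridTime_succ_pos n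
  rw [(integral_empiricalLaw hY x n hgm hgi).2]
  have e2 : ∑ k ∈ Finset.range (n + 2), (τ k : ℝ) * m = gridTime τ (n + 1) * m := by
    rw [← Finset.sum_mul, gridTime, NNReal.coe_sum]
  simp only [mul_sub, Finset.sum_sub_distrib, e2, sub_div]
  rw [mul_div_cancel_left₀ _ hpos.ne']

end Decay

/-! ### The corrector of the exact process -/

section ExactCorrector

variable {E : Type*} [NormedAddCommGroup E] {u : ℝ≥0 → E → ℝ} {ρ : ℝ≥0 → ℝ≥0} {g A e C D : ℝ}

theorem exactCorrector_bound (hc : ∀ y, Continuous fun t => u t y)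
    (hρ : IntegrableOn (fun t : ℝ => (ρ t.toNNReal : ℝ) ^ g) (Set.Ioi 0))
    (hu : ∀ t y, |u t y| ≤ C * wt y ^ A * (ρ t : ℝ) ^ g) (y : E) :
    IntegrableOn (fun t : ℝ => u t.toNNReal y) (Set.Ioi 0) ∧
      |∫ t in Set.Ioi (0 : ℝ), u t.toNNReal y|
        ≤ (C * ∫ t in Set.Ioi (0 : ℝ), (ρ t.toNNReal : ℝ) ^ g) * wt y ^ A := by
  have hi : IntegrableOn (fun t : ℝ => u t.toNNReal y) (Set.Ioi 0) :=
    (hρ.const_mul (C * wt y ^ A)).mono' ((hc y).comp continuous_real_toNNReal).aestronglyMeasurable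
      (Eventually.of_forall fun t => hu _ y)
  refine ⟨hi, ?_⟩
  calc _ ≤ ∫ t in Set.Ioi (0 : ℝ), |u t.toNNReal y| := abs_integral_le_integral_abs
    _ ≤ ∫ t in Set.Ioi (0 : ℝ), C * wt y ^ A * (ρ t.toNNReal : ℝ) ^ g :=
        integral_mono hi.abs (hρ.const_mul _) fun t => hu _ y
    _ = _ := by rw [integral_const_mul]; ring

/-- The local Hölder bound on `u t` integrates over time because `ρ ^ g` does. Continuity of the
corrector makes weak convergence applicable to its product with `f - μ(f)`. -/
theorem continuous_exactCorrector (hg : 0 < g) (hc : ∀ y, Continuous fun t => u t y)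
    (hρ : IntegrableOn (fun t : ℝ => (ρ t.toNNReal : ℝ) ^ g) (Set.Ioi 0))
    (hu : ∀ t y, |u t y| ≤ C * wt y ^ A * (ρ t : ℝ) ^ g)
    (hd : ∀ t y z, |u t y - u t z| ≤ D * ‖y - z‖ ^ g * (wt y * wt z) ^ e * (ρ t : ℝ) ^ g) :
    Continuous fun y => ∫ t in Set.Ioi (0 : ℝ), u t.toNNReal y := by
  set I := ∫ t in Set.Ioi (0 : ℝ), (ρ t.toNNReal : ℝ) ^ g
  have hi := fun y => (exactCorrector_bound hc hρ hu y).1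
  have hle : ∀ y z, |(∫ t in Set.Ioi (0 : ℝ), u t.toNNReal y)
      - ∫ t in Set.Ioi (0 : ℝ), u t.toNNReal z| ≤ D * ‖y - z‖ ^ g * (wt y * wt z) ^ e * I := by
    intro y z
    rw [← integral_sub (hi y) (hi z)]
    calc _ ≤ ∫ t in Set.Ioi (0 : ℝ), |u t.toNNReal y - u t.toNNReal z| :=
          abs_integral_le_integral_abs
      _ ≤ ∫ t in Set.Ioi (0 : ℝ), D * ‖y - z‖ ^ g * (wt y * wt z) ^ e * (ρ t.toNNReal : ℝ) ^ g :=
          integral_mono ((hi y).sub (hi z)).abs (hρ.const_mul _) fun t => hd _ y z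
      _ = _ := integral_const_mul _ _
  rw [continuous_iff_continuousAt]
  intro z
  rw [ContinuousAt, tendsto_iff_norm_sub_tendsto_zero]
  refine squeeze_zero (fun _ => norm_nonneg _) (fun y => hle y z) ?_
  have h1 : Continuous fun y => ‖y - z‖ ^ g :=
    (continuous_id.sub continuous_const).norm.rpow_const fun _ => Or.inr hg.le
  have h2 : Continuous fun y => (wt y * wt z) ^ e :=
    ((continuous_wt (E := E)).mul continuous_const).rpow_const fun y =>
      Or.inl (mul_pos (wt_pos y) (wt_pos z)).ne'
  have h3 : Continuous fun y => D * ‖y - z‖ ^ g * (wt y * wt z) ^ e * I := by fun_prop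
  simpa [Real.zero_rpow hg.ne'] using h3.tendsto z

end ExactCorrector

/-! ### Passage to the limit -/

section Limit

variable {τ : ℕ → ℝ≥0}

/-- `V n / t_n` differs from twice the weighted mean of `b` by vanishing terms: a bounded remainder
over `t_n`, a mean of `τ_k e_k`, and the corrector error, at most an arbitrary `η` plus a multiple
of a null average. -/
theorem tendsto_variance_of_corrector (hτ : IsStepSequence τ) {V c b e ε : ℕ → ℝ} {B Be m : ℝ}
    (hV : ∀ n, |V n - 2 * ∑ k ∈ Finset.range n, (τ k : ℝ) * c k
      + ∑ k ∈ Finset.range n, (τ k : ℝ) ^ 2 * e k| ≤ B)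
    (he : ∀ k, |e k| ≤ Be)
    (hε : Tendsto (fun n => (∑ k ∈ Finset.range n, (τ k : ℝ) * ε k) / gridTime τ n) atTop (𝓝 0))
    (hcb : ∀ η : ℝ, 0 < η → ∃ C', 0 ≤ C' ∧ ∀ k, 1 ≤ k → |c k - b k| ≤ η + C' * ε k)
    (hb : Tendsto (fun n => (∑ k ∈ Finset.range n, (τ k : ℝ) * b k) / gridTime τ n) atTop (𝓝 m)) :
    Tendsto (fun n => V n / gridTime τ n) atTop (𝓝 (2 * m)) := by
  have hT : Tendsto (fun n => (gridTime τ n : ℝ)) atTop atTop :=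
    NNReal.tendsto_coe_atTop.2 hτ.tendsto_atTop
  have h1 : Tendsto (fun n => (V n - 2 * ∑ k ∈ Finset.range n, (τ k : ℝ) * c k
      + ∑ k ∈ Finset.range n, (τ k : ℝ) ^ 2 * e k) / gridTime τ n) atTop (𝓝 0) := by
    refine squeeze_zero_norm (fun n => ?_) ((tendsto_const_nhds (x := B)).div_atTop hT)
    rw [norm_div, Real.norm_of_nonneg (NNReal.coe_nonneg _)]
    exact div_le_div_of_nonneg_right (hV n) (NNReal.coe_nonneg _)
  have h2 : Tendsto (fun n => (∑ k ∈ Finset.range n, (τ k : ℝ) ^ 2 * e k) / gridTime τ n) atTop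
      (𝓝 0) := by
    have h0 : Tendsto (fun k => (τ k : ℝ) * e k) atTop (𝓝 0) := by
      refine squeeze_zero_norm (a := fun k => (τ k : ℝ) * Be) (fun k => ?_) ?_
      · rw [norm_mul, Real.norm_of_nonneg (NNReal.coe_nonneg _)]
        exact mul_le_mul_of_nonneg_left (he k) (NNReal.coe_nonneg _)
      · simpa using (NNReal.tendsto_coe.2 hτ.tendsto_zero).mul_const Be
    refine (tendsto_weighted_cesaro hτ.tendsto_atTop h0).congr fun n => ?_
    simp only [sq, mul_assoc]
  have h3 : Tendsto (fun n => (∑ k ∈ Finset.range n, (τ k : ℝ) * (c k - b k)) / gridTime τ n) atTop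
      (𝓝 0) := by
    rw [Metric.tendsto_atTop]
    intro δ hδ
    obtain ⟨C', hC', h⟩ := hcb (δ / 2) (by positivity)
    have h4 := hε.const_mul C'
    rw [mul_zero] at h4
    obtain ⟨N, hN⟩ := eventually_atTop.1 (h4.eventually_lt_const (half_pos hδ))
    refine ⟨max N 1, fun n hn => ?_⟩
    have hNn := hN n ((le_max_left _ _).trans hn)
    have hpos : (0 : ℝ) < gridTime τ n := by
      obtain ⟨j, rfl⟩ := Nat.exists_eq_succ_of_ne_zero
        (Nat.one_le_iff_ne_zero.1 ((le_max_right N 1).trans hn))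
      exact hτ.gridTime_succ_pos j
    rw [dist_zero_right, norm_div, Real.norm_of_nonneg hpos.le, div_lt_iff₀ hpos, Real.norm_eq_abs]
    rw [← mul_div_assoc, div_lt_iff₀ hpos] at hNn
    have hsumτ : ∑ k ∈ Finset.range n, (τ k : ℝ) ≤ gridTime τ n := by
      simp only [gridTime, NNReal.coe_sum]
      exact Finset.sum_le_sum_of_subset_of_nonneg (Finset.range_mono (Nat.le_succ n))
        fun k _ _ => (τ k).coe_nonneg
    calc |∑ k ∈ Finset.range n, (τ k : ℝ) * (c k - b k)|
        ≤ ∑ k ∈ Finset.range n, |(τ k : ℝ) * (c k - b k)| := Finset.abs_sum_le_sum_abs _ _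
      _ ≤ ∑ k ∈ Finset.range n, (δ / 2 * (τ k : ℝ) + C' * ((τ k : ℝ) * ε k)) := by
          refine Finset.sum_le_sum fun k _ => ?_
          rw [abs_mul, abs_of_nonneg (NNReal.coe_nonneg _)]
          rcases Nat.eq_zero_or_pos k with rfl | hk
          · simp [hτ.zero]
          · refine (mul_le_mul_of_nonneg_left (h k hk) (NNReal.coe_nonneg _)).trans (le_of_eq ?_)
            ring
      _ = δ / 2 * (∑ k ∈ Finset.range n, (τ k : ℝ))
          + C' * ∑ k ∈ Finset.range n, (τ k : ℝ) * ε k := by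
          rw [Finset.sum_add_distrib, Finset.mul_sum, Finset.mul_sum]
      _ < δ * gridTime τ n := by
          have := mul_le_mul_of_nonneg_left hsumτ (half_pos hδ).le
          linarith
  have h5 := ((h1.sub h2).add (h3.const_mul 2)).add (hb.const_mul 2)
  simp only [sub_zero, mul_zero, add_zero, zero_add] at h5
  refine h5.congr fun n => ?_
  simp only [mul_sub, Finset.sum_sub_distrib, sub_div, add_div]
  ring

theorem quasiIndex_mono (hτ : IsStepSequence τ) : Monotone (quasiIndex τ) := by
  refine fun j k hjk => ?_
  by_contra h
  have h1 := (quasiIndex_spec hτ j).1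
  have h2 := (quasiIndex_spec hτ k).2
  have h3 := gridTime_mono τ (Nat.succ_le_of_lt (not_le.1 h))
  exact absurd ((h2.trans_le h3).trans_le h1) (not_lt.2 (by exact_mod_cast hjk))

theorem quasiIndex_zero (hτ : IsStepSequence τ) : quasiIndex τ 0 = 0 := by
  by_contra h
  obtain ⟨j, hj⟩ := Nat.exists_eq_succ_of_ne_zero h
  have h1 := (quasiIndex_spec hτ 0).1
  rw [hj, Nat.cast_zero] at h1
  exact absurd (hτ.gridTime_succ_pos j) (not_lt.2 h1)

theorem tendsto_quasiIndex (hτ : IsStepSequence τ) : Tendsto (quasiIndex τ) atTop atTop := by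
  rw [tendsto_atTop_atTop]
  intro m
  obtain ⟨N, hN⟩ := exists_nat_ge (gridTime τ m)
  refine ⟨N, fun k hk => ?_⟩
  by_contra h
  have h2 := (quasiIndex_spec hτ k).2
  have h3 := gridTime_mono τ (Nat.succ_le_of_lt (not_le.1 h))
  exact absurd (h2.trans_le h3) (not_lt.2 (hN.trans (by exact_mod_cast hk)))

/-- Empirical laws include the last weight `τ_n`, whereas the second-moment sums stop at `n - 1`;
the extra term is at most `τ_n * B`. -/
theorem tendsto_weighted_average (hτ : IsStepSequence τ) {b : ℕ → ℝ} {B m : ℝ}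
    (hB : ∀ k, |b k| ≤ B)
    (h : Tendsto (fun n => (∑ k ∈ Finset.range (n + 2), (τ k : ℝ) * b k) / gridTime τ (n + 1)) atTop
      (𝓝 m)) :
    Tendsto (fun n => (∑ k ∈ Finset.range n, (τ k : ℝ) * b k) / gridTime τ n) atTop (𝓝 m) := by
  have hT : Tendsto (fun n => (gridTime τ n : ℝ)) atTop atTop :=
    NNReal.tendsto_coe_atTop.2 hτ.tendsto_atTop
  have h1 : Tendsto (fun n => (∑ k ∈ Finset.range (n + 1), (τ k : ℝ) * b k) / gridTime τ n) atTop
      (𝓝 m) := (tendsto_add_atTop_iff_nat 1).1 h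
  have h0 : Tendsto (fun k => (τ k : ℝ) * b k) atTop (𝓝 0) := by
    refine squeeze_zero_norm (a := fun k => (τ k : ℝ) * B) (fun k => ?_) ?_
    · rw [norm_mul, Real.norm_of_nonneg (NNReal.coe_nonneg _)]
      exact mul_le_mul_of_nonneg_left (hB k) (NNReal.coe_nonneg _)
    · simpa using (NNReal.tendsto_coe.2 hτ.tendsto_zero).mul_const B
  have h2 := h1.sub (h0.div_atTop hT)
  rw [sub_zero] at h2
  refine h2.congr fun n => ?_
  rw [Finset.sum_range_succ, add_div, add_sub_cancel_right]

end Limit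

/-! ### Approximate against exact corrector under expectation -/

section CorrectorComparison

variable {Ω E : Type*} {mΩ : MeasurableSpace Ω} [NormedAddCommGroup E] [MeasurableSpace E]
  {P : Measure Ω} [IsProbabilityMeasure P] {Y : ℕ → ℕ → E → Ω → E} {τ : ℕ → ℝ≥0}
  {𝒢 : Filtration ℕ mΩ}

/-- Comparison of the correctors of the approximation and of the exact process, integrated
against `f(Y_{t_k}) - c`. -/
theorem abs_integral_corrector_sub_le (hY : IsMarkovFamily P 𝒢 Y) {f φ : E → ℝ}
    (hf : Measurable f) (hφ : Measurable φ) {c : ℝ} {k : ℕ} {x : E}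
    (hfi : ∀ i, Integrable (fun ω => f (Y 0 i x ω)) P) {q M C η ε : ℝ} (hη : 0 ≤ η)
    (hM : MomentLE P (Y 0 k x) q M)
    (hb₁ : ∀ y, |f y - c| * |∑' i, (τ (k + i) : ℝ) * (transOp P Y k (k + i) f y - c)|
      ≤ C * wt y ^ q)
    (hb₂ : ∀ y, |f y - c| * |φ y| ≤ C * wt y ^ q)
    (hle : ∀ y, |f y - c| * |(∑' i, (τ (k + i) : ℝ) * (transOp P Y k (k + i) f y - c)) - φ y|
      ≤ η * wt y ^ q + ε) :
    |∫ ω, (f (Y 0 k x ω) - c)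
        * (∑' i, (τ (k + i) : ℝ) * P[fun ω => f (Y 0 (k + i) x ω) - c | 𝒢 k] ω) ∂P
      - ∫ ω, (f (Y 0 k x ω) - c) * φ (Y 0 k x ω) ∂P| ≤ η * M + ε := by
  set ψ : E → ℝ := fun y => ∑' i, (τ (k + i) : ℝ) * (transOp P Y k (k + i) f y - c) with hψ
  have hψm : Measurable ψ := Measurable.tsum fun i =>
    ((hY.measurable_transOp' (Nat.le_add_right k i) hf).sub_const c).const_mul _
  have hYm := hY.measurable (Nat.zero_le k) x
  have hae : ∀ᵐ ω ∂P, (∑' i, (τ (k + i) : ℝ) * P[fun ω => f (Y 0 (k + i) x ω) - c | 𝒢 k] ω)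
      = ψ (Y 0 k x ω) := by
    filter_upwards [ae_all_iff.2 fun i => hY.condExp_sub_const_eq (Nat.zero_le k)
      (Nat.le_add_right k i) x hf c (hfi (k + i))] with ω h
    simp only [hψ, h]
  rw [integral_congr_ae (g := fun ω => (f (Y 0 k x ω) - c) * ψ (Y 0 k x ω))
    (hae.mono fun ω h => by simp only [h])]
  have hi₁ : Integrable (fun ω => (f (Y 0 k x ω) - c) * ψ (Y 0 k x ω)) P :=
    (hM.1.const_mul C).mono' ((((hf.sub_const c).mul hψm).comp hYm).aestronglyMeasurable)
      (Eventually.of_forall fun ω => by rw [norm_mul]; exact hb₁ _)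
  have hi₂ : Integrable (fun ω => (f (Y 0 k x ω) - c) * φ (Y 0 k x ω)) P :=
    (hM.1.const_mul C).mono' ((((hf.sub_const c).mul hφ).comp hYm).aestronglyMeasurable)
      (Eventually.of_forall fun ω => by rw [norm_mul]; exact hb₂ _)
  rw [← integral_sub hi₁ hi₂]
  calc _ ≤ ∫ ω, |(f (Y 0 k x ω) - c) * ψ (Y 0 k x ω) - (f (Y 0 k x ω) - c) * φ (Y 0 k x ω)| ∂P :=
        abs_integral_le_integral_abs
    _ ≤ ∫ ω, (η * wt (Y 0 k x ω) ^ q + ε) ∂P := by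
        refine integral_mono (hi₁.sub hi₂).abs ((hM.1.const_mul η).add (integrable_const ε))
          fun ω => ?_
        rw [← mul_sub, abs_mul]
        exact hle _
    _ = η * ∫ ω, wt (Y 0 k x ω) ^ q ∂P + ε := by
        rw [integral_add (hM.1.const_mul η) (integrable_const ε), integral_const_mul]; simp
    _ ≤ η * M + ε := by
        have := mul_le_mul_of_nonneg_left hM.2 hη
        linarith

end CorrectorComparison

/-! ### Martingale differences along the quasi-uniform subsequence -/

section QuasiDiff

variable {Ω E : Type*} {mΩ : MeasurableSpace Ω} [MeasurableSpace E]
  {P : Measure Ω} [IsProbabilityMeasure P] {ℱ : Filtration ℝ≥0 mΩ} {τ : ℕ → ℝ≥0}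
  {Y : ℕ → ℕ → E → Ω → E} {μ : Measure E} {f : E → ℝ} {x : E}

theorem martTerm_ae_eq (hfi : ∀ i, Integrable (fun ω => f (Y 0 i x ω)) P) (k : ℕ) :
    ∀ᵐ ω ∂P, ∀ i, martTerm P ℱ τ Y μ f x k i ω
      = (τ i : ℝ) * P[fun ω => f (Y 0 i x ω) - ∫ z, f z ∂μ | gridFiltration ℱ τ k] ω := by
  rw [ae_all_iff]
  intro i
  filter_upwards [condExp_sub (hfi i) (integrable_const (∫ z, f z ∂μ)) (gridFiltration ℱ τ k)]
    with ω h
  rw [martTerm]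
  congr 1
  have h3 := h
  rw [Pi.sub_apply, condExp_const ((gridFiltration ℱ τ).le k)] at h3
  exact h3.symm

/-- The series conditioned on `ℱ_0` cancels between consecutive terms, and `μ(f)` moves inside the
conditional expectations. -/
theorem quasiDiff_succ_ae_eq (hfi : ∀ i, Integrable (fun ω => f (Y 0 i x ω)) P) (k : ℕ) :
    quasiDiff P ℱ τ Y μ f x (k + 1) =ᵐ[P] fun ω =>
      (∑' i, (τ i : ℝ) * P[fun ω => f (Y 0 i x ω) - ∫ z, f z ∂μ |
        gridFiltration ℱ τ (quasiIndex τ (k + 1))] ω)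
      - ∑' i, (τ i : ℝ) * P[fun ω => f (Y 0 i x ω) - ∫ z, f z ∂μ |
        gridFiltration ℱ τ (quasiIndex τ k)] ω := by
  filter_upwards [martTerm_ae_eq (ℱ := ℱ) (τ := τ) (μ := μ) hfi (quasiIndex τ (k + 1)),
    martTerm_ae_eq (ℱ := ℱ) (τ := τ) (μ := μ) hfi (quasiIndex τ k)] with ω h1 h2
  simp only [quasiDiff, quasiMart, mart, h1, h2]
  ring

end QuasiDiff

end

/-! ### Proof of the proposition -/

theorem mainTheorem4 {Ω E : Type*} {mΩ : MeasurableSpace Ω}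
    [NormedAddCommGroup E] [NormedSpace ℝ E] [CompleteSpace E] [SecondCountableTopology E]
    [MeasurableSpace E] [BorelSpace E]
    (P : Measure Ω) [IsProbabilityMeasure P] (ℱ : Filtration ℝ≥0 mΩ)
    -- the exact process and its invariant measure
    (X : ℝ≥0 → ℝ≥0 → E → Ω → E) (hX : IsMarkovFamily P ℱ X) (hXhom : IsTimeHomogeneous P X)
    (μ : Measure E) [IsProbabilityMeasure μ] (hμ : IsInvariantMeasure P X μ)
    -- the time steps and the approximation
    (τ : ℕ → ℝ≥0) (hτ : IsStepSequence τ)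
    (Y : ℕ → ℕ → E → Ω → E) (hY : IsMarkovFamily P (gridFiltration ℱ τ) Y)
    -- the standing assumptions
    (r r' γ₁ β l l' q q' κ α : ℝ) (ρ ρτ : ℝ≥0 → ℝ≥0)
    (h1 : ExactAssumption P X r r' γ₁ β l l' ρ)
    (h2 : ApproxAssumption P Y τ q q' κ ρτ)
    (h3 : ConvergenceAssumption P X Y τ r' q' α)
    -- the exponent conditions
    (d p γ : ℝ) (hd : d = max (1 + β) (max r' q'))
    (hp1 : 1 ≤ p) (hp : p ≤ min r q) (hγ₁ : γ₁ ≤ γ) (hγ : γ ≤ 1)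
    (hexp1 : p / 2 * (1 + r') + (1 + β) * γ₁ ≤ r)
    (hexp2 : p * q' + 2 * d * γ ≤ q)
    (hexp3 : p / 2 + p * q' / 2 + γ * max d κ ≤ min r q)
    (hexp4 : p / 2 + max ((p / 2 + γ) * max r' q') ((p / 2 + l * γ) * r') ≤ r)
    -- the step conditions
    (hstep : StepConditions τ ρ ρτ γ α l')
    -- test function and initial value
    (f : E → ℝ) (hf : IsTestFunction p γ f) (x : E) :
    -- the objects in the limit are well defined
    (Integrable f μ ∧
      (∀ u : E, IntegrableOn
        (fun t : ℝ => transOp P X 0 t.toNNReal f u - ∫ y, f y ∂μ) (Set.Ioi 0)) ∧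
      Integrable (fun u => (f u - ∫ y, f y ∂μ) *
        (∫ t in Set.Ioi (0 : ℝ), (transOp P X 0 t.toNNReal f u - ∫ y, f y ∂μ))) μ ∧
      0 ≤ asymptoticVariance P X μ f ∧
      (∀ k, ∀ᵐ ω ∂P, Summable fun i => martTerm P ℱ τ Y μ f x k i ω) ∧
      ∀ k, MemLp (quasiDiff P ℱ τ Y μ f x k) 2 P) ∧
    -- the limit
    Tendsto (fun N : ℕ =>
        1 / (quasiTime τ N : ℝ) * ∑ k ∈ Finset.Icc 1 N, ∫ ω, |quasiDiff P ℱ τ Y μ f x k ω| ^ 2 ∂P)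
      atTop (𝓝 (limitConst P X μ f ^ 2)) := by
  -- exponents
  have hr2 := h1.r_ge
  have hr'1 := h1.r'_ge
  have hq2 := h2.q_ge
  have hq'1 := h2.q'_ge
  have hγ₁0 := h1.γ₁_pos
  have hγ0 : 0 < γ := hγ₁0.trans_le hγ₁
  have hp0 : 0 < p := by linarith
  have hpr : p ≤ r := hp.trans (min_le_left _ _)
  have hpq : p ≤ q := hp.trans (min_le_right _ _)
  have hβ := h1.β_nonneg
  have hl := h1.l_nonneg
  have hl' := h1.l'_pos
  have hα : 0 < α := hτ.α_pos h3.α_nonneg hstep.cond_i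
  have hd1 : 1 + β ≤ d := hd ▸ le_max_left _ _
  have hd2 : max r' q' ≤ d := hd ▸ le_max_right _ _
  have hd0 : 1 ≤ d := by linarith
  have hpq' : 0 ≤ q' * p / 2 := by positivity
  -- `A` is the growth exponent in `y` of the decay bounds: `q' * p / 2` comes from the moments, and
  -- `d * γ` covers both `(1 + β) * γ` from attractiveness and `max r' q' * γ` from strong
  -- convergence.
  obtain ⟨A, hA⟩ : ∃ A, A = q' * p / 2 + d * γ := ⟨_, rfl⟩
  have hdγ : 0 < d * γ := by positivity
  have hA0 : 0 ≤ A := by linarith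
  have hA2 : 2 * A ≤ q := by rw [hA]; linarith
  have hpA : p / 2 + A ≤ min r q := by
    have : γ * d ≤ γ * max d κ := by gcongr; exact le_max_left _ _
    rw [hA]; linarith
  have hpAr : p / 2 + A ≤ r := hpA.trans (min_le_left _ _)
  -- Strict, since `d * γ > 0` gives `p / 2 < A` and `2 * A ≤ q`. Truncation and weak convergence
  -- both live on this gap.
  have hpAq : p / 2 + A < q := by
    have : p ≤ q' * p := le_mul_of_one_le_left hp0.le hq'1
    rw [hA]; linarith
  have hAr : A ≤ r := by linarith
  have hexpA : ∀ g, 0 < g → g ≤ γ → g + (β * g + q' * p / 2) ≤ A := fun g hg hgγ => by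
    have : (1 + β) * g ≤ d * γ := mul_le_mul hd1 hgγ hg.le (by linarith)
    rw [hA]; linarith
  have hexpA' : max r' q' * γ + q' * p / 2 ≤ A := by
    have := mul_le_mul_of_nonneg_right hd2 hγ0.le
    rw [hA]; linarith
  have hexpreg : l * γ + r' * p / 2 ≤ r := by
    have h5 := le_max_right ((p / 2 + γ) * max r' q') ((p / 2 + l * γ) * r')
    have h6 : l * γ ≤ l * γ * r' := le_mul_of_one_le_right (by positivity) hr'1
    linarith
  have hs0 : 0 ≤ l' * γ := by positivity
  have hγα : 0 ≤ γ * α := by positivity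
  -- moments
  obtain ⟨C, hC, hMY⟩ := h2.exists_momentLE hY
  -- The growth rate `q'` passes from `Y` to `X`, so `A` need not contain `r' * p / 2` and remains
  -- controlled by `hexp2` and `hexp3`.
  have hMX := h3.momentLE_exact hα hτ h1 h2 hX hXhom hY hp0 hpr hpq hγ0 hγ hexpreg hMY
  have hMXp : ∀ t y, MomentLE P (X 0 t y) p (C * wt y ^ (q' * p)) := fun t y =>
    (hMX t y).lower hC hp0.le hpq (by linarith)
  have hMYp : ∀ m n y, m ≤ n → MomentLE P (Y m n y) p (C * wt y ^ (q' * p)) := fun m n y hmn =>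
    (hMY m n y hmn).lower hC hp0.le hpq (by linarith)
  have hMYs : ∀ s, 0 ≤ s → s ≤ q → ∀ k, MomentLE P (Y 0 k x) s (C * wt x ^ (q' * s)) :=
    fun s hs hsq k => (hMY 0 k x (Nat.zero_le k)).lower hC hs hsq (by linarith)
  obtain ⟨Cμ, hμr⟩ := h1.exists_momentLE_invariant hX hμ
  have hμs : ∀ s, 0 ≤ s → s ≤ r → MomentLE μ id s (Cμ ^ (s / r)) := fun s hs hsr =>
    hμr.mono_exp hs hsr (by linarith)
  -- decay of the exact semigroup and of the approximation
  have hdecX : ∀ (g : ℝ) (K : ℝ) (F : E → ℝ), 0 < g → g ≤ γ → HolderGrowth p g K F →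
      Integrable F μ ∧ ∃ D, 0 ≤ D ∧
        (∀ t y z, |transOp P X 0 t F y - transOp P X 0 t F z|
          ≤ D * ‖y - z‖ ^ g * (wt y * wt z) ^ (β * g + q' * p / 2) * (ρ t : ℝ) ^ g) ∧
        ∃ D', 0 ≤ D' ∧ ∀ t y, |transOp P X 0 t F y - ∫ z, F z ∂μ|
          ≤ D' * wt y ^ A * (ρ t : ℝ) ^ g := by
    intro g K F hg hgγ hF
    obtain ⟨D, hD, hDle⟩ := h1.exists_transOp_sub_le hX hF hp0 hg (hgγ.trans hγ)
      (by linarith : (0 : ℝ) ≤ q') hMXp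
    have he := hexpA g hg hgγ
    have hb : p / 2 ≤ g + (β * g + q' * p / 2) := by
      have : p ≤ q' * p := le_mul_of_one_le_left hp0.le hq'1
      have : 0 ≤ β * g := by positivity
      linarith
    have hm := hμs (g + (β * g + q' * p / 2)) (by positivity) (he.trans hAr)
    obtain ⟨hi, hle⟩ := exists_transOp_sub_integral_le hX hμ hF hg hD hb hm hDle
    refine ⟨hi, D, hD, hDle, _, mul_nonneg hD hm.nonneg, fun t y => (hle t y).trans ?_⟩
    have := mul_nonneg hD hm.nonneg
    have := wt_rpow_mono y he
    gcongr
  have hdecY : ∀ (K : ℝ) (F : E → ℝ), HolderGrowth p γ K F →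
      ∃ D, 0 ≤ D ∧ DecayBound P Y τ ρ μ γ α A D F := by
    intro K F hF
    obtain ⟨-, -, -, -, D, hD, hDle⟩ := hdecX γ K F hγ0 le_rfl hF
    obtain ⟨D', hD', hle⟩ := h3.exists_transOp_sub_le hX hXhom hY hF hp0 hγ0 hγ hr'1
      (by linarith) hMXp hMYp
    exact ⟨D + D', by positivity, decayBound_of_le hD hD' le_rfl hexpA' hDle hle⟩
  obtain ⟨K, hK⟩ := hf.exists_holderGrowth hp1 hγ0 le_rfl
  obtain ⟨K₁, hK₁⟩ := hf.exists_holderGrowth hp1 hγ₁0 hγ₁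
  obtain ⟨hfμ, D, hD, hDle, D₁, hD₁, hD₁le⟩ := hdecX γ₁ K₁ f hγ₁0 hγ₁ hK₁
  obtain ⟨DY, hDY, hdY⟩ := hdecY K f hK
  obtain ⟨D₂, hD₂, hD₂le⟩ := h3.exists_transOp_sub_le hX hXhom hY hK hp0 hγ0 hγ hr'1
    (by linarith) hMXp hMYp
  obtain ⟨D₃, hD₃, hD₃le⟩ := h1.exists_transOp_add_sub_le hX hXhom hK hp0 hγ0 hγ hpr hexpreg
  -- the corrector of the exact process
  set c := ∫ y, f y ∂μ with hc
  set u : ℝ≥0 → E → ℝ := fun t y => transOp P X 0 t f y - c with hu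
  set φ : E → ℝ := fun y => ∫ t in Set.Ioi (0 : ℝ), u t.toNNReal y with hφ
  have hut : ∀ y, Continuous fun t => u t y := fun y =>
    (continuous_transOp_of_regular (C := D₃ * wt y ^ (r' * r)) (mul_pos hl' hγ0)
      fun t h => hD₃le t h y).sub continuous_const
  have hφb := exactCorrector_bound hut h1.ρ_integrable hD₁le
  set I := D₁ * ∫ t in Set.Ioi (0 : ℝ), (ρ t.toNNReal : ℝ) ^ γ₁ with hI
  have hI0 : 0 ≤ I := mul_nonneg hD₁ (integral_nonneg fun t => by positivity)
  have hφc : Continuous φ := continuous_exactCorrector hγ₁0 hut h1.ρ_integrable hD₁le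
    fun t y z => by simpa only [hu, sub_sub_sub_cancel_right] using hDle t y z
  have hfc : ∀ y, |f y - c| ≤ (K + |c|) * wt y ^ (p / 2) := fun y => by
    have h5 := one_le_wt_rpow y (s := p / 2) (by linarith)
    have h6 := mul_le_mul_of_nonneg_left h5 (abs_nonneg c)
    have h7 := (abs_sub (f y) c).trans (add_le_add (hK.growth y) le_rfl)
    linarith
  have hK0 : 0 ≤ K + |c| := add_nonneg hK.nonneg (abs_nonneg c)
  have hprod : ∀ y : E, wt y ^ (p / 2) * wt y ^ A = wt y ^ (p / 2 + A) := fun y =>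
    (Real.rpow_add (wt_pos y) _ _).symm
  have hhb : ∀ y, |f y - c| * |φ y| ≤ ((K + |c|) * I) * wt y ^ (p / 2 + A) := fun y => by
    rw [← hprod]
    have := mul_le_mul (hfc y) (hφb y).2 (abs_nonneg _)
      (mul_nonneg hK0 (wt_rpow_pos y _).le)
    linarith
  have hfcont := hK.continuous hγ0
  set h : E → ℝ := fun y => (f y - c) * φ y with hh
  have hhc : Continuous h := (hfcont.sub continuous_const).mul hφc
  have hhμ : Integrable h μ :=
    ((hμs (p / 2 + A) (by positivity) hpAr).1.const_mul ((K + |c|) * I)).mono'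
      hhc.measurable.aestronglyMeasurable
      (Eventually.of_forall fun y => by rw [norm_mul]; exact hhb y)
  -- the sums along the approximation
  have hfi : ∀ i, Integrable (fun ω => f (Y 0 i x ω)) P := fun i =>
    hK.integrable (hY.measurable (Nat.zero_le i) x).aemeasurable
      (hMYs (p / 2) (by positivity) (by linarith) i)
  have hfsq : ∀ i ω, (f (Y 0 i x ω) - c) ^ 2 ≤ (K + |c|) ^ 2 * wt (Y 0 i x ω) ^ p := fun i ω => by
    rw [← sq_abs]
    calc _ ≤ ((K + |c|) * wt (Y 0 i x ω) ^ (p / 2)) ^ 2 := by gcongr; exact hfc _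
      _ = _ := by
          rw [mul_pow, ← Real.rpow_natCast (wt (Y 0 i x ω) ^ (p / 2)),
            ← Real.rpow_mul (wt_pos (Y 0 i x ω)).le]
          congr 2; push_cast; ring
  have hFm : ∀ i, Measurable[gridFiltration ℱ τ i] fun ω => f (Y 0 i x ω) - c := fun i =>
    (hK.meas.comp (hY.adapted 0 i x (Nat.zero_le i))).sub_const c
  have hFsq : ∀ i, Integrable (fun ω => (f (Y 0 i x ω) - c) ^ 2) P := fun i =>
    ((hMYs p hp0.le hpq i).1.const_mul _).mono'
      (((hK.meas.comp (hY.measurable (Nat.zero_le i) x)).sub_const c).pow_const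
        2).aestronglyMeasurable
      (Eventually.of_forall fun ω => by
        rw [Real.norm_of_nonneg (sq_nonneg _)]; exact hfsq i ω)
  have hF : ∀ i, MemLp (fun ω => f (Y 0 i x ω) - c) 2 P := fun i =>
    (memLp_two_iff_integrable_sq
      ((hK.meas.comp (hY.measurable (Nat.zero_le i) x)).sub_const c).aestronglyMeasurable).2
      (hFsq i)
  obtain ⟨B, hB⟩ := hstep.exists_sum_decay_le hγα hγ0.le
  have hcond : ∀ k i, 1 ≤ k → ‖condLp (gridFiltration ℱ τ) hF k (k + i)‖ ≤
      DY * √(C * wt x ^ (q' * (2 * A))) * ((ρ (gridTime τ (k + i) - gridTime τ k) : ℝ) ^ γ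
        + (τ (k + i) : ℝ) ^ (γ * α)) := fun k i hk =>
    norm_condLp_le_of_decayBound hY hDY hK.meas (hMYs (2 * A) (by linarith) hA2) hdY hfi hF hk
  have hcondτ : ∀ k i, 1 ≤ k → (τ (k + i) : ℝ) * ‖condLp (gridFiltration ℱ τ) hF k (k + i)‖ ≤
      DY * √(C * wt x ^ (q' * (2 * A))) * ((τ (k + i) : ℝ)
        * ((ρ (gridTime τ (k + i) - gridTime τ k) : ℝ) ^ γ + (τ (k + i) : ℝ) ^ (γ * α))) :=
    fun k i hk => by
      have := mul_le_mul_of_nonneg_left (hcond k i hk) (τ (k + i)).coe_nonneg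
      linarith
  have hcs : ∀ k, 1 ≤ k → Summable fun i =>
      (τ (k + i) : ℝ) * ‖condLp (gridFiltration ℱ τ) hF k (k + i)‖ := fun k hk =>
    Summable.of_nonneg_of_le (fun i => by positivity) (fun i => hcondτ k i hk)
      ((hB k).1.mul_left _)
  obtain ⟨hae, hmem, V, hV0, hVinc, B', hVle⟩ := exists_second_moment_martingale hF
    (fun i => (hFm i).stronglyMeasurable) hcs
    (B := DY * √(C * wt x ^ (q' * (2 * A))) * B) fun k hk => by
      refine ((hcs k hk).tsum_le_tsum (fun i => hcondτ k i hk) ((hB k).1.mul_left _)).trans ?_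
      rw [tsum_mul_left]
      exact mul_le_mul_of_nonneg_left (hB k).2 (by positivity)
  -- comparison of the correctors
  set s := l' * γ with hs
  set e := γ * α with he
  have hsumY : ∀ k y, 1 ≤ k →
      Summable (fun i => (τ (k + i) : ℝ) * (transOp P Y k (k + i) f y - c)) ∧
      |∑' i, (τ (k + i) : ℝ) * (transOp P Y k (k + i) f y - c)| ≤ DY * B * wt y ^ A := by
    intro k y hk
    have hle : ∀ i, ‖(τ (k + i) : ℝ) * (transOp P Y k (k + i) f y - c)‖ ≤ DY * wt y ^ A
        * ((τ (k + i) : ℝ) * ((ρ (gridTime τ (k + i) - gridTime τ k) : ℝ) ^ γ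
          + (τ (k + i) : ℝ) ^ e)) := fun i => by
      rw [norm_mul, Real.norm_of_nonneg (NNReal.coe_nonneg _), Real.norm_eq_abs]
      have := mul_le_mul_of_nonneg_left (hdY k (k + i) y hk (Nat.le_add_right k i))
        (τ (k + i)).coe_nonneg
      linarith
    have hsum := (hB k).1.mul_left (DY * wt y ^ A)
    refine ⟨Summable.of_norm_bounded hsum hle, ?_⟩
    have h5 := tsum_of_norm_bounded hsum.hasSum hle
    rw [tsum_mul_left] at h5
    refine h5.trans ((mul_le_mul_of_nonneg_left (hB k).2
      (mul_nonneg hDY (wt_rpow_pos y A).le)).trans (le_of_eq ?_))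
    ring
  have hB0 : 0 ≤ B := le_trans (tsum_nonneg fun i => by positivity) (hB 0).2
  set ε := correctorError τ (1 + e) (1 + s) with hε
  -- The exponent `r' * r`, inherited from time regularity, may exceed every moment of `Y`; `hcomp`
  -- only matters where the weight is bounded.
  obtain ⟨G, hG⟩ : ∃ G, G = max A (r' * r) := ⟨_, rfl⟩
  have hG0 : 0 ≤ G := by rw [hG]; exact hA0.trans (le_max_left _ _)
  have hcomp : ∀ k y, 1 ≤ k →
      |(∑' i, (τ (k + i) : ℝ) * (transOp P Y k (k + i) f y - c)) - φ y|
        ≤ (D₂ + D₁ * (ρ 0 : ℝ) ^ γ₁ + D₃) * wt y ^ G * ε k := by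
    intro k y hk
    have h5 := abs_tsum_sub_integral_le hτ (hut y) (D := D₃ * wt y ^ (r' * r))
      (D' := D₂ * wt y ^ (max r' q' * γ + q' * p / 2)) hs0 hγα
      (mul_nonneg hD₃ (wt_rpow_pos _ _).le) (mul_nonneg hD₂ (wt_rpow_pos _ _).le)
      (fun t h => by simpa only [hu, sub_sub_sub_cancel_right] using hD₃le t h y) (hφb y).1
      (v := fun i => transOp P Y k (k + i) f y - c) (k := k)
      (fun i => by
        simpa only [hu, sub_sub_sub_cancel_right] using
          hD₂le k (k + i) y hk (Nat.le_add_right k i))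
      (hsumY k y hk).1 hstep.summable_rpow_order
      (hstep.summable_rpow_regular hτ (by linarith))
    refine h5.trans (mul_le_mul_of_nonneg_right ?_ (correctorError_nonneg _ _ _ _))
    have w1 : wt y ^ (max r' q' * γ + q' * p / 2) ≤ wt y ^ G :=
      wt_rpow_mono y (hexpA'.trans (hG ▸ le_max_left _ _))
    have w2 : wt y ^ (r' * r) ≤ wt y ^ G := wt_rpow_mono y (hG ▸ le_max_right _ _)
    have w3 : wt y ^ A ≤ wt y ^ G := wt_rpow_mono y (hG ▸ le_max_left _ _)
    have w4 : |u 0 y| ≤ D₁ * wt y ^ G * (ρ 0 : ℝ) ^ γ₁ := (hD₁le 0 y).trans (by gcongr)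
    have w5 := mul_le_mul_of_nonneg_left w1 hD₂
    have w6 := mul_le_mul_of_nonneg_left w2 hD₃
    linarith
  set b : ℕ → ℝ := fun k => ∫ ω, h (Y 0 k x ω) ∂P with hb
  obtain ⟨M, hM⟩ : ∃ M, M = C * wt x ^ (q' * q) := ⟨_, rfl⟩
  have hMq : ∀ k, MomentLE P (Y 0 k x) q M := fun k => hM ▸ hMY 0 k x (Nat.zero_le k)
  have hM1 : 1 ≤ M := (hMq 0).one_le (by linarith)
  have hwq : ∀ y : E, wt y ^ (p / 2 + A) ≤ wt y ^ q := fun y => wt_rpow_mono y hpAq.le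
  have hcb : ∀ η : ℝ, 0 < η → ∃ C', 0 ≤ C' ∧ ∀ k, 1 ≤ k →
      |(∫ ω, (f (Y 0 k x ω) - c) * (∑' i, (τ (k + i) : ℝ)
        * P[fun ω => f (Y 0 (k + i) x ω) - c | gridFiltration ℱ τ k] ω) ∂P) - b k|
        ≤ η + C' * ε k := by
    intro η hη
    -- `η / M` because the `q`-th moments of `Y` are at most `M`, so integration returns `η`.
    obtain ⟨C', hC', hle⟩ := le_eta_add_of_wt_bounds (E := E)
      (C := (K + |c|) * (DY * B + I))
      (C₁ := (K + |c|) * (D₂ + D₁ * (ρ 0 : ℝ) ^ γ₁ + D₃)) (s := p / 2 + A) (q := q)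
      (B := p / 2 + G) (by positivity) hpAq (by positivity)
      (show 0 < η / M by positivity)
    refine ⟨C', hC', fun k hk => ?_⟩
    have hψ : ∀ y, |f y - c| * |∑' i, (τ (k + i) : ℝ) * (transOp P Y k (k + i) f y - c)|
        ≤ (K + |c|) * (DY * B) * wt y ^ (p / 2 + A) := fun y => by
      rw [← hprod]
      have := mul_le_mul (hfc y) (hsumY k y hk).2 (abs_nonneg _)
        (mul_nonneg hK0 (wt_rpow_pos y _).le)
      linarith
    have hDB : 0 ≤ (K + |c|) * (DY * B) := by positivity
    have hKI : 0 ≤ (K + |c|) * I := by positivity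
    have hmain := abs_integral_corrector_sub_le (τ := τ) (C := (K + |c|) * (DY * B + I))
      (η := η / M) (ε := C' * ε k) hY hK.meas hφc.measurable (c := c) (k := k) hfi
      (by positivity) (hMq k)
      (fun y => by
        have := mul_le_mul_of_nonneg_left (hwq y) hDB
        have := mul_nonneg hKI (wt_rpow_pos y q).le
        linarith [hψ y])
      (fun y => by
        have := mul_le_mul_of_nonneg_left (hwq y) hKI
        have := mul_nonneg hDB (wt_rpow_pos y q).le
        linarith [hhb y])
      (fun y => hle y _ _ (correctorError_nonneg _ _ _ _)
        (by
          have h5 := mul_le_mul_of_nonneg_left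
            (abs_sub (∑' i, (τ (k + i) : ℝ) * (transOp P Y k (k + i) f y - c)) (φ y))
            (abs_nonneg (f y - c))
          linarith [hψ y, hhb y])
        (by
          have h5 := mul_le_mul (hfc y) (hcomp k y hk) (abs_nonneg _)
            (mul_nonneg hK0 (wt_rpow_pos y _).le)
          rw [Real.rpow_add (wt_pos y)]
          refine h5.trans (le_of_eq ?_)
          ring))
    rwa [div_mul_cancel₀ η (by positivity)] at hmain
  -- convergence of the empirical laws
  have hprobs := isProbabilityMeasure_empiricalLaw (P := P) hτ hY x
  have hlip : LipschitzTendsto (empiricalLaw P Y τ x) μ :=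
    lipschitzTendsto_empiricalLaw hτ hY hstep hγα hγ0.le (hMYs A hA0 (by linarith) 1)
      fun g C L hC hL => hdecY _ g (HolderGrowth.of_lipschitz hp0.le hγ0 hγ hC hL)
  have hbbd : ∀ y, |h y| ≤ ((K + |c|) * I) * wt y ^ (p / 2 + A) := fun y => by
    rw [hh, abs_mul]; exact hhb y
  have hhi : ∀ k, Integrable (fun ω => h (Y 0 k x ω)) P := fun k =>
    ((hMYs (p / 2 + A) (by positivity) hpAq.le k).1.const_mul _).mono'
      (hhc.measurable.comp (hY.measurable (Nat.zero_le k) x)).aestronglyMeasurable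
      (Eventually.of_forall fun ω => hbbd _)
  have hblim : Tendsto (fun n => (∑ k ∈ Finset.range n, (τ k : ℝ) * b k) / gridTime τ n) atTop
      (𝓝 (∫ y, h y ∂μ)) := by
    refine tendsto_weighted_average hτ
      (B := (K + |c|) * I * (C * wt x ^ (q' * (p / 2 + A)))) (fun k => ?_) ?_
    · have h5 := hMYs (p / 2 + A) (by positivity) hpAq.le k
      calc |b k| ≤ ∫ ω, |h (Y 0 k x ω)| ∂P := abs_integral_le_integral_abs
        _ ≤ ∫ ω, ((K + |c|) * I) * wt (Y 0 k x ω) ^ (p / 2 + A) ∂P :=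
            integral_mono (hhi k).abs (h5.1.const_mul _) fun ω => hbbd _
        _ = ((K + |c|) * I) * ∫ ω, wt (Y 0 k x ω) ^ (p / 2 + A) ∂P := integral_const_mul _ _
        _ ≤ _ := mul_le_mul_of_nonneg_left h5.2 (by positivity)
    · have h5 := hlip.tendsto_of_growth (by positivity) hpAq
        (momentLE_empiricalLaw hτ hY hMq) hhc hbbd
      simpa only [(integral_empiricalLaw hY x _ hhc.measurable hhi).2] using h5
  have hVlim : Tendsto (fun n => V n / gridTime τ n) atTop (𝓝 (asymptoticVariance P X μ f)) :=
    tendsto_variance_of_corrector hτ hVle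
      (Be := (K + |c|) ^ 2 * (C * wt x ^ (q' * p)))
      (fun k => by
        rw [abs_of_nonneg (integral_nonneg fun ω => sq_nonneg _)]
        calc _ ≤ ∫ ω, (K + |c|) ^ 2 * wt (Y 0 k x ω) ^ p ∂P :=
              integral_mono (hFsq k) ((hMYs p hp0.le hpq k).1.const_mul _) (hfsq k)
          _ = (K + |c|) ^ 2 * ∫ ω, wt (Y 0 k x ω) ^ p ∂P := integral_const_mul _ _
          _ ≤ _ := mul_le_mul_of_nonneg_left (hMYs p hp0.le hpq k).2 (by positivity))
      (hstep.tendsto_correctorError hτ (by linarith)) hcb hblim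
  -- conclusion
  have hVnn : ∀ n, 0 ≤ V n := fun n => by
    have := hVinc 0 n (Nat.zero_le n)
    rw [hV0, sub_zero] at this
    rw [← this]
    exact integral_nonneg fun ω => sq_nonneg _
  -- The sign of the radicand is read off from the second moments that converge to it.
  have hvar : 0 ≤ asymptoticVariance P X μ f :=
    ge_of_tendsto' hVlim fun n => div_nonneg (hVnn n) (NNReal.coe_nonneg _)
  refine ⟨⟨hfμ, fun y => (hφb y).1, hhμ, hvar, fun k => ?_, fun k => ?_⟩, ?_⟩
  · filter_upwards [hae k, martTerm_ae_eq (ℱ := ℱ) (τ := τ) (μ := μ) hfi k] with ω h5 h6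
    simpa only [h6] using h5
  · cases k with
    | zero => exact MemLp.zero
    | succ k =>
      exact (memLp_congr_ae (quasiDiff_succ_ae_eq hfi k)).2 ((hmem _).sub (hmem _))
  · have hinc : ∀ k, ∫ ω, |quasiDiff P ℱ τ Y μ f x (k + 1) ω| ^ 2 ∂P
        = V (quasiIndex τ (k + 1)) - V (quasiIndex τ k) := fun k => by
      rw [← hVinc _ _ (quasiIndex_mono hτ (Nat.le_succ k))]
      refine integral_congr_ae ?_
      filter_upwards [quasiDiff_succ_ae_eq (ℱ := ℱ) (τ := τ) (μ := μ) hfi k] with ω h5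
      rw [h5, sq_abs]
    -- Increments telescope, so the claim is `hVlim` along the subsequence `quasiIndex τ N`.
    have hsum : ∀ N, ∑ k ∈ Finset.Icc 1 N, ∫ ω, |quasiDiff P ℱ τ Y μ f x k ω| ^ 2 ∂P
        = V (quasiIndex τ N) := fun N => by
      induction N with
      | zero => simp [quasiIndex_zero hτ, hV0]
      | succ N ih => rw [Finset.sum_Icc_succ_top (by omega), ih, hinc]; ring
    rw [limitConst, Real.sq_sqrt hvar]
    refine (hVlim.comp (tendsto_quasiIndex hτ)).congr fun N => ?_
    rw [hsum, quasiTime, Function.comp_apply, one_div, div_eq_inv_mul]
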